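/- Let $\Bbbk$ be a commutative ring, $n\in\mathbb{N}_0$, $\delta\in\Bbbk$, and let $\delta'\in\Bbbk^{\times}$ be a unit. **Algebras.** A partial Brauer diagram is a partition of $\{1,\dots,n\}\cup\{1',\dots,n'\}$ into pairs and singletons; it is a Brauer diagram if it has no singletons. The product $dd'$ is obtained by placing $d$ to the left of $d'$, identifying the right vertices of $d$ with the left vertices of $d'$, and replacing each closed loop removed from the middle by the factor $\delta$ and each open string removed from the middle (a chain ending in two singletons) by the factor $\delta'$; we write $d\circ d'$ for the resulting diagram without the factor. The partial Brauer algebra $\mathfrak{R}_n=\mathfrak{R}_n(\delta,\delta')$ is the free $\Bbbk$-module on partial Brauer diagrams with this product, and the Brauer algebra $\mathfrak{B}_n(\delta)$ is the one on Brauer diagrams. **Specht modules.** Two diagrams are in the same left cell if they have the same parts contained in $\{1',\dots,n'\}$. For a left cell $\mathcal{L}$, the cell module $\mathbf{C}_{\mathcal{L}}$ is the free $\Bbbk$-module on $\mathcal{L}$ with $d\cdot x=dx$ if $d\circ x\in\mathcal{L}$ and $d\cdot x=0$ otherwise. Put $\mathcal{L}^{\mathfrak{B}}=\mathcal{L}\cap\{\text{Brauer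 diagrams}\}$, with the $\mathfrak{B}_n$-module $\mathbf{C}_{\mathcal{L}^{\mathfrak{B}}}$ defined in the same way. All diagrams in $\mathcal{L}$ have the same number $k$ of propagating lines (pairs meeting both sides), called the propagating number of $\mathcal{L}$; the group $S_k$ acts on $\mathbf{C}_{\mathcal{L}}$ and $\mathbf{C}_{\mathcal{L}^{\mathfrak{B}}}$ from the right by permuting the right ends of the propagating lines. For $\lambda\vdash k$ let $\mathcal{S}_{\Bbbk}(\lambda)=\Bbbk\otimes_{\mathbb{Z}}\mathcal{S}_{\mathbb{Z}}(\lambda)$, where $\mathcal{S}_{\mathbb{Z}}(\lambda)$ is the integral Specht module of $S_k$, spanned by the polytabloids. The Specht modules are $\Delta(\lambda)=\mathbf{C}_{\mathcal{L}}\otimes_{\Bbbk[S_k]}\mathcal{S}_{\Bbbk}(\lambda)$ for $\mathfrak{R}_n$, and $\Delta^{\mathfrak{B}}(n,\lambda)=\mathbf{C}_{\mathcal{L}^{\mathfrak{B}}}\otimes_{\Bbbk[S_k]}\mathcal{S}_{\Bbbk}(\lambda)$, for $\mathcal{L}^{\mathfrak{B}}\neq\varnothing$, for $\mathfrak{B}_n$.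 **Functors.** Let $u_{n,i}$ be the diagram with singletons $\{i\},\{i'\}$ and pairs $\{j,j'\}$ for $j\ne i$; put $\hat u_{n,i}=1-\frac{1}{\delta'}u_{n,i}$ and $\hat u_n=\hat u_{n,1}\cdots\hat u_{n,n}$. For a diagram $d$ let $\langle d\rangle=\big(\prod_{i}\hat u_{n,i}\big)\,d\,\big(\prod_{j}\hat u_{n,j}\big)$, where $i$ and $j$ run over those indices for which $i$, respectively $j'$, is not a singleton of $d$. In rank $n+1$ put $\omega=\langle u_{n+1,1}\rangle\in\mathfrak{R}_{n+1}$ and $e_\omega=\frac{1}{\delta'}\omega$, so that $\mathfrak{R}_{n+1}e_\omega=\mathfrak{R}_{n+1}\omega$. For a Brauer diagram $d$ of rank $n$ let $\varphi(d)$ be the diagram of rank $n+1$ with the singletons $\{1\},\{1'\}$ and the parts of $d$ with all indices raised by one. **Proposition.** The elements $\hat u_n$ and $e_\omega$ are idempotent, and there are isomorphisms of rings $\hat u_n\mathfrak{R}_n\hat u_n\cong\mathfrak{B}_n(\delta-1)$ and $e_\omega\mathfrak{R}_{n+1}e_\omega\cong\mathfrak{B}_n(\delta-1)$ under which, for each $r\in\Bbbk$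 and each Brauer diagram $d$, the elements $r\langle d\rangle$ and $\frac{r}{\delta'}\langle\varphi(d)\rangle$, respectively, correspond to $rd$. Regard, through these, $$\mathrm{F}=\mathrm{Hom}_{\mathfrak{R}_n}(\mathfrak{R}_n\hat u_n,-)\quad\text{and}\quad \mathrm{F}_\omega=\mathrm{Hom}_{\mathfrak{R}_{n+1}}(\mathfrak{R}_{n+1}\omega,-)$$ as functors from $\mathfrak{R}_n$-modules, respectively $\mathfrak{R}_{n+1}$-modules, to $\mathfrak{B}_n(\delta-1)$-modules. Then both map Specht modules to Specht modules or to zero. Precisely, let $\mathcal{L}$ be a left cell with propagating number $k$, let $\lambda\vdash k$, and define $\Delta(\lambda)$ by means of $\mathcal{L}$. 1. Let $\mathcal{L}$ be of rank $n$. If $n-k$ is even, there is a left cell $\mathcal{M}$ of rank $n$ with propagating number $k$ and $\mathcal{M}^{\mathfrak{B}}\ne\varnothing$, and for each such $\mathcal{M}$ we have $\mathrm{F}\,\mathbf{C}_{\mathcal{L}}\cong\mathbf{C}_{\mathcal{M}^{\mathfrak{B}}}$ and $\mathrm{F}\,\Delta(\lambda)\cong\Delta^{\mathfrak{B}}(n,\lambda)$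 (defined by means of $\mathcal{M}$); in particular $\mathrm{F}\,\mathbf{C}_{\mathcal{L}}\cong\mathbf{C}_{\mathcal{L}^{\mathfrak{B}}}$ if $\mathcal{L}^{\mathfrak{B}}\neq\varnothing$. If $n-k$ is odd, then $\mathrm{F}\,\mathbf{C}_{\mathcal{L}}=0$ and $\mathrm{F}\,\Delta(\lambda)=0$. 2. Let $\mathcal{L}$ be of rank $n+1$. If $n+1-k$ is odd, there is a left cell $\mathcal{M}$ of rank $n$ with propagating number $k$ and $\mathcal{M}^{\mathfrak{B}}\ne\varnothing$, and for each such $\mathcal{M}$ we have $\mathrm{F}_\omega\,\mathbf{C}_{\mathcal{L}}\cong\mathbf{C}_{\mathcal{M}^{\mathfrak{B}}}$ and $\mathrm{F}_\omega\,\Delta(\lambda)\cong\Delta^{\mathfrak{B}}(n,\lambda)$ (defined by means of $\mathcal{M}$). If $n+1-k$ is even, then $\mathrm{F}_\omega\,\mathbf{C}_{\mathcal{L}}=0$ and $\mathrm{F}_\omega\,\Delta(\lambda)=0$. Here all Brauer algebra modules are modules over $\mathfrak{B}_n(\delta-1)$. -/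

import Mathlib

set_option linter.unnecessarySimpa false
set_option linter.unusedSimpArgs false

namespace PartialBrauer

/-! ### Straightening

A diagram is recorded by the involution `f` which sends a vertex to its partner, and a vertex
without a partner (a singleton) to itself. A juxtaposition of diagrams is such an involution
together with a list of pairs `(a, b)` of vertices; the members of a pair are the two copies of
one vertex of the equator, and are to be identified. Straightening removes the vertices of the
equator one by one. -/

section Joining

/-- Identify the vertices `a` and `b` and remove the resulting vertex of the equator.
If `a` and `b` both have partners, outside of `{a, b}`, these become partners of each other; if
only one of them has a partner, that partner becomes a singleton; if `a` and `b` are partners of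
each other (a closed loop) or are both singletons (an open string), then the component just
disappears. The removed vertices `a` and `b` are kept in the type as fixed points, that play no
further role. -/
def joinEnds {A : Type*} [DecidableEq A] (f : A → A) (a b x : A) : A :=
  if x = a ∨ x = b then x
  else if f x = a then (if f b = b then x else f b)
  else if f x = b then (if f a = a then x else f a)
  else f x

/-- The result of removing all the pairs in the list. -/
def straighten {A : Type*} [DecidableEq A] (f : A → A) : List (A × A) → A → A
  | [] => f
  | p :: l => straighten (joinEnds f p.1 p.2) l

/-- The number of closed loops removed in the course of straightening. -/
def numLoops {A : Type*} [DecidableEq A] (f : A → A) : List (A × A) → ℕ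
  | [] => 0
  | p :: l => (if f p.1 = p.2 then 1 else 0) + numLoops (joinEnds f p.1 p.2) l

/-- The number of open strings removed in the course of straightening (an open string
is a component inside the equator that ends in two singletons). -/
def numStrings {A : Type*} [DecidableEq A] (f : A → A) : List (A × A) → ℕ
  | [] => 0
  | p :: l => (if f p.1 = p.1 ∧ f p.2 = p.2 then 1 else 0) +
      numStrings (joinEnds f p.1 p.2) l

/-- The entries of the pairs in the list. -/
def ends {A : Type*} (l : List (A × A)) : List A := l.flatMap fun p => [p.1, p.2]

theorem joinEnds_invol {A : Type*} [DecidableEq A] {f : A → A} (hf : Function.Involutive f)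
    (a b : A) (hab : a ≠ b) : Function.Involutive (joinEnds f a b) := by
  intro x
  have h1 := hf x
  have h2 := hf a
  have h3 := hf b
  unfold joinEnds
  grind

theorem joinEnds_fix {A : Type*} [DecidableEq A] {f : A → A} {a b x : A}
    (h : f x = x ∨ x = a ∨ x = b) : joinEnds f a b x = x := by
  unfold joinEnds
  grind

theorem joinEnds_keep {A : Type*} [DecidableEq A] {f : A → A} {a b x : A}
    (ha : x ≠ a) (hb : x ≠ b) (ha' : f x ≠ a) (hb' : f x ≠ b) : joinEnds f a b x = f x := by
  unfold joinEnds
  grind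

theorem joinEnds_comm {A : Type*} [DecidableEq A] {f : A → A} (hf : Function.Involutive f)
    {a b c d : A} (hab : a ≠ b) (hac : a ≠ c) (had : a ≠ d) (hbc : b ≠ c) (hbd : b ≠ d)
    (hcd : c ≠ d) :
    joinEnds (joinEnds f a b) c d = joinEnds (joinEnds f c d) a b := by
  funext x
  have h0 := hf x
  have h1 := hf a
  have h2 := hf b
  have h3 := hf c
  have h4 := hf d
  unfold joinEnds
  grind (splits := 30)

theorem loops_comm {A : Type*} [DecidableEq A] {f : A → A} (hf : Function.Involutive f)
    {a b c d : A} (hab : a ≠ b) (hac : a ≠ c) (had : a ≠ d) (hbc : b ≠ c) (hbd : b ≠ d)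
    (hcd : c ≠ d) :
    (if f a = b then 1 else 0) + (if joinEnds f a b c = d then 1 else 0) =
    (if f c = d then 1 else 0) + (if joinEnds f c d a = b then 1 else 0) := by
  have h1 := hf a
  have h2 := hf b
  have h3 := hf c
  have h4 := hf d
  unfold joinEnds
  grind (splits := 30)

theorem strings_comm {A : Type*} [DecidableEq A] {f : A → A} (hf : Function.Involutive f)
    {a b c d : A} (hab : a ≠ b) (hac : a ≠ c) (had : a ≠ d) (hbc : b ≠ c) (hbd : b ≠ d)
    (hcd : c ≠ d) :
    (if f a = a ∧ f b = b then 1 else 0) +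
      (if joinEnds f a b c = c ∧ joinEnds f a b d = d then 1 else 0) =
    (if f c = c ∧ f d = d then 1 else 0) +
      (if joinEnds f c d a = a ∧ joinEnds f c d b = b then 1 else 0) := by
  have h1 := hf a
  have h2 := hf b
  have h3 := hf c
  have h4 := hf d
  unfold joinEnds
  grind (splits := 30)
theorem straighten_invol {A : Type*} [DecidableEq A] (l : List (A × A)) (hl : (ends l).Nodup)
    {f : A → A} (hf : Function.Involutive f) : Function.Involutive (straighten f l) := by
  induction l generalizing f with
  | nil => exact hf
  | cons p l ih =>
    have h2 : p.1 ≠ p.2 ∧ (ends l).Nodup := by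
      simp only [ends, List.flatMap_cons, List.cons_append, List.nil_append,
        List.nodup_cons, List.mem_cons] at hl ⊢
      tauto
    exact ih h2.2 (joinEnds_invol hf _ _ h2.1)

theorem straighten_fix {A : Type*} [DecidableEq A] (l : List (A × A)) {f : A → A} {x : A}
    (h : f x = x ∨ x ∈ ends l) : straighten f l x = x := by
  induction l generalizing f with
  | nil => simpa [ends, straighten] using h
  | cons p l ih =>
    refine ih ?_
    simp only [ends, List.flatMap_cons, List.cons_append, List.nil_append, List.mem_cons] at h ⊢
    by_cases hx : x ∈ List.flatMap (fun p : A × A => [p.1, p.2]) l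
    · exact Or.inr hx
    · exact Or.inl (joinEnds_fix (by tauto))

theorem straighten_keep {A : Type*} [DecidableEq A] (l : List (A × A)) {f : A → A} {x : A}
    (hx : x ∉ ends l) (hfx : f x ∉ ends l) : straighten f l x = f x := by
  induction l generalizing f with
  | nil => rfl
  | cons p l ih =>
    simp only [ends, List.flatMap_cons, List.cons_append, List.nil_append, List.mem_cons,
      not_or] at hx hfx ih
    have : joinEnds f p.1 p.2 x = f x := joinEnds_keep hx.1 hx.2.1 hfx.1 hfx.2.1
    rw [← this]
    exact ih hx.2.2 (by rw [this]; exact hfx.2.2)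

theorem straighten_perm {A : Type*} [DecidableEq A] {l l' : List (A × A)} (h : l.Perm l')
    (hl : (ends l).Nodup) {f : A → A} (hf : Function.Involutive f) :
    straighten f l = straighten f l' ∧ numLoops f l = numLoops f l' ∧
      numStrings f l = numStrings f l' := by
  induction h generalizing f with
  | nil => exact ⟨rfl, rfl, rfl⟩
  | cons p _ ih =>
    simp only [ends, List.flatMap_cons, List.cons_append, List.nil_append,
        List.nodup_cons, List.mem_cons] at hl ih
    obtain ⟨h1, h2, h3⟩ := ih (by tauto) (joinEnds_invol hf p.1 p.2 (by tauto))
    simp only [straighten, numLoops, numStrings, h1, h2, h3, and_self]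
  | swap p q l =>
    simp only [ends, List.flatMap_cons, List.cons_append, List.nil_append,
        List.nodup_cons, List.mem_cons] at hl
    have hab : p.1 ≠ p.2 := by tauto
    have hac : p.1 ≠ q.1 := by tauto
    have had : p.1 ≠ q.2 := by tauto
    have hbc : p.2 ≠ q.1 := by tauto
    have hbd : p.2 ≠ q.2 := by tauto
    have hcd : q.1 ≠ q.2 := by tauto
    have e1 := joinEnds_comm hf hab hac had hbc hbd hcd
    have e2 := loops_comm hf hab hac had hbc hbd hcd
    have e3 := strings_comm hf hab hac had hbc hbd hcd
    simp only [straighten, numLoops, numStrings, e1, ← add_assoc, e2, e3, and_self]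
  | trans h12 _ ih1 ih2 =>
    have hl2 : (ends _).Nodup := ((h12.flatMap_right _).nodup_iff).1 hl
    obtain ⟨a1, a2, a3⟩ := ih1 hl hf
    obtain ⟨b1, b2, b3⟩ := ih2 hl2 hf
    exact ⟨a1.trans b1, a2.trans b2, a3.trans b3⟩

theorem straighten_append {A : Type*} [DecidableEq A] (l l' : List (A × A)) (f : A → A) :
    straighten f (l ++ l') = straighten (straighten f l) l' ∧
    numLoops f (l ++ l') = numLoops f l + numLoops (straighten f l) l' ∧
    numStrings f (l ++ l') = numStrings f l + numStrings (straighten f l) l' := by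
  induction l generalizing f with
  | nil => simp [straighten, numLoops, numStrings]
  | cons p l ih =>
    obtain ⟨h1, h2, h3⟩ := ih (joinEnds f p.1 p.2)
    simp only [List.cons_append, straighten, numLoops, numStrings, h1, h2, h3, add_assoc, and_self]

theorem straighten_embed {A B : Type*} [DecidableEq A] [DecidableEq B] {e : A → B}
    (he : Function.Injective e) (l : List (A × A)) {f : A → A} {g : B → B}
    (h : ∀ x, g (e x) = e (f x)) :
    (∀ x, straighten g (l.map fun p => (e p.1, e p.2)) (e x) = e (straighten f l x)) ∧
    numLoops g (l.map fun p => (e p.1, e p.2)) = numLoops f l ∧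
    numStrings g (l.map fun p => (e p.1, e p.2)) = numStrings f l := by
  induction l generalizing f g with
  | nil => exact ⟨h, rfl, rfl⟩
  | cons p l ih =>
    have key : ∀ x, joinEnds g (e p.1) (e p.2) (e x) = e (joinEnds f p.1 p.2 x) := by
      intro x
      simp only [joinEnds, h, he.eq_iff]
      split_ifs <;> rfl
    obtain ⟨h1, h2, h3⟩ := ih key
    simp only [List.map_cons, straighten, numLoops, numStrings, h1, h2, h3, h, he.eq_iff,
      implies_true, and_self]

theorem straighten_ne {A : Type*} [DecidableEq A] (l : List (A × A)) (hl : (ends l).Nodup)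
    {f : A → A} (hf : Function.Involutive f) (hne : ∀ x, x ∈ ends l → f x ≠ x)
    {x : A} (hx : f x ≠ x) (hxl : x ∉ ends l) :
    straighten f l x ≠ x ∧ numStrings f l = 0 := by
  induction l generalizing f with
  | nil => exact ⟨hx, rfl⟩
  | cons p l ih =>
    simp only [ends, List.flatMap_cons, List.cons_append, List.nil_append,
        List.nodup_cons, List.mem_cons, not_or] at hl hne hxl ih
    have hp : p.1 ≠ p.2 := by tauto
    have h1 := hne p.1 (Or.inl rfl)
    have h2 := hne p.2 (Or.inr (Or.inl rfl))
    have stay : ∀ y, f y ≠ y → y ≠ p.1 → y ≠ p.2 → joinEnds f p.1 p.2 y ≠ y := by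
      intro y hy hy1 hy2
      have := hf y
      have := hf p.1
      have := hf p.2
      unfold joinEnds
      grind
    have := ih (by tauto) (joinEnds_invol hf p.1 p.2 hp)
      (fun y hy => stay y (hne y (by tauto)) (by rintro rfl; tauto) (by rintro rfl; tauto))
      (stay x hx (by tauto) (by tauto)) (by tauto)
    refine ⟨this.1, ?_⟩
    simp [numStrings, h1, this.2]
end Joining

/-! ### Partial Brauer diagrams -/

/-- A partial Brauer diagram: a partition of `{1, …, n} ∪ {1', …, n'}` into singletons and pairs,
given by the involution that exchanges the two elements of each pair and fixes the singletons.
The vertex `i` on the left is `Sum.inl i`, the vertex `i'` on the right is `Sum.inr i`. -/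
@[ext]
structure Diagram (n : ℕ) where
  partner : Fin n ⊕ Fin n → Fin n ⊕ Fin n
  partner_partner : ∀ x, partner (partner x) = x

/-- The juxtaposition of `d` (on the left) and `d'` (on the right), before the right side of
`d` and the left side of `d'` are identified. -/
def juxtapose {n : ℕ} (d d' : Diagram n) :
    (Fin n ⊕ Fin n) ⊕ (Fin n ⊕ Fin n) → (Fin n ⊕ Fin n) ⊕ (Fin n ⊕ Fin n) :=
  Sum.map d.partner d'.partner

/-- The pairs of vertices to be identified: `i'` of the left diagram with `i` of the right one. -/
def equator (n : ℕ) : List (((Fin n ⊕ Fin n) ⊕ (Fin n ⊕ Fin n)) × ((Fin n ⊕ Fin n) ⊕ (Fin n ⊕ Fin n))) :=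
  (List.finRange n).map fun i => (Sum.inl (Sum.inr i), Sum.inr (Sum.inl i))

/-- The vertices on the exterior of a juxtaposition. -/
def outer {n : ℕ} : Fin n ⊕ Fin n → (Fin n ⊕ Fin n) ⊕ (Fin n ⊕ Fin n)
  | Sum.inl i => Sum.inl (Sum.inl i)
  | Sum.inr j => Sum.inr (Sum.inr j)

/-- Left inverse to `outer`, with arbitrary values on the equator. -/
def unouter {n : ℕ} : (Fin n ⊕ Fin n) ⊕ (Fin n ⊕ Fin n) → Fin n ⊕ Fin n
  | Sum.inl (Sum.inl i) => Sum.inl i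
  | Sum.inl (Sum.inr i) => Sum.inl i
  | Sum.inr (Sum.inl j) => Sum.inr j
  | Sum.inr (Sum.inr j) => Sum.inr j

/-- The partner map of the straightened juxtaposition. -/
def composePartner {n : ℕ} (d d' : Diagram n) (x : Fin n ⊕ Fin n) : Fin n ⊕ Fin n :=
  unouter (straighten (juxtapose d d') (equator n) (outer x))

theorem juxtapose_invol {n : ℕ} (d d' : Diagram n) : Function.Involutive (juxtapose d d') := by
  rintro (x | x) <;> simp [juxtapose, Diagram.partner_partner]

theorem mem_ends_equator {n : ℕ} (x : (Fin n ⊕ Fin n) ⊕ (Fin n ⊕ Fin n)) :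
    x ∈ ends (equator n) ↔ ∀ y, x ≠ outer y := by
  rcases x with (x | x) | (x | x) <;> simp [ends, equator, outer]

theorem ends_nodup {B : Type*} {n : ℕ} (p q : Fin n → B) (hp : Function.Injective p)
    (hq : Function.Injective q) (hpq : ∀ i j, p i ≠ q j) :
    (ends ((List.finRange n).map fun i => (p i, q i))).Nodup := by
  have h := List.nodup_finRange n
  revert h
  generalize List.finRange n = l
  intro h
  induction l with
  | nil => simp [ends]
  | cons i l ih =>
    have h' := List.nodup_cons.1 h
    have ih := ih h'.2
    simp only [ends, List.map_cons, List.flatMap_cons, List.cons_append, List.nil_append,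
      List.nodup_cons, List.mem_cons, List.mem_flatMap, List.mem_map, List.not_mem_nil, or_false, not_or, not_exists, not_and,
      forall_exists_index, and_imp] at ih ⊢
    refine ⟨⟨hpq i i, ?_⟩, ?_, ih⟩
    · rintro _ j hj rfl
      exact ⟨fun hh => h'.1 (by rw [hp hh]; exact hj), fun hh => hpq i j hh⟩
    · rintro _ j hj rfl
      exact ⟨fun hh => hpq j i hh.symm, fun hh => h'.1 (by rw [hq hh]; exact hj)⟩

theorem equator_nodup (n : ℕ) : (ends (equator n)).Nodup :=
  ends_nodup _ _ (fun i j h => by simpa using h) (fun i j h => by simpa using h) (by simp)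

theorem outer_composePartner {n : ℕ} (d d' : Diagram n) (x : Fin n ⊕ Fin n) :
    outer (composePartner d d' x) = straighten (juxtapose d d') (equator n) (outer x) := by
  have hinv := straighten_invol _ (equator_nodup n) (juxtapose_invol d d')
  have hx : straighten (juxtapose d d') (equator n) (outer x) ∉ ends (equator n) := by
    intro h
    have h1 := straighten_fix (f := juxtapose d d') _ (Or.inr h)
    rw [hinv (outer x)] at h1
    rw [← h1, mem_ends_equator] at h
    exact h x rfl
  rw [mem_ends_equator] at hx
  push Not at hx
  obtain ⟨y, hy⟩ := hx
  rw [composePartner, hy]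
  rcases y with y | y <;> rfl

theorem outer_injective {n : ℕ} : Function.Injective (outer (n := n)) := by
  rintro (x | x) (y | y) h <;> simpa [outer] using h

/-- The diagram `d ∘ d'` obtained by straightening the juxtaposition of `d` and `d'`. -/
def compose {n : ℕ} (d d' : Diagram n) : Diagram n where
  partner := composePartner d d'
  partner_partner x := outer_injective (by
    rw [outer_composePartner, outer_composePartner]
    exact straighten_invol _ (equator_nodup n) (juxtapose_invol d d') _)

/-- The number of closed loops removed when the juxtaposition of `d` and `d'` is straightened. -/
def loops {n : ℕ} (d d' : Diagram n) : ℕ := numLoops (juxtapose d d') (equator n)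
/-- The number of open strings removed when the juxtaposition of `d` and `d'` is straightened. -/
def strings {n : ℕ} (d d' : Diagram n) : ℕ := numStrings (juxtapose d d') (equator n)


/-- The two ways to straighten the juxtaposition of three diagrams `a`, `b`, `c` agree. -/
theorem compose_assoc {n : ℕ} (a b c : Diagram n) :
    (∀ x, (compose (compose a b) c).partner x = (compose a (compose b c)).partner x) ∧
    loops a b + loops (compose a b) c = loops b c + loops a (compose b c) ∧
    strings a b + strings (compose a b) c = strings b c + strings a (compose b c) := by
  let A := Fin n ⊕ Fin n
  let F : A ⊕ (A ⊕ A) → A ⊕ (A ⊕ A) := Sum.map a.partner (Sum.map b.partner c.partner)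
  have hF : Function.Involutive F := by
    rintro (x | x | x) <;> simp [F, Diagram.partner_partner]
  let e₁ : A ⊕ A → A ⊕ (A ⊕ A) := Sum.elim Sum.inl (fun q => Sum.inr (Sum.inl q))
  let e₂ : A ⊕ A → A ⊕ (A ⊕ A) :=
    Sum.elim (Sum.elim (fun x => Sum.inl (Sum.inl x)) (fun z => Sum.inr (Sum.inl (Sum.inr z))))
      (fun q => Sum.inr (Sum.inr q))
  let e₃ : A ⊕ A → A ⊕ (A ⊕ A) := Sum.inr
  let e₄ : A ⊕ A → A ⊕ (A ⊕ A) :=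
    Sum.elim Sum.inl (Sum.elim (fun x => Sum.inr (Sum.inl (Sum.inl x)))
      (fun z => Sum.inr (Sum.inr (Sum.inr z))))
  have i₁ : Function.Injective e₁ := by
    rintro (x | x) (y | y) h <;> simpa [e₁] using h
  have i₂ : Function.Injective e₂ := by
    rintro ((x | x) | x) ((y | y) | y) h <;> simpa [e₂] using h
  have i₃ : Function.Injective e₃ := Sum.inr_injective
  have i₄ : Function.Injective e₄ := by
    rintro (x | x | x) (y | y | y) h <;> simpa [e₄] using h
  set l₁ := (equator n).map fun p => (e₁ p.1, e₁ p.2) with hl₁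
  set l₂ := (equator n).map fun p => (e₂ p.1, e₂ p.2) with hl₂
  have hl₃ : (equator n).map (fun p => (e₃ p.1, e₃ p.2)) = l₂ := by
    simp [hl₂, equator, e₂, e₃]
  have hl₄ : (equator n).map (fun p => (e₄ p.1, e₄ p.2)) = l₁ := by
    simp [hl₁, equator, e₁, e₄]
  have hends : (ends (l₁ ++ l₂)).Nodup := by
    have hm : ∀ (e : A ⊕ A → A ⊕ (A ⊕ A)),
        ends ((equator n).map fun p => (e p.1, e p.2)) = (ends (equator n)).map e := by
      intro e
      simp [ends, List.map_flatMap, List.flatMap_map]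
    have : ends (l₁ ++ l₂) = ends l₁ ++ ends l₂ := by simp [ends]
    rw [this, List.nodup_append, hl₁, hl₂, hm, hm]
    refine ⟨(equator_nodup n).map i₁, (equator_nodup n).map i₂, ?_⟩
    intro x hx y hy
    rw [List.mem_map] at hx hy
    obtain ⟨u, hu, rfl⟩ := hx
    obtain ⟨v, hv, rfl⟩ := hy
    rw [mem_ends_equator] at hu hv
    rcases u with (u | u) | (u | u)
    · exact absurd rfl (hu (Sum.inl u))
    · rcases v with (v | v) | (v | v) <;> simp [e₁, e₂]
    · rcases v with (v | v) | (v | v) <;> simp [e₁, e₂]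
    · exact absurd rfl (hu (Sum.inr u))
  have hcount : ∀ x, x ∈ ends l₁ → ∃ y, x = e₁ y := by
    intro x hx
    simp only [ends, hl₁, List.flatMap_map, List.mem_flatMap] at hx
    obtain ⟨p, _, hp⟩ := hx
    simp at hp
    rcases hp with h | h
    · exact ⟨_, h⟩
    · exact ⟨_, h⟩
  have hcount' : ∀ x, x ∈ ends l₂ → ∃ y, x = e₃ y := by
    intro x hx
    simp only [ends, ← hl₃, List.flatMap_map, List.mem_flatMap] at hx
    obtain ⟨p, _, hp⟩ := hx
    simp at hp
    rcases hp with h | h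
    · exact ⟨_, h⟩
    · exact ⟨_, h⟩
  -- first the equator between `a` and `b`, then the one between `b` and `c`
  obtain ⟨s₁, p₁, q₁⟩ := straighten_embed i₁ (equator n) (f := juxtapose a b) (g := F) (by
    rintro (x | x) <;> simp [e₁, F, juxtapose])
  rw [← hl₁] at s₁ p₁ q₁
  obtain ⟨s₂, p₂, q₂⟩ := straighten_embed i₂ (equator n) (f := juxtapose (compose a b) c)
    (g := straighten F l₁) (by
      rintro (x | x)
      · have : ∀ y, e₂ (Sum.inl y) = e₁ (outer y) := by rintro (y | y) <;> rfl
        rw [this, s₁, ← outer_composePartner, ← this]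
        rfl
      · change straighten F l₁ (Sum.inr (Sum.inr x)) = Sum.inr (Sum.inr (c.partner x))
        refine straighten_keep l₁ ?_ ?_ <;> intro h <;> obtain ⟨y | y, hy⟩ := hcount _ h <;>
          simp [e₁, F] at hy)
  rw [← hl₂] at s₂ p₂ q₂
  -- now in the other order
  obtain ⟨s₃, p₃, q₃⟩ := straighten_embed i₃ (equator n) (f := juxtapose b c) (g := F) (by
    rintro (x | x) <;> simp [e₃, F, juxtapose])
  rw [hl₃] at s₃ p₃ q₃
  obtain ⟨s₄, p₄, q₄⟩ := straighten_embed i₄ (equator n) (f := juxtapose a (compose b c))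
    (g := straighten F l₂) (by
      rintro (x | x)
      · change straighten F l₂ (Sum.inl x) = Sum.inl (a.partner x)
        refine straighten_keep l₂ ?_ ?_ <;> intro h <;> obtain ⟨y | y, hy⟩ := hcount' _ h <;>
          simp [e₃, F] at hy
      · have : ∀ y, e₄ (Sum.inr y) = e₃ (outer y) := by rintro (y | y) <;> rfl
        rw [this, s₃, ← outer_composePartner, ← this]
        rfl)
  rw [hl₄] at s₄ p₄ q₄
  obtain ⟨t₁, t₂, t₃⟩ := straighten_perm (List.perm_append_comm (l₁ := l₁) (l₂ := l₂)) hends hF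
  obtain ⟨u₁, u₂, u₃⟩ := straighten_append l₁ l₂ F
  obtain ⟨v₁, v₂, v₃⟩ := straighten_append l₂ l₁ F
  refine ⟨fun x => ?_, ?_, ?_⟩
  · have h24 : ∀ y, e₂ (outer y) = e₄ (outer y) := by rintro (y | y) <;> rfl
    apply outer_injective
    apply i₂
    calc e₂ (outer (composePartner (compose a b) c x))
        = straighten F (l₁ ++ l₂) (e₂ (outer x)) := by rw [outer_composePartner, ← s₂, u₁]
      _ = straighten F (l₂ ++ l₁) (e₄ (outer x)) := by rw [t₁, h24]
      _ = e₄ (outer (composePartner a (compose b c) x)) := by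
          rw [outer_composePartner, ← s₄, v₁]
      _ = e₂ (outer (composePartner a (compose b c) x)) := (h24 _).symm
  · simp only [loops]
    rw [← p₁, ← p₂, ← p₃, ← p₄, ← u₂, ← v₂, t₂]
  · simp only [strings]
    rw [← q₁, ← q₂, ← q₃, ← q₄, ← u₃, ← v₃, t₃]

/-- The diagram all of whose parts are the propagating lines `{i, i'}`. -/
def identity (n : ℕ) : Diagram n where
  partner := Sum.swap
  partner_partner := Sum.swap_swap


theorem straighten_identity {A : Type*} [DecidableEq A] {n : ℕ} (d : Diagram n)
    (c : Fin n → Fin n ⊕ Fin n) (hc : Function.Injective c) (X Y Y' : Fin n → A)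
    (hX : Function.Injective X) (hY : Function.Injective Y) (hXY : ∀ i j, X i ≠ Y j)
    (l : List (Fin n)) (hl : l.Nodup) {f : A → A} (hf : Function.Involutive f)
    {r : Fin n ⊕ Fin n → A} (hr : Function.Injective r) (hrc : ∀ i ∈ l, r (c i) = Y' i)
    (hfr : ∀ x, f (r x) = r (d.partner x)) (hfX : ∀ i ∈ l, f (X i) = Y i)
    (hrX : ∀ i ∈ l, ∀ x, r x ≠ X i) (hrY : ∀ i ∈ l, ∀ x, r x ≠ Y i) :
    numLoops f (l.map fun i => (Y i, Y' i)) = 0 ∧ numStrings f (l.map fun i => (Y i, Y' i)) = 0 ∧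
    ∃ r' : Fin n ⊕ Fin n → A, (∀ i ∈ l, r' (c i) = X i) ∧
      (∀ x, (∀ i ∈ l, x ≠ c i) → r' x = r x) ∧
      ∀ x, straighten f (l.map fun i => (Y i, Y' i)) (r' x) = r' (d.partner x) := by
  induction l generalizing f r with
  | nil => exact ⟨rfl, rfl, r, by simp, by simp, hfr⟩
  | cons i l ih =>
    have hn := List.nodup_cons.1 hl
    simp only [List.mem_cons, forall_eq_or_imp] at hrc hfX hrX hrY
    have hYX : f (Y i) = X i := by rw [← hfX.1, hf]
    have hne : Y i ≠ Y' i := fun h => hrY.1 (c i) (by rw [hrc.1, h])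
    have hg : ∀ x, joinEnds f (Y i) (Y' i) (Function.update r (c i) (X i) x) =
        Function.update r (c i) (X i) (d.partner x) := by
      intro x
      have h1 := hrX.1
      have h2 := hrY.1
      have h3 := hXY i i
      have h4 := hfr x
      have h5 := hfr (c i)
      have h6 := d.partner_partner x
      have h8 := d.partner_partner (c i)
      have h9 := hrc.1
      have h7 : ∀ y z, r y = r z ↔ y = z := fun y z => hr.eq_iff
      have h10 := h1 x
      have h11 := h2 x
      have h12 := h1 (d.partner x)
      have h13 := h2 (d.partner x)
      have h14 := h1 (c i)
      have h15 := h2 (d.partner (c i))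
      have h16 := h1 (d.partner (c i))
      have h17 := h7 x (c i)
      have h18 := h7 (d.partner x) (c i)
      have h19 := h7 (d.partner (c i)) (c i)
      have h20 := hfX.1
      unfold joinEnds
      simp only [Function.update_apply]
      clear h1 h2 h7 hfr hrX hrY hrc ih hfX hX hY hXY hc
      grind (splits := 20)
    have hr' : Function.Injective (Function.update r (c i) (X i)) := by
      intro x y h
      simp only [Function.update_apply] at h
      split_ifs at h with h1 h2 h2
      · rw [h1, h2]
      · exact absurd h.symm (hrX.1 y)
      · exact absurd h (hrX.1 x)
      · exact hr h
    obtain ⟨g1, g2, r', g3, g4, g5⟩ := ih hn.2 (joinEnds_invol hf _ _ hne) hr'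
      (fun j hj => by
        rw [Function.update_of_ne (fun h => hn.1 (by rw [← hc h]; exact hj)), hrc.2 j hj]) hg
      (fun j hj => by
        have hij : j ≠ i := fun h => hn.1 (h ▸ hj)
        rw [joinEnds_keep (hXY j i) _ _ _, hfX.2 j hj]
        · intro h; exact hrX.2 j hj (c i) (by rw [h, hrc.1])
        · rw [hfX.2 j hj]; exact fun h => hij (hY h)
        · rw [hfX.2 j hj]; intro h; exact hrY.2 j hj (c i) (by rw [h, hrc.1]))
      (fun j hj x => by
        have hij : j ≠ i := fun h => hn.1 (h ▸ hj)
        rw [Function.update_apply]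
        split_ifs
        · exact fun h => hij (hX h).symm
        · exact hrX.2 j hj x)
      (fun j hj x => by
        rw [Function.update_apply]
        split_ifs
        · exact hXY i j
        · exact hrY.2 j hj x)
    refine ⟨?_, ?_, r', ?_, ?_, ?_⟩
    · simp only [List.map_cons, numLoops, g1, hYX]
      rw [if_neg (fun h => hrX.1 (c i) (by rw [h, hrc.1]))]
    · simp only [List.map_cons, numStrings, g2, hYX]
      rw [if_neg (fun h => hXY i i h.1)]
    · simp only [List.mem_cons, forall_eq_or_imp]
      refine ⟨?_, g3⟩
      rw [g4 _ (fun j hj h => hn.1 (by rw [hc h]; exact hj)), Function.update_self]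
    · intro x hx
      rw [g4 x (fun j hj => hx j (List.mem_cons_of_mem _ hj)),
        Function.update_of_ne (hx i List.mem_cons_self)]
    · exact g5

theorem straighten_swap {A : Type*} [DecidableEq A] (l : List (A × A)) (hl : (ends l).Nodup)
    {f : A → A} (hf : Function.Involutive f) :
    straighten f (l.map Prod.swap) = straighten f l ∧
    numLoops f (l.map Prod.swap) = numLoops f l ∧
    numStrings f (l.map Prod.swap) = numStrings f l := by
  induction l generalizing f with
  | nil => exact ⟨rfl, rfl, rfl⟩
  | cons p l ih =>
    simp only [ends, List.flatMap_cons, List.cons_append, List.nil_append,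
        List.nodup_cons, List.mem_cons, not_or] at hl ih
    have hp : p.1 ≠ p.2 := hl.1.1
    obtain ⟨h1, h2, h3⟩ := ih hl.2.2 (joinEnds_invol hf p.1 p.2 hp)
    have hj : joinEnds f p.2 p.1 = joinEnds f p.1 p.2 := by
      funext x
      unfold joinEnds
      grind
    have hs : f p.2 = p.1 ↔ f p.1 = p.2 := by
      constructor <;> intro h <;> rw [← h, hf]
    simp only [List.map_cons, straighten, numLoops, numStrings, Prod.fst_swap, Prod.snd_swap, hj,
      h1, h2, h3, hs, and_comm, and_self]

theorem identity_compose {n : ℕ} (d : Diagram n) :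
    compose (identity n) d = d ∧ loops (identity n) d = 0 ∧ strings (identity n) d = 0 := by
  obtain ⟨h1, h2, r', h3, h4, h5⟩ := straighten_identity d Sum.inl Sum.inl_injective
    (fun i => Sum.inl (Sum.inl i)) (fun i => Sum.inl (Sum.inr i)) (fun i => Sum.inr (Sum.inl i))
    (fun i j h => by simpa using h) (fun i j h => by simpa using h) (by simp)
    (List.finRange n) (List.nodup_finRange n) (juxtapose_invol (identity n) d)
    (r := Sum.inr) Sum.inr_injective (by simp) (fun x => rfl) (fun i _ => rfl) (by simp) (by simp)
  have hr : r' = outer := by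
    funext x
    rcases x with x | x
    · exact h3 x (List.mem_finRange x)
    · exact h4 _ (by simp)
  refine ⟨?_, h1, h2⟩
  ext1
  funext x
  apply outer_injective
  rw [← hr]
  exact (congrFun hr _ ▸ outer_composePartner (identity n) d x).trans (hr ▸ h5 x)

theorem compose_identity {n : ℕ} (d : Diagram n) :
    compose d (identity n) = d ∧ loops d (identity n) = 0 ∧ strings d (identity n) = 0 := by
  obtain ⟨h1, h2, r', h3, h4, h5⟩ := straighten_identity d Sum.inr Sum.inr_injective
    (fun i => Sum.inr (Sum.inr i)) (fun i => Sum.inr (Sum.inl i)) (fun i => Sum.inl (Sum.inr i))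
    (fun i j h => by simpa using h) (fun i j h => by simpa using h) (by simp)
    (List.finRange n) (List.nodup_finRange n) (juxtapose_invol d (identity n))
    (r := Sum.inl) Sum.inl_injective (by simp) (fun x => rfl) (fun i _ => rfl) (by simp) (by simp)
  have hr : r' = outer := by
    funext x
    rcases x with x | x
    · exact h4 _ (by simp)
    · exact h3 x (List.mem_finRange x)
  have hL : (List.finRange n).map (fun i => ((Sum.inr (Sum.inl i), Sum.inl (Sum.inr i)) :
      ((Fin n ⊕ Fin n) ⊕ (Fin n ⊕ Fin n)) × ((Fin n ⊕ Fin n) ⊕ (Fin n ⊕ Fin n)))) =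
      (equator n).map Prod.swap := by simp [equator]
  obtain ⟨k1, k2, k3⟩ := straighten_swap _ (equator_nodup n) (juxtapose_invol d (identity n))
  rw [hL, k2] at h1
  rw [hL, k3] at h2
  simp only [hL, k1, hr] at h5
  refine ⟨?_, h1, h2⟩
  ext1
  funext x
  apply outer_injective
  exact (outer_composePartner d (identity n) x).trans (h5 x)


instance instMonoidDiagram (n : ℕ) : Monoid (Diagram n) where
  mul := compose
  one := identity n
  mul_assoc a b c := Diagram.ext (funext (compose_assoc a b c).1)
  one_mul d := (identity_compose d).1
  mul_one d := (compose_identity d).1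

/-- The Brauer diagrams: those without singletons. -/
def brauerSubmonoid (n : ℕ) : Submonoid (Diagram n) where
  carrier := {d | ∀ x, d.partner x ≠ x}
  one_mem' := by
    rintro (x | x) h
    · exact Sum.inr_ne_inl h
    · exact Sum.inl_ne_inr h
  mul_mem' := by
    intro a b ha hb x hx
    have hne : ∀ y, juxtapose a b y ≠ y := by
      rintro (y | y) <;> simp [juxtapose, ha y, hb y]
    refine (straighten_ne (equator n) (equator_nodup n) (juxtapose_invol a b) (fun y _ => hne y)
      (hne (outer x)) (fun h => (mem_ends_equator _).1 h x rfl)).1 ?_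
    rw [← outer_composePartner]
    exact congrArg outer hx

abbrev BrauerDiagram (n : ℕ) : Type := brauerSubmonoid n

noncomputable section

/-! ### Twisted monoid algebras -/

/-- The structure constants of a twisted monoid algebra. -/
structure TwoCocycle (M 𝕜 : Type*) [Monoid M] [CommRing 𝕜] where
  toFun : M → M → 𝕜
  cocycle : ∀ a b c, toFun a b * toFun (a * b) c = toFun b c * toFun a (b * c)
  one_left : ∀ a, toFun 1 a = 1
  one_right : ∀ a, toFun a 1 = 1

/-- The twisted monoid algebra: the free `𝕜`-module on `M`, with multiplication
`a * b = t a b • (ab)` on basis elements. -/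
def TwistedAlgebra {M 𝕜 : Type*} [Monoid M] [CommRing 𝕜] (_ : TwoCocycle M 𝕜) : Type _ := M →₀ 𝕜

namespace TwistedAlgebra

instance {M 𝕜 : Type*} [Monoid M] [CommRing 𝕜] (t : TwoCocycle M 𝕜) :
    AddCommGroup (TwistedAlgebra t) := inferInstanceAs (AddCommGroup (M →₀ 𝕜))

instance {M 𝕜 : Type*} [Monoid M] [CommRing 𝕜] (t : TwoCocycle M 𝕜) :
    Module 𝕜 (TwistedAlgebra t) := inferInstanceAs (Module 𝕜 (M →₀ 𝕜))

/-- The element `r • a`, for a basis element `a`. -/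
def single {M 𝕜 : Type*} [Monoid M] [CommRing 𝕜] (t : TwoCocycle M 𝕜) (a : M) (r : 𝕜) :
    TwistedAlgebra t := Finsupp.single a r

/-- The bilinear multiplication. -/
def mulLin {M 𝕜 : Type*} [Monoid M] [CommRing 𝕜] (t : TwoCocycle M 𝕜) :
    TwistedAlgebra t →ₗ[𝕜] TwistedAlgebra t →ₗ[𝕜] TwistedAlgebra t :=
  Finsupp.linearCombination 𝕜 fun a : M =>
    (Finsupp.linearCombination 𝕜 fun b : M => single t (a * b) (t.toFun a b) :
      (M →₀ 𝕜) →ₗ[𝕜] TwistedAlgebra t)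

instance {M 𝕜 : Type*} [Monoid M] [CommRing 𝕜] (t : TwoCocycle M 𝕜) :
    Mul (TwistedAlgebra t) := ⟨fun x y => mulLin t x y⟩

instance {M 𝕜 : Type*} [Monoid M] [CommRing 𝕜] (t : TwoCocycle M 𝕜) :
    One (TwistedAlgebra t) := ⟨single t 1 1⟩

theorem mul_def {M 𝕜 : Type*} [Monoid M] [CommRing 𝕜] (t : TwoCocycle M 𝕜)
    (x y : TwistedAlgebra t) : x * y = mulLin t x y := rfl

theorem smul_single {M 𝕜 : Type*} [Monoid M] [CommRing 𝕜] (t : TwoCocycle M 𝕜) (a : M)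
    (r s : 𝕜) : r • single t a s = single t a (r * s) :=
  Finsupp.smul_single r a s

theorem single_mul_single {M 𝕜 : Type*} [Monoid M] [CommRing 𝕜] (t : TwoCocycle M 𝕜)
    (a b : M) (r s : 𝕜) :
    single t a r * single t b s = single t (a * b) (r * s * t.toFun a b) := by
  have h1 : mulLin t (single t a r) =
      r • (Finsupp.linearCombination 𝕜 fun b : M => single t (a * b) (t.toFun a b)) :=
    Finsupp.linearCombination_single 𝕜 r a
  have h2 : (Finsupp.linearCombination 𝕜 fun b : M => single t (a * b) (t.toFun a b))
      (Finsupp.single b s) = s • single t (a * b) (t.toFun a b) :=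
    Finsupp.linearCombination_single 𝕜 s b
  rw [mul_def, h1]
  change r • (Finsupp.linearCombination 𝕜 fun b : M => single t (a * b) (t.toFun a b))
    (Finsupp.single b s) = _
  rw [h2, smul_single, smul_single, mul_assoc]


theorem induction {M 𝕜 : Type*} [Monoid M] [CommRing 𝕜] (t : TwoCocycle M 𝕜)
    {p : TwistedAlgebra t → Prop} (x : TwistedAlgebra t) (h0 : p 0)
    (hadd : ∀ x y, p x → p y → p (x + y)) (hs : ∀ a r, p (single t a r)) : p x :=
  Finsupp.induction_linear (motive := p) x h0 hadd hs

instance {M 𝕜 : Type*} [Monoid M] [CommRing 𝕜] (t : TwoCocycle M 𝕜) :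
    Ring (TwistedAlgebra t) where
  __ := (inferInstance : AddCommGroup (TwistedAlgebra t))
  left_distrib x y z := map_add (mulLin t x) y z
  right_distrib x y z := LinearMap.map_add₂ (mulLin t) x y z
  zero_mul x := LinearMap.map_zero₂ (mulLin t) x
  mul_zero x := map_zero (mulLin t x)
  mul_assoc x y z := by
    simp only [mul_def]
    induction x using induction t with
    | h0 => simp only [map_zero, LinearMap.zero_apply]
    | hadd x x' hx hx' => simp only [map_add, LinearMap.add_apply, hx, hx']
    | hs a r =>
      induction y using induction t with
      | h0 => simp only [map_zero, LinearMap.zero_apply]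
      | hadd y y' hy hy' => simp only [map_add, LinearMap.add_apply, hy, hy']
      | hs b s =>
        induction z using induction t with
        | h0 => simp only [map_zero]
        | hadd z z' hz hz' => simp only [map_add, hz, hz']
        | hs c q =>
          simp only [← mul_def, single_mul_single, mul_assoc]
          congr 1
          linear_combination r * s * q * t.cocycle a b c
  one_mul x := by
    change mulLin t (single t 1 1) x = x
    induction x using induction t with
    | h0 => simp only [map_zero]
    | hadd x x' hx hx' => simp only [map_add, hx, hx']
    | hs a r => simp only [← mul_def, single_mul_single, one_mul, t.one_left, mul_one]
  mul_one x := by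
    change mulLin t x (single t 1 1) = x
    induction x using induction t with
    | h0 => simp only [map_zero, LinearMap.zero_apply]
    | hadd x x' hx hx' => simp only [map_add, LinearMap.add_apply, hx, hx']
    | hs a r => simp only [← mul_def, single_mul_single, t.one_right, mul_one]

instance {M 𝕜 : Type*} [Monoid M] [CommRing 𝕜] (t : TwoCocycle M 𝕜) :
    Algebra 𝕜 (TwistedAlgebra t) :=
  Algebra.ofModule (fun r x y => LinearMap.map_smul₂ (mulLin t) r x y)
    (fun r x y => map_smul (mulLin t x) r y)

end TwistedAlgebra

/-! ### Cell modules

For a set `L` of basis elements, `CellModule t L` is the free `𝕜`-module with basis `L`, on which a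
basis element `a` of the algebra acts by `a · x = t a x • (ax)` if `ax` is in `L` and by `a · x = 0`
otherwise. -/

/-- The condition on `L` which makes this an action. -/
class IsCell {M : Type*} [Monoid M] (L : Set M) : Prop where
  mem_of_mem : ∀ a b x, x ∈ L → a * (b * x) ∈ L → b * x ∈ L

/-- The free module with basis `L`. -/
def CellModule {M 𝕜 : Type*} [Monoid M] [CommRing 𝕜] (_ : TwoCocycle M 𝕜) (L : Set M) : Type _ :=
  L →₀ 𝕜

namespace CellModule

instance {M 𝕜 : Type*} [Monoid M] [CommRing 𝕜] (t : TwoCocycle M 𝕜) (L : Set M) :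
    AddCommGroup (CellModule t L) := inferInstanceAs (AddCommGroup (L →₀ 𝕜))

instance {M 𝕜 : Type*} [Monoid M] [CommRing 𝕜] (t : TwoCocycle M 𝕜) (L : Set M) :
    Module 𝕜 (CellModule t L) := inferInstanceAs (Module 𝕜 (L →₀ 𝕜))

/-- The element `r • x`, for a basis element `x`. -/
def single {M 𝕜 : Type*} [Monoid M] [CommRing 𝕜] (t : TwoCocycle M 𝕜) {L : Set M} (x : L)
    (r : 𝕜) : CellModule t L := Finsupp.single x r

open Classical in
/-- The action of basis elements on basis elements. -/
def basisAct {M 𝕜 : Type*} [Monoid M] [CommRing 𝕜] (t : TwoCocycle M 𝕜) {L : Set M} (a : M)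
    (x : L) : CellModule t L :=
  if h : a * x.1 ∈ L then single t ⟨a * x.1, h⟩ (t.toFun a x.1) else 0

/-- The bilinear action. -/
def actLin {M 𝕜 : Type*} [Monoid M] [CommRing 𝕜] (t : TwoCocycle M 𝕜) (L : Set M) :
    TwistedAlgebra t →ₗ[𝕜] CellModule t L →ₗ[𝕜] CellModule t L :=
  Finsupp.linearCombination 𝕜 fun a : M =>
    (Finsupp.linearCombination 𝕜 fun x : L => basisAct t a x :
      (L →₀ 𝕜) →ₗ[𝕜] CellModule t L)

theorem actLin_single {M 𝕜 : Type*} [Monoid M] [CommRing 𝕜] (t : TwoCocycle M 𝕜) (L : Set M)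
    (a : M) (x : L) (r s : 𝕜) :
    actLin t L (TwistedAlgebra.single t a r) (single t x s) = (r * s) • basisAct t a x := by
  have h1 : actLin t L (TwistedAlgebra.single t a r) =
      r • (Finsupp.linearCombination 𝕜 fun x : L => basisAct t a x) :=
    Finsupp.linearCombination_single 𝕜 r a
  have h2 : (Finsupp.linearCombination 𝕜 fun x : L => basisAct t a x)
      (Finsupp.single x s) = s • basisAct t a x :=
    Finsupp.linearCombination_single 𝕜 s x
  rw [h1, mul_smul, ← h2]
  rfl

theorem induction {M 𝕜 : Type*} [Monoid M] [CommRing 𝕜] (t : TwoCocycle M 𝕜) {L : Set M}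
    {p : CellModule t L → Prop} (x : CellModule t L) (h0 : p 0)
    (hadd : ∀ x y, p x → p y → p (x + y)) (hs : ∀ a r, p (single t a r)) : p x :=
  Finsupp.induction_linear (motive := p) x h0 hadd hs

theorem smul_single {M 𝕜 : Type*} [Monoid M] [CommRing 𝕜] (t : TwoCocycle M 𝕜) {L : Set M}
    (x : L) (r s : 𝕜) : r • single t x s = single t x (r * s) :=
  Finsupp.smul_single r x s

instance {M 𝕜 : Type*} [Monoid M] [CommRing 𝕜] (t : TwoCocycle M 𝕜) (L : Set M) [IsCell L] :
    Module (TwistedAlgebra t) (CellModule t L) where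
  smul x m := actLin t L x m
  smul_zero x := map_zero (actLin t L x)
  smul_add x := map_add (actLin t L x)
  zero_smul m := LinearMap.map_zero₂ (actLin t L) m
  add_smul x y m := LinearMap.map_add₂ (actLin t L) x y m
  one_smul m := by
    change actLin t L (TwistedAlgebra.single t 1 1) m = m
    induction m using induction t with
    | h0 => simp only [map_zero]
    | hadd x x' hx hx' => simp only [map_add, hx, hx']
    | hs x r =>
      have hx : (1 : M) * x.1 ∈ L := by rw [one_mul]; exact x.2
      have hx' : (⟨1 * x.1, hx⟩ : L) = x := Subtype.ext (one_mul _)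
      rw [actLin_single, basisAct, dif_pos hx, hx', t.one_left, smul_single, one_mul, mul_one]
  mul_smul x y m := by
    change actLin t L (TwistedAlgebra.mulLin t x y) m = actLin t L x (actLin t L y m)
    induction x using TwistedAlgebra.induction t with
    | h0 => simp only [map_zero, LinearMap.zero_apply]
    | hadd x x' hx hx' => simp only [map_add, LinearMap.add_apply, hx, hx']
    | hs a r =>
      induction y using TwistedAlgebra.induction t with
      | h0 => simp only [map_zero, LinearMap.zero_apply]
      | hadd y y' hy hy' => simp only [map_add, LinearMap.add_apply, hy, hy']
      | hs b s =>
        induction m using induction t with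
        | h0 => simp only [map_zero]
        | hadd z z' hz hz' => simp only [map_add, hz, hz']
        | hs x q =>
          rw [← TwistedAlgebra.mul_def, TwistedAlgebra.single_mul_single, actLin_single,
            actLin_single, map_smul]
          have hab := mul_assoc a b x.1
          by_cases hb : b * x.1 ∈ L
          · by_cases ha : a * (b * x.1) ∈ L
            · have ha' : a * b * x.1 ∈ L := by rw [hab]; exact ha
              have he : (⟨a * b * x.1, ha'⟩ : L) = ⟨a * (b * x.1), ha⟩ := Subtype.ext hab
              rw [basisAct, dif_pos ha', basisAct, dif_pos hb, actLin_single, basisAct,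
                dif_pos ha, he, smul_single, smul_single, smul_single]
              congr 1
              linear_combination r * s * q * t.cocycle a b x.1
            · have ha' : a * b * x.1 ∉ L := by rw [hab]; exact ha
              rw [basisAct, dif_neg ha', basisAct, dif_pos hb, actLin_single, basisAct,
                dif_neg ha, smul_zero, smul_zero, smul_zero]
          · have ha' : a * b * x.1 ∉ L := by
              rw [hab]
              exact fun h => hb (IsCell.mem_of_mem a b x.1 x.2 h)
            rw [basisAct, dif_neg ha', basisAct, dif_neg hb, map_zero, smul_zero, smul_zero]

theorem smul_def {M 𝕜 : Type*} [Monoid M] [CommRing 𝕜] (t : TwoCocycle M 𝕜) {L : Set M}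
    [IsCell L] (x : TwistedAlgebra t) (m : CellModule t L) : x • m = actLin t L x m := rfl

instance {M 𝕜 : Type*} [Monoid M] [CommRing 𝕜] (t : TwoCocycle M 𝕜) (L : Set M) [IsCell L] :
    IsScalarTower 𝕜 (TwistedAlgebra t) (CellModule t L) where
  smul_assoc r x m := LinearMap.map_smul₂ (actLin t L) r x m

instance {M 𝕜 : Type*} [Monoid M] [CommRing 𝕜] (t : TwoCocycle M 𝕜) (L : Set M) [IsCell L] :
    SMulCommClass 𝕜 (TwistedAlgebra t) (CellModule t L) where
  smul_comm r x m := (map_smul (actLin t L x) r m).symm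

end CellModule

open TensorProduct

/-- The submodule of `C ⊗[𝕜] V`, for the cell module `C` with basis `L`, generated by the elements
`x·σ ⊗ v - x ⊗ σ·v`, where `act` is a right action of `G` on the basis `L`. (The span over `𝕜` of these
elements is a submodule over the algebra whenever the right action commutes with the left one.) -/
def balancing {M 𝕜 G V : Type*} [Monoid M] [CommRing 𝕜] [Group G] [AddCommGroup V] [Module 𝕜 V]
    (t : TwoCocycle M 𝕜) (L : Set M) [IsCell L] (act : L → G → L) (ρ : Representation 𝕜 G V) :
    Submodule (TwistedAlgebra t) (CellModule t L ⊗[𝕜] V) :=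
  Submodule.span _ {z | ∃ (x : L) (σ : G) (v : V),
    z = CellModule.single t (act x σ) 1 ⊗ₜ v - CellModule.single t x 1 ⊗ₜ ρ σ v}

/-- The tensor product `C ⊗_{𝕜[G]} V` of the cell module `C` with basis `L`, as a
`𝕜[G]`-bimodule, and the representation `V` of `G`. -/
abbrev CellTensor {M 𝕜 G V : Type*} [Monoid M] [CommRing 𝕜] [Group G] [AddCommGroup V]
    [Module 𝕜 V] (t : TwoCocycle M 𝕜) (L : Set M) [IsCell L] (act : L → G → L)
    (ρ : Representation 𝕜 G V) : Type _ :=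
  (CellModule t L ⊗[𝕜] V) ⧸ balancing t L act ρ


/-! ### The algebras -/

/-- The product of diagrams `d d'` is `δ ^ (closed loops) * δ' ^ (open strings) • (d ∘ d')`. -/
def partialBrauerTwist {𝕜 : Type*} [CommRing 𝕜] (n : ℕ) (δ δ' : 𝕜) : TwoCocycle (Diagram n) 𝕜 where
  toFun d d' := δ ^ loops d d' * δ' ^ strings d d'
  cocycle a b c := by
    obtain ⟨-, h1, h2⟩ := compose_assoc a b c
    change δ ^ loops a b * δ' ^ strings a b *
      (δ ^ loops (compose a b) c * δ' ^ strings (compose a b) c) =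
      δ ^ loops b c * δ' ^ strings b c *
      (δ ^ loops a (compose b c) * δ' ^ strings a (compose b c))
    rw [mul_mul_mul_comm, ← pow_add, ← pow_add, h1, h2, pow_add, pow_add, mul_mul_mul_comm]
  one_left a := by
    obtain ⟨-, h1, h2⟩ := identity_compose a
    change δ ^ loops (identity n) a * δ' ^ strings (identity n) a = 1
    rw [h1, h2, pow_zero, pow_zero, one_mul]
  one_right a := by
    obtain ⟨-, h1, h2⟩ := compose_identity a
    change δ ^ loops a (identity n) * δ' ^ strings a (identity n) = 1
    rw [h1, h2, pow_zero, pow_zero, one_mul]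

/-- The product of Brauer diagrams `d d'` is `δ ^ (closed loops) • (d ∘ d')`. -/
def brauerTwist {𝕜 : Type*} [CommRing 𝕜] (n : ℕ) (δ : 𝕜) : TwoCocycle (BrauerDiagram n) 𝕜 where
  toFun d d' := δ ^ loops d.1 d'.1
  cocycle a b c := by
    rw [← pow_add, ← pow_add]
    exact congrArg (δ ^ ·) (compose_assoc a.1 b.1 c.1).2.1
  one_left a := by
    change δ ^ loops (identity n) a.1 = 1
    rw [(identity_compose a.1).2.1, pow_zero]
  one_right a := by
    change δ ^ loops a.1 (identity n) = 1
    rw [(compose_identity a.1).2.1, pow_zero]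

/-- The partial Brauer algebra `R_n(δ, δ')`. -/
abbrev PartialBrauerAlgebra {𝕜 : Type*} [CommRing 𝕜] (n : ℕ) (δ δ' : 𝕜) : Type _ :=
  TwistedAlgebra (partialBrauerTwist n δ δ')

/-- The Brauer algebra `B_n(δ)`. -/
abbrev BrauerAlgebra {𝕜 : Type*} [CommRing 𝕜] (n : ℕ) (δ : 𝕜) : Type _ :=
  TwistedAlgebra (brauerTwist n δ)

/-- The basis element of the partial Brauer algebra given by a diagram. -/
def basis {𝕜 : Type*} [CommRing 𝕜] {n : ℕ} (δ δ' : 𝕜) (d : Diagram n) :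
    PartialBrauerAlgebra n δ δ' := TwistedAlgebra.single _ d 1

/-- The basis element of the Brauer algebra given by a diagram. -/
def brauerBasis {𝕜 : Type*} [CommRing 𝕜] {n : ℕ} (δ : 𝕜) (d : BrauerDiagram n) :
    BrauerAlgebra n δ := TwistedAlgebra.single _ d 1

/-! ### Left cells -/

/-- `d` and `d'` have the same parts contained in the right side (the case `i = j` is that of
singletons). -/
def SameRightParts {n : ℕ} (d d' : Diagram n) : Prop :=
  ∀ i j : Fin n, d.partner (Sum.inr i) = Sum.inr j ↔ d'.partner (Sum.inr i) = Sum.inr j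

/-- A left cell of the set of partial Brauer diagrams. -/
structure LeftCell (n : ℕ) where
  carrier : Set (Diagram n)
  exists_rep : ∃ d, carrier = {d' | SameRightParts d' d}

theorem mul_right_part {n : ℕ} (b x : Diagram n) (i j : Fin n)
    (h : x.partner (Sum.inr i) = Sum.inr j) : (b * x).partner (Sum.inr i) = Sum.inr j := by
  apply outer_injective
  have h' : juxtapose b x (outer (Sum.inr i)) = outer (Sum.inr j) :=
    congrArg Sum.inr h
  rw [← h']
  refine (outer_composePartner b x _).trans (straighten_keep _ ?_ ?_)
  · exact fun hh => (mem_ends_equator _).1 hh _ rfl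
  · rw [h']
    exact fun hh => (mem_ends_equator _).1 hh _ rfl

instance {n : ℕ} (L : LeftCell n) : IsCell L.carrier where
  mem_of_mem a b x hx hax := by
    obtain ⟨d, hd⟩ := L.exists_rep
    rw [hd] at hx hax ⊢
    exact fun i j => ⟨fun h => (hax i j).1 (mul_right_part a _ i j h),
      fun h => mul_right_part b _ i j ((hx i j).2 h)⟩

/-- The intersection of a left cell with the set of Brauer diagrams. -/
def LeftCell.brauer {n : ℕ} (L : LeftCell n) : Set (BrauerDiagram n) := {b | b.1 ∈ L.carrier}

instance {n : ℕ} (L : LeftCell n) : IsCell L.brauer where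
  mem_of_mem a b x hx hax := IsCell.mem_of_mem (L := L.carrier) a.1 b.1 x.1 hx hax

/-- The right ends of the propagating lines of a diagram. -/
def Diagram.rightEnds {n : ℕ} (d : Diagram n) : Finset (Fin n) :=
  Finset.univ.filter fun j => ∃ i, d.partner (Sum.inr j) = Sum.inl i

open Classical in
/-- The right ends of the propagating lines of the diagrams in a left cell (they are the same for all
of its diagrams). -/
def LeftCell.rightEnds {n : ℕ} (L : LeftCell n) : Finset (Fin n) :=
  Finset.univ.filter fun j => ∃ d ∈ L.carrier, j ∈ d.rightEnds

/-- The propagating number of a left cell. -/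
def LeftCell.propNumber {n : ℕ} (L : LeftCell n) : ℕ := L.rightEnds.card

theorem LeftCell.not_mem_rightEnds {n : ℕ} (L : LeftCell n) (j : Fin n) :
    j ∉ L.rightEnds ↔ ∃ i, ∀ d ∈ L.carrier, d.partner (Sum.inr j) = Sum.inr i := by
  obtain ⟨d₀, h₀⟩ := L.exists_rep
  have hm : d₀ ∈ L.carrier := by rw [h₀]; exact fun _ _ => Iff.rfl
  have hL : ∀ d ∈ L.carrier, SameRightParts d d₀ := by intro d hd; rwa [h₀] at hd
  have hr : j ∈ L.rightEnds ↔ ∃ d ∈ L.carrier, ∃ i, d.partner (Sum.inr j) = Sum.inl i := by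
    classical
    simp [LeftCell.rightEnds, Diagram.rightEnds]
  rw [hr]
  push Not
  constructor
  · intro h
    rcases hd : d₀.partner (Sum.inr j) with i | i
    · exact absurd hd (h d₀ hm i)
    · exact ⟨i, fun d hd' => (hL d hd' j i).2 hd⟩
  · rintro ⟨i, hi⟩ d hd x hx
    rw [hi d hd] at hx
    exact Sum.inr_ne_inl hx

theorem LeftCell.mem_rightEnds {n : ℕ} (L : LeftCell n) (j : Fin n) :
    j ∈ L.rightEnds ↔ ∀ d ∈ L.carrier, ∃ i, d.partner (Sum.inr j) = Sum.inl i := by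
  constructor
  · intro h d hd
    rcases hx : d.partner (Sum.inr j) with i | i
    · exact ⟨i, rfl⟩
    · refine absurd h ((L.not_mem_rightEnds j).2 ⟨i, ?_⟩)
      obtain ⟨d₀, h₀⟩ := L.exists_rep
      rw [h₀] at hd ⊢
      exact fun d' hd' => (hd' j i).2 ((hd j i).1 hx)
  · intro h
    by_contra hj
    obtain ⟨i, hi⟩ := (L.not_mem_rightEnds j).1 hj
    obtain ⟨d₀, h₀⟩ := L.exists_rep
    have hm : d₀ ∈ L.carrier := by rw [h₀]; exact fun _ _ => Iff.rfl
    obtain ⟨x, hx⟩ := h d₀ hm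
    rw [hi d₀ hm] at hx
    exact Sum.inr_ne_inl hx

/-- Rename the vertices on the right by a permutation. -/
def Diagram.relabelRight {n : ℕ} (d : Diagram n) (τ : Equiv.Perm (Fin n)) : Diagram n where
  partner x := Sum.map id τ (d.partner (Sum.map id τ.symm x))
  partner_partner x := by
    have h : ∀ y : Fin n ⊕ Fin n, Sum.map id τ.symm (Sum.map id τ y) = y := by
      rintro (y | y) <;> simp
    have h' : ∀ y : Fin n ⊕ Fin n, Sum.map id τ (Sum.map id τ.symm y) = y := by
      rintro (y | y) <;> simp
    rw [h, d.partner_partner, h']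

/-- A permutation of `k` letters, as a permutation of the right ends (in their natural order) of
the `k` propagating lines. -/
def LeftCell.endPerm {n k : ℕ} (L : LeftCell n) (hk : L.propNumber = k)
    (σ : Equiv.Perm (Fin k)) : Equiv.Perm (Fin n) :=
  σ.extendDomain (L.rightEnds.orderIsoOfFin hk).toEquiv

theorem LeftCell.relabel_mem {n k : ℕ} (L : LeftCell n) (hk : L.propNumber = k)
    (σ : Equiv.Perm (Fin k)) (d : Diagram n) (hd : d ∈ L.carrier) :
    d.relabelRight (L.endPerm hk σ).symm ∈ L.carrier := by
  set τ := L.endPerm hk σ with hτ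
  have hfix : ∀ j, j ∉ L.rightEnds → τ j = j := fun j hj =>
    Equiv.Perm.extendDomain_apply_not_subtype _ _ hj
  have hmem : ∀ j, j ∈ L.rightEnds → τ j ∈ L.rightEnds := by
    intro j hj
    rw [hτ, LeftCell.endPerm, Equiv.Perm.extendDomain_apply_subtype _ _ hj]
    exact Subtype.prop _
  have hd' := hd
  obtain ⟨d₀, h₀⟩ := L.exists_rep
  rw [h₀] at hd ⊢
  refine fun i j => Iff.trans ?_ (hd i j)
  by_cases hi : i ∈ L.rightEnds
  · obtain ⟨x, hx⟩ := (L.mem_rightEnds _).1 (hmem i hi) d hd'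
    obtain ⟨y, hy⟩ := (L.mem_rightEnds _).1 hi d hd'
    simp [Diagram.relabelRight, hx, hy]
  · obtain ⟨x, hx⟩ := (L.not_mem_rightEnds _).1 hi
    have hx := hx d hd'
    have hxr : x ∉ L.rightEnds := by
      intro h
      obtain ⟨y, hy⟩ := (L.mem_rightEnds _).1 h d hd'
      rw [← hx, d.partner_partner] at hy
      exact Sum.inr_ne_inl hy
    have hxx : τ.symm x = x := by rw [Equiv.symm_apply_eq, hfix x hxr]
    simp [Diagram.relabelRight, hfix i hi, hx, hxx]

/-- The right action of the symmetric group on a left cell, by permutation of the right ends of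
the propagating lines: where `d` has the right end `σ(i)`, `d · σ` has `i`, so that
`(d · σ) · τ = d · (σ τ)`. -/
def LeftCell.act {n k : ℕ} (L : LeftCell n) (hk : L.propNumber = k) (d : L.carrier)
    (σ : Equiv.Perm (Fin k)) : L.carrier :=
  ⟨d.1.relabelRight (L.endPerm hk σ).symm, L.relabel_mem hk σ d.1 d.2⟩

theorem relabelRight_mem_brauer {n : ℕ} (d : BrauerDiagram n) (τ : Equiv.Perm (Fin n)) :
    d.1.relabelRight τ ∈ brauerSubmonoid n := by
  intro x hx
  refine d.2 (Sum.map id τ.symm x) ?_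
  conv_rhs => rw [← hx]
  generalize h : d.1.partner (Sum.map id τ.symm x) = y
  simp only [Diagram.relabelRight, h]
  rcases y with y | y <;> simp

/-- The same action on the Brauer diagrams in a left cell. -/
def LeftCell.brauerAct {n k : ℕ} (L : LeftCell n) (hk : L.propNumber = k) (d : L.brauer)
    (σ : Equiv.Perm (Fin k)) : L.brauer :=
  ⟨⟨d.1.1.relabelRight (L.endPerm hk σ).symm, relabelRight_mem_brauer d.1 _⟩,
    L.relabel_mem hk σ d.1.1 d.2⟩

/-! ### Specht modules of symmetric groups -/

/-- Tableaux of shape `μ`: bijective fillings of the cells. The cell `(i, j)` is in row `i` and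
column `j`. -/
abbrev Tableau (μ : YoungDiagram) : Type := μ.cells ≃ Fin μ.card

/-- The tabloid of a tableau, as the function giving the row in which an entry stands. -/
def Tableau.tabloid {μ : YoungDiagram} (t : Tableau μ) : Fin μ.card → ℕ :=
  fun i => (t.symm i).1.1

/-- The permutations which preserve the columns of the tableau. -/
def Tableau.columnStabilizer {μ : YoungDiagram} (t : Tableau μ) :
    Finset (Equiv.Perm (Fin μ.card)) :=
  Finset.univ.filter fun π => ∀ i, (t.symm (π i)).1.2 = (t.symm i).1.2

/-- Apply a permutation to the entries of a tableau. -/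
def Tableau.permute {μ : YoungDiagram} (σ : Equiv.Perm (Fin μ.card)) (t : Tableau μ) :
    Tableau μ := Equiv.trans t σ

/-- The polytabloid `e_t`, the signed sum of the tabloids of `π t`, for `π` in the column stabilizer. -/
def Tableau.polytabloid {μ : YoungDiagram} (t : Tableau μ) : (Fin μ.card → ℕ) →₀ ℤ :=
  ∑ π ∈ t.columnStabilizer,
    (Equiv.Perm.sign π : ℤ) • Finsupp.single (Tableau.tabloid (Tableau.permute π t)) (1 : ℤ)

/-- The action of permutations on (combinations of) tabloids. -/
def permuteRows {k : ℕ} : Representation ℤ (Equiv.Perm (Fin k)) ((Fin k → ℕ) →₀ ℤ) where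
  toFun σ := Finsupp.lmapDomain ℤ ℤ fun r => r ∘ σ.symm
  map_one' := by
    ext1
    ext1
    change Finsupp.mapDomain _ (Finsupp.single _ _) = _
    rw [Finsupp.mapDomain_single]
    rfl
  map_mul' σ τ := by
    ext1
    ext1
    change Finsupp.mapDomain _ (Finsupp.single _ _) =
      Finsupp.mapDomain _ (Finsupp.mapDomain _ (Finsupp.single _ _))
    rw [Finsupp.mapDomain_single, Finsupp.mapDomain_single, Finsupp.mapDomain_single]
    rfl

/-- The integral Specht module of the symmetric group, spanned by the polytabloids. -/
def integralSpecht (μ : YoungDiagram) : Submodule ℤ ((Fin μ.card → ℕ) →₀ ℤ) :=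
  Submodule.span ℤ (Set.range (Tableau.polytabloid (μ := μ)))

theorem permuteRows_polytabloid {μ : YoungDiagram} (σ : Equiv.Perm (Fin μ.card)) (t : Tableau μ) :
    permuteRows σ t.polytabloid = (Tableau.permute σ t).polytabloid := by
  simp only [Tableau.polytabloid, map_sum]
  refine Finset.sum_nbij' (fun π => σ * π * σ⁻¹) (fun π => σ⁻¹ * π * σ) ?_ ?_ ?_ ?_ ?_
  · intro π hπ
    simp only [Tableau.columnStabilizer, Finset.mem_filter, Finset.mem_univ, true_and] at hπ ⊢
    intro i
    have := hπ (σ.symm i)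
    simpa [Tableau.permute] using this
  · intro π hπ
    simp only [Tableau.columnStabilizer, Finset.mem_filter, Finset.mem_univ, true_and] at hπ ⊢
    intro i
    have := hπ (σ i)
    simpa [Tableau.permute] using this
  · intro π _; group
  · intro π _; group
  · intro π _
    simp only [map_smul]
    congr 1
    · rw [map_mul, map_mul, mul_comm, ← mul_assoc, ← map_mul, inv_mul_cancel, map_one, one_mul]
    · change Finsupp.mapDomain _ (Finsupp.single _ _) = _
      rw [Finsupp.mapDomain_single]
      congr 1
      funext i
      have : (σ * π * σ⁻¹ * σ) = σ * π := by group
      change (t.symm (π.symm (σ.symm i))).1.1 =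
        (t.symm (σ.symm ((σ * π * σ⁻¹).symm i))).1.1
      rw [← Equiv.Perm.inv_def (σ * π * σ⁻¹), mul_inv_rev, mul_inv_rev, inv_inv]
      simp [Equiv.Perm.mul_apply, Equiv.Perm.inv_def]

/-- The action of the symmetric group on the integral Specht module. -/
def integralSpechtRep (μ : YoungDiagram) :
    Representation ℤ (Equiv.Perm (Fin μ.card)) (integralSpecht μ) where
  toFun σ := (permuteRows σ).restrict (p := integralSpecht μ) (q := integralSpecht μ) (by
    intro x hx
    have : integralSpecht μ ≤ (integralSpecht μ).comap (permuteRows σ) := by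
      conv_lhs => rw [integralSpecht]
      rw [Submodule.span_le]
      rintro _ ⟨t, rfl⟩
      change permuteRows σ _ ∈ integralSpecht μ
      rw [permuteRows_polytabloid]
      exact Submodule.subset_span ⟨_, rfl⟩
    exact this hx)
  map_one' := by
    ext1 x
    exact Subtype.ext (by simp)
  map_mul' σ τ := by
    ext1 x
    exact Subtype.ext (by simp)

/-- The Specht module of the symmetric group over `𝕜`, with scalars extended from `ℤ`. -/
abbrev SpechtModule (𝕜 : Type*) [CommRing 𝕜] (μ : YoungDiagram) : Type _ :=
  𝕜 ⊗[ℤ] integralSpecht μ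

/-- The action of the symmetric group on the Specht module over `𝕜`. -/
def spechtRep (𝕜 : Type*) [CommRing 𝕜] (μ : YoungDiagram) :
    Representation 𝕜 (Equiv.Perm (Fin μ.card)) (SpechtModule 𝕜 μ) where
  toFun σ := (integralSpechtRep μ σ).baseChange 𝕜
  map_one' := by rw [map_one]; exact LinearMap.baseChange_id
  map_mul' σ τ := by rw [map_mul]; exact LinearMap.baseChange_comp _ _

/-- The Specht module `Δ(μ)` of the partial Brauer algebra, constructed from the left cell `L`. -/
abbrev Specht {𝕜 : Type*} [CommRing 𝕜] {n : ℕ} (δ δ' : 𝕜) (L : LeftCell n) (μ : YoungDiagram)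
    (h : L.propNumber = μ.card) : Type _ :=
  CellTensor (partialBrauerTwist n δ δ') L.carrier (L.act h) (spechtRep 𝕜 μ)

/-- The Specht module of the Brauer algebra, constructed from the Brauer diagrams in `L`. -/
abbrev BrauerSpecht {𝕜 : Type*} [CommRing 𝕜] {n : ℕ} (δ : 𝕜) (L : LeftCell n) (μ : YoungDiagram)
    (h : L.propNumber = μ.card) : Type _ :=
  CellTensor (brauerTwist n δ) L.brauer (L.brauerAct h) (spechtRep 𝕜 μ)

/-! ### Idempotents -/

/-- The diagram `u_{n,i}` with the singletons `i`, `i'` and the propagating lines `{j, j'}`, `j ≠ i`. -/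
def cutDiagram {n : ℕ} (i : Fin n) : Diagram n where
  partner := Sum.elim (fun j => if j = i then Sum.inl j else Sum.inr j)
    (fun j => if j = i then Sum.inr j else Sum.inl j)
  partner_partner := by
    rintro (j | j) <;> by_cases h : j = i <;> simp [h]

/-- The element `û_{n,i} = 1 - δ'⁻¹ u_{n,i}`. -/
def uHat {𝕜 : Type*} [CommRing 𝕜] {n : ℕ} (δ : 𝕜) (δ' : 𝕜ˣ) (i : Fin n) :
    PartialBrauerAlgebra n δ (δ' : 𝕜) :=
  1 - ((δ'⁻¹ : 𝕜ˣ) : 𝕜) • basis δ (δ' : 𝕜) (cutDiagram i)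

/-- The product of the (commuting) elements `û_{n,i}` for `i ∈ X`. -/
def uHatProd {𝕜 : Type*} [CommRing 𝕜] {n : ℕ} (δ : 𝕜) (δ' : 𝕜ˣ) (X : Finset (Fin n)) :
    PartialBrauerAlgebra n δ (δ' : 𝕜) :=
  ((List.finRange n).map fun i => if i ∈ X then uHat δ δ' i else 1).prod

/-- The `i` such that `i` is not a singleton. -/
def Diagram.leftNonsingletons {n : ℕ} (d : Diagram n) : Finset (Fin n) :=
  Finset.univ.filter fun i => d.partner (Sum.inl i) ≠ Sum.inl i

/-- The `i` such that `i'` is not a singleton. -/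
def Diagram.rightNonsingletons {n : ℕ} (d : Diagram n) : Finset (Fin n) :=
  Finset.univ.filter fun i => d.partner (Sum.inr i) ≠ Sum.inr i

/-- The decorated diagram `⟨d⟩ = û_{l(d)} d û_{r(d)}`. -/
def decorated {𝕜 : Type*} [CommRing 𝕜] {n : ℕ} (δ : 𝕜) (δ' : 𝕜ˣ) (d : Diagram n) :
    PartialBrauerAlgebra n δ (δ' : 𝕜) :=
  uHatProd δ δ' d.leftNonsingletons * basis δ (δ' : 𝕜) d * uHatProd δ δ' d.rightNonsingletons

/-- The element `û_n = û_{n,1} ⋯ û_{n,n}`. -/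
def uHatAll {𝕜 : Type*} [CommRing 𝕜] (n : ℕ) (δ : 𝕜) (δ' : 𝕜ˣ) :
    PartialBrauerAlgebra n δ (δ' : 𝕜) := uHatProd δ δ' Finset.univ

/-- The element `ω = ⟨u_{n+1,1}⟩` of the partial Brauer algebra of rank `n + 1`. -/
def omega {𝕜 : Type*} [CommRing 𝕜] (n : ℕ) (δ : 𝕜) (δ' : 𝕜ˣ) :
    PartialBrauerAlgebra (n + 1) δ (δ' : 𝕜) := decorated δ δ' (cutDiagram 0)

/-- The diagram `(u ⊗ u*) ⊗ d`: the singletons `1`, `1'`, followed by a shifted copy of `d`. -/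
def addCut {n : ℕ} (d : Diagram n) : Diagram (n + 1) where
  partner := Sum.elim
    (Fin.cases (Sum.inl 0) fun i => Sum.map Fin.succ Fin.succ (d.partner (Sum.inl i)))
    (Fin.cases (Sum.inr 0) fun i => Sum.map Fin.succ Fin.succ (d.partner (Sum.inr i)))
  partner_partner := by
    have key : ∀ y : Fin n ⊕ Fin n, Sum.elim
        (Fin.cases (Sum.inl 0) fun i => Sum.map Fin.succ Fin.succ (d.partner (Sum.inl i)))
        (Fin.cases (Sum.inr 0) fun i => Sum.map Fin.succ Fin.succ (d.partner (Sum.inr i)))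
        (Sum.map Fin.succ Fin.succ y) = Sum.map Fin.succ Fin.succ (d.partner y) := by
      rintro (y | y) <;> simp
    rintro (j | j) <;> refine Fin.cases ?_ (fun i => ?_) j
    · simp
    · simp only [Sum.elim_inl, Fin.cases_succ, key, d.partner_partner, Sum.map_inl]
    · simp
    · simp only [Sum.elim_inr, Fin.cases_succ, key, d.partner_partner, Sum.map_inr]

/-! ### Functors -/

/-- `Hom_R(R e, M)`. -/
def CornerHom {R : Type*} [Ring R] (e : R) (M : Type*) [AddCommGroup M] [Module R M] : Type _ :=
  Submodule.span R {e} →ₗ[R] M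

instance {R : Type*} [Ring R] (e : R) (M : Type*) [AddCommGroup M] [Module R M] :
    AddCommGroup (CornerHom e M) := inferInstanceAs (AddCommGroup (Submodule.span R {e} →ₗ[R] M))

theorem mul_corner_mem {R : Type*} [Ring R] {e : R} (he : IsIdempotentElem e) (a : he.Corner)
    (x : R) : x * a.1 ∈ Submodule.span R {e} := by
  obtain ⟨r, hr⟩ := a.2
  rw [Submodule.mem_span_singleton]
  exact ⟨x * (e * r), by rw [← hr, smul_eq_mul]; simp only [mul_assoc]⟩

/-- Right multiplication by an element of the corner ring `e R e`, on `R e`. -/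
def rightMul {R : Type*} [Ring R] {e : R} (he : IsIdempotentElem e) (a : he.Corner) :
    Submodule.span R {e} →ₗ[R] Submodule.span R {e} where
  toFun x := ⟨x.1 * a.1, mul_corner_mem he a x.1⟩
  map_add' x y := Subtype.ext (add_mul x.1 y.1 a.1)
  map_smul' r x := Subtype.ext (mul_assoc r x.1 a.1)

theorem rightMul_zero {R : Type*} [Ring R] {e : R} (he : IsIdempotentElem e) :
    rightMul he 0 = 0 :=
  LinearMap.ext fun x => Subtype.ext (mul_zero x.1)

theorem rightMul_one {R : Type*} [Ring R] {e : R} (he : IsIdempotentElem e) :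
    rightMul he 1 = LinearMap.id :=
  LinearMap.ext fun x => Subtype.ext (by
    obtain ⟨r, hr⟩ := Submodule.mem_span_singleton.1 x.2
    change x.1 * e = x.1
    rw [← hr, smul_eq_mul, mul_assoc, he.eq])

theorem rightMul_add {R : Type*} [Ring R] {e : R} (he : IsIdempotentElem e) (a b : he.Corner) :
    rightMul he (a + b) = rightMul he a + rightMul he b :=
  LinearMap.ext fun x => Subtype.ext (mul_add x.1 a.1 b.1)

theorem rightMul_mul {R : Type*} [Ring R] {e : R} (he : IsIdempotentElem e) (a b : he.Corner) :
    rightMul he (a * b) = rightMul he b ∘ₗ rightMul he a :=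
  LinearMap.ext fun x => Subtype.ext (mul_assoc x.1 a.1 b.1).symm

/-- The left action of `e R e` on `Hom_R(R e, M)`, by `(a • f)(x) = f (x a)`. -/
instance {R : Type*} [Ring R] {e : R} (he : IsIdempotentElem e) (M : Type*) [AddCommGroup M]
    [Module R M] : Module he.Corner (CornerHom e M) where
  smul a f := LinearMap.comp f (rightMul he a)
  smul_zero _ := LinearMap.zero_comp _
  smul_add _ _ _ := LinearMap.add_comp _ _ _
  zero_smul f := (congrArg (LinearMap.comp f) (rightMul_zero he)).trans (LinearMap.comp_zero _)
  add_smul a b f :=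
    (congrArg (LinearMap.comp f) (rightMul_add he a b)).trans (LinearMap.comp_add _ _ _)
  one_smul f := (congrArg (LinearMap.comp f) (rightMul_one he)).trans (LinearMap.comp_id _)
  mul_smul a b f :=
    (congrArg (LinearMap.comp f) (rightMul_mul he a b)).trans (LinearMap.comp_assoc _ _ _).symm

open CategoryTheory

/-- The functor `Hom_R(R e, -)` from `R`-modules to `e R e`-modules. -/
def cornerFunctor {R : Type*} [Ring R] {e : R} (he : IsIdempotentElem e) :
    ModuleCat R ⥤ ModuleCat he.Corner where
  obj M := ModuleCat.of he.Corner (CornerHom e M)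
  map φ := ModuleCat.ofHom
    { toFun := fun f => LinearMap.comp φ.hom f
      map_add' := fun _ _ => LinearMap.comp_add _ _ _
      map_smul' := fun _ _ => rfl }

/-- The functor `Hom_R(R e, -)` with values in `B`-modules, for an identification `γ` of `e R e`
with `B`. -/
def moritaFunctor {R B : Type*} [Ring R] [Ring B] {e : R} (he : IsIdempotentElem e)
    (γ : he.Corner ≃+* B) : ModuleCat R ⥤ ModuleCat B :=
  cornerFunctor he ⋙ ModuleCat.restrictScalars (γ.symm : B →+* he.Corner)

universe u

/-- The cell module of a left cell `L`. -/
abbrev cellObj {𝕜 : Type u} [CommRing 𝕜] {n : ℕ} (δ δ' : 𝕜) (L : LeftCell n) :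
    ModuleCat.{u} (PartialBrauerAlgebra n δ δ') :=
  ModuleCat.of _ (CellModule (partialBrauerTwist n δ δ') L.carrier)

/-- The cell module of the Brauer algebra with basis the Brauer diagrams in `L`. -/
abbrev brauerCellObj {𝕜 : Type u} [CommRing 𝕜] {n : ℕ} (δ : 𝕜) (L : LeftCell n) :
    ModuleCat.{u} (BrauerAlgebra n δ) :=
  ModuleCat.of _ (CellModule (brauerTwist n δ) L.brauer)

/-- The Specht module `Δ(μ)` of the partial Brauer algebra, as an object of the module category. -/
abbrev spechtObj {𝕜 : Type u} [CommRing 𝕜] {n : ℕ} (δ δ' : 𝕜) (L : LeftCell n) (μ : YoungDiagram)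
    (h : L.propNumber = μ.card) : ModuleCat.{u} (PartialBrauerAlgebra n δ δ') :=
  ModuleCat.of _ (Specht δ δ' L μ h)

/-- The Specht module of the Brauer algebra, as an object of the module category. -/
abbrev brauerSpechtObj {𝕜 : Type u} [CommRing 𝕜] {n : ℕ} (δ : 𝕜) (L : LeftCell n)
    (μ : YoungDiagram) (h : L.propNumber = μ.card) : ModuleCat.{u} (BrauerAlgebra n δ) :=
  ModuleCat.of _ (BrauerSpecht δ L μ h)

end

end PartialBrauer

universe u

open PartialBrauer CategoryTheory

/-! Multiplication by `u_i` cuts a diagram at the vertex `i`: this vertex and its partner become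
singletons, and a factor `δ'` appears if `i` was a singleton already. Hence `δ'⁻¹ u_i` and `û_i` are
complementary idempotents, and `û_i` kills every diagram with a singleton at `i`.

The shift from `δ` to `δ - 1` comes from an alternating sum. Expand `d û d'`, where `û` runs over
places of the equator at which neither diagram has a singleton. A cut that does not lie on a pair
about to close up into a loop leaves a singleton, either at another vertex of the equator, where the
remaining factors of `û` kill it, or on the exterior, where the hats outside of the product kill it.
On a closed loop the uncut term has the weight `δ`, and the cut one is an open string of weight
`δ'⁻¹ δ' = 1`, so that each loop contributes `δ - 1`. This is `hatEval_eq_zero` and `hatEval_eq`,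
translated to diagrams in `map_mul_uHatList_mul_eq`.

Both functors are treated at once, by a choice of `n` among `N` places (`Places`). The idempotent is
the product of `δ'⁻¹ u_i` over the other places and of `û_i` over the chosen ones; no other places
give `û_n`, and the first of `n + 1` gives `e_ω`. The corner ring has as basis the Brauer diagrams
padded with singletons, between hats and rescaled (`lift_mul_lift`, `liftLin_injective`,
`exists_liftLin`).

For modules, `Hom_R(R e, X)` is `e X`. In a cell module, `e x` is zero or a multiple of `e x'` for a
proper `x'`, one whose singletons on the left are exactly at the other places. The `e x'` form a
basis of `e C`, because `û x'` is `x'` plus a combination of diagrams with further singletons on the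
left. A proper diagram in a left cell with `k` propagating lines amounts to its left side, a perfect
matching of `n + k` points that does not pair two of the `k` right ends (`HalfDiagram`). Neither the
set of these nor the action of a Brauer diagram on it depends on the cell, so that any cell with the
same `k` which contains Brauer diagrams gives the same module (`cellTransfer`). If `n + k` is odd
there are no matchings, and `e C = 0`.

For Specht modules, the inclusion of the Brauer cell module as `e C` has a linear retraction, and
both maps respect the relations that define the tensor product over the group algebra
(`balancing_into`, `balancing_onto`). So the relations in the tensor product over `𝕜` pull back to
exactly the relations on the Brauer side (`tensor_iso`). -/

namespace PartialBrauer

/-! ### Cutting an involution at a vertex, and its effect on straightening -/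

section Cutting

/-- Turn the vertex `a` and its partner into singletons. -/
def cut {A : Type*} [DecidableEq A] (f : A → A) (a x : A) : A :=
  if x = a ∨ f x = a then x else f x

theorem cut_invol {A : Type*} [DecidableEq A] {f : A → A} (hf : Function.Involutive f) (a : A) :
    Function.Involutive (cut f a) := by
  intro x
  have h1 := hf x
  have h2 := hf a
  unfold cut
  grind

theorem cut_self {A : Type*} [DecidableEq A] (f : A → A) (a : A) : cut f a a = a := by
  simp [cut]

theorem cut_fix {A : Type*} [DecidableEq A] {f : A → A} {a x : A} (h : f x = x) :
    cut f a x = x := by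
  simp [cut, h]

theorem cut_of_fix {A : Type*} [DecidableEq A] {f : A → A} (hf : Function.Involutive f) {a : A}
    (h : f a = a) : cut f a = f := by
  funext x
  have h1 := hf x
  unfold cut
  grind

theorem joinEnds_cut {A : Type*} [DecidableEq A] {f : A → A} (hf : Function.Involutive f)
    {a b c : A} (hac : a ≠ c) (hbc : b ≠ c) :
    joinEnds (cut f c) a b = cut (joinEnds f a b) c := by
  funext x
  have h0 := hf x
  have h1 := hf a
  have h2 := hf b
  have h3 := hf c
  unfold joinEnds cut
  grind (splits := 30)

theorem cut_loop {A : Type*} [DecidableEq A] {f : A → A}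
    {a b c : A} (hab : a ≠ b) (hac : a ≠ c) (hbc : b ≠ c) :
    cut f c a = b ↔ f a = b := by
  unfold cut
  grind

/-- If `c` is joined to one of `a`, `b` and the other is a singleton, then removing the pair makes
`c` a singleton; if `c` is cut first, `a` and `b` are both singletons and form an open string
instead. The two extra terms record this exchange, which makes the count additive along a list of
pairs. -/
theorem cut_string {A : Type*} [DecidableEq A] {f : A → A} (hf : Function.Involutive f)
    {a b c : A} (hac : a ≠ c) (hbc : b ≠ c) :
    (if cut f c a = a ∧ cut f c b = b then 1 else 0) + (if f c = c then 1 else 0) =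
    (if f a = a ∧ f b = b then 1 else 0) + (if joinEnds f a b c = c then 1 else 0) := by
  have h1 := hf a
  have h2 := hf b
  have h3 := hf c
  unfold joinEnds cut
  grind (splits := 30)

/-- A cut at an exterior vertex touches no closed loop. It creates an open string exactly when the
component of `c` runs into the equator and ends there in a singleton, which is when `c` is a
singleton after straightening but not before. -/
theorem straighten_cut {A : Type*} [DecidableEq A] (l : List (A × A)) (hl : (ends l).Nodup)
    {f : A → A} (hf : Function.Involutive f) {c : A} (hc : c ∉ ends l) :
    straighten (cut f c) l = cut (straighten f l) c ∧ numLoops (cut f c) l = numLoops f l ∧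
    numStrings (cut f c) l + (if f c = c then 1 else 0) =
      numStrings f l + (if straighten f l c = c then 1 else 0) := by
  induction l generalizing f with
  | nil => exact ⟨rfl, rfl, rfl⟩
  | cons p l ih =>
    simp only [ends, List.flatMap_cons, List.cons_append, List.nil_append,
        List.nodup_cons, List.mem_cons, not_or] at hl hc ih
    have hab : p.1 ≠ p.2 := hl.1.1
    have hac : p.1 ≠ c := fun h => hc.1 h.symm
    have hbc : p.2 ≠ c := fun h => hc.2.1 h.symm
    obtain ⟨h1, h2, h3⟩ := ih hl.2.2 (joinEnds_invol hf p.1 p.2 hab) hc.2.2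
    have h4 := cut_string hf hac hbc
    have h5 := joinEnds_cut hf hac hbc
    refine ⟨?_, ?_, ?_⟩
    · rw [straighten, h5, h1, straighten]
    · simp only [numLoops, h5, h2, cut_loop (f := f) hab hac hbc]
    · rw [numStrings, numStrings, straighten, h5]
      omega

end Cutting

/-! ### The alternating sum over cuts, and the parameter `δ - 1` -/

section HatEvaluation

variable {𝕜 A Q : Type*} [CommRing 𝕜] [DecidableEq A] [AddCommGroup Q] [Module 𝕜 Q]

/-- The value of the straightening of `f` along `l`, with its weight. -/
def weighted (δ δ' : 𝕜) (q : (A → A) → Q) (l : List (A × A)) (f : A → A) : Q :=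
  (δ ^ numLoops f l * δ' ^ numStrings f l) • q (straighten f l)

/-- The weight of one step of straightening. -/
def stepWeight (δ δ' : 𝕜) (f : A → A) (p : A × A) : 𝕜 :=
  δ ^ (if f p.1 = p.2 then 1 else 0) * δ' ^ (if f p.1 = p.1 ∧ f p.2 = p.2 then 1 else 0)

theorem weighted_cons (δ δ' : 𝕜) (q : (A → A) → Q) (p : A × A) (l : List (A × A)) (f : A → A) :
    weighted δ δ' q (p :: l) f =
      stepWeight δ δ' f p • weighted δ δ' q l (joinEnds f p.1 p.2) := by
  simp only [weighted, stepWeight, numLoops, numStrings, straighten, smul_smul, pow_add]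
  congr 1
  ring

/-- The alternating sum of the values of `v` at the cuts of `f`, which corresponds to the insertion of
`1 - δ'⁻¹ u` at the vertices in the list. -/
def hatEval (δ' : 𝕜ˣ) (v : (A → A) → Q) : List A → (A → A) → Q
  | [], f => v f
  | a :: m, f => hatEval δ' v m f -
      (((δ'⁻¹ : 𝕜ˣ) : 𝕜) * (δ' : 𝕜) ^ (if f a = a then 1 else 0)) • hatEval δ' v m (cut f a)

/-- Cuts away from the pair commute with its removal, so the pair can be removed before the sum over
the cuts is formed. -/
theorem hatEval_weighted_cons (δ : 𝕜) (δ' : 𝕜ˣ) (q : (A → A) → Q) (p : A × A) (hp : p.1 ≠ p.2)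
    (l : List (A × A)) (m : List A) (h1 : p.1 ∉ m) (h2 : p.2 ∉ m) {f : A → A}
    (hf : Function.Involutive f) :
    hatEval δ' (weighted δ δ' q (p :: l)) m f =
      stepWeight δ (δ' : 𝕜) f p • hatEval δ' (weighted δ δ' q l) m (joinEnds f p.1 p.2) := by
  induction m generalizing f with
  | nil => exact weighted_cons _ _ _ _ _ _
  | cons a m ih =>
    simp only [List.mem_cons, not_or] at h1 h2
    rw [hatEval, hatEval, ih h1.2 h2.2 hf, ih h1.2 h2.2 (cut_invol hf a),
      joinEnds_cut hf h1.1 h2.1, smul_sub, smul_smul, smul_smul]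
    congr 2
    -- The balance of open strings, turned into an identity between powers of `δ'`.
    have h3 := congrArg (fun k => (δ' : 𝕜) ^ k) (cut_string hf h1.1 h2.1)
    simp only [pow_add] at h3
    simp only [stepWeight, cut_loop (f := f) hp h1.1 h2.1]
    linear_combination ((δ'⁻¹ : 𝕜ˣ) : 𝕜) * δ ^ (if f p.1 = p.2 then 1 else 0) * h3

theorem hatEval_cons_pair (δ : 𝕜) (δ' : 𝕜ˣ) (q : (A → A) → Q) (p : A × A) (hp : p.1 ≠ p.2)
    (l : List (A × A)) (m : List A) (h1 : p.1 ∉ m) (h2 : p.2 ∉ m) {f : A → A}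
    (hf : Function.Involutive f) :
    hatEval δ' (weighted δ δ' q (p :: l)) (p.1 :: m) f =
      stepWeight δ (δ' : 𝕜) f p • hatEval δ' (weighted δ δ' q l) m (joinEnds f p.1 p.2) -
      (((δ'⁻¹ : 𝕜ˣ) : 𝕜) * (δ' : 𝕜) ^ (if f p.1 = p.1 then 1 else 0) *
        stepWeight δ (δ' : 𝕜) (cut f p.1) p) •
        hatEval δ' (weighted δ δ' q l) m (joinEnds (cut f p.1) p.1 p.2) := by
  rw [hatEval, hatEval_weighted_cons δ δ' q p hp l m h1 h2 hf,
    hatEval_weighted_cons δ δ' q p hp l m h1 h2 (cut_invol hf _), smul_smul]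

/-- If `a` and `b` are partners, or one of them is a singleton, the component has no partners on
both sides that the removal could connect. What remains of it is at most one vertex, which becomes a
singleton with or without the cut. -/
theorem joinEnds_cut_self {f : A → A} (hf : Function.Involutive f) {a b : A}
    (h : f a = b ∨ f a = a ∨ f b = b) : joinEnds (cut f a) a b = joinEnds f a b := by
  funext x
  have h0 := hf x
  have h1 := hf a
  have h2 := hf b
  unfold joinEnds cut
  grind (splits := 30)

/-- The three alternatives say which old partner becomes the new one. They keep track of the set in
which the partners lie during the induction for `hatEval_eq`. -/
theorem joinEnds_live {f : A → A} (hf : Function.Involutive f) {a b x : A} (hab : a ≠ b) (ha : f a ≠ a)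
    (hb : f b ≠ b) (hxa : x ≠ a) (hxb : x ≠ b) (hx : f x ≠ x) :
    joinEnds f a b x ≠ x ∧ ((f a ≠ b ∧ joinEnds f a b x = f a) ∨
      (f b ≠ a ∧ joinEnds f a b x = f b) ∨ (f x ≠ a ∧ f x ≠ b ∧ joinEnds f a b x = f x)) := by
  have h0 := hf x
  have h1 := hf a
  have h2 := hf b
  unfold joinEnds
  grind (splits := 30)

/-- A singleton on the equator is killed by a hat: if it lies in the pair being removed, the cut and
the uncut term cancel. Any other singleton survives the removal of the pair in both terms, until it
is reached or ends up in `O`, where `q` vanishes. -/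
theorem hatEval_eq_zero (δ : 𝕜) (δ' : 𝕜ˣ) (q : (A → A) → Q) (O : Set A)
    (hq : ∀ g, (∃ x ∈ O, g x = x) → q g = 0) (l : List (A × A)) (hl : (ends l).Nodup)
    {f : A → A} (hf : Function.Involutive f) (hx : ∃ x, (x ∈ O ∨ x ∈ ends l) ∧ f x = x) :
    hatEval δ' (weighted δ δ' q l) (l.map Prod.fst) f = 0 := by
  induction l generalizing f with
  | nil =>
    obtain ⟨x, hx, hfx⟩ := hx
    have hxO : x ∈ O := by simpa [ends] using hx
    simp only [List.map_nil, hatEval, weighted, straighten, hq f ⟨x, hxO, hfx⟩, smul_zero]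
  | cons p l ih =>
    have hfst : ∀ z, z ∈ l.map Prod.fst → z ∈ ends l := by
      intro z hz
      obtain ⟨y, hy, rfl⟩ := List.mem_map.1 hz
      exact List.mem_flatMap.2 ⟨y, hy, by simp⟩
    have hl' : (p.1 ≠ p.2 ∧ p.1 ∉ ends l) ∧ p.2 ∉ ends l ∧ (ends l).Nodup := by
      simpa [ends, not_or] using hl
    obtain ⟨⟨hab, h1⟩, h2, h3⟩ := hl'
    rw [List.map_cons, hatEval_cons_pair δ δ' q p hab l _ (fun h => h1 (hfst _ h))
      (fun h => h2 (hfst _ h)) hf]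
    by_cases hfix : f p.1 = p.1 ∨ f p.2 = p.2
    -- Both terms have the same remainder. If the first vertex is a singleton, the cut costs `δ'⁻¹
    -- δ'`; if only the second is, the cut creates an open string, whose `δ'` again cancels `δ'⁻¹`.
    · rw [joinEnds_cut_self hf (Or.inr hfix), ← sub_smul]
      convert zero_smul 𝕜 _
      have e1 := hf p.1
      have e2 := hf p.2
      by_cases ha : f p.1 = p.1
      · rw [cut_of_fix hf ha]
        simp [ha]
      · have hb : f p.2 = p.2 := by tauto
        have hne : f p.1 ≠ p.2 := by grind
        have hc : cut f p.1 p.2 = p.2 := cut_fix hb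
        simp [stepWeight, ha, hb, hc, cut_self, hne, hab]
    · obtain ⟨x, hx, hfx⟩ := hx
      have hxa : x ≠ p.1 := by rintro rfl; exact hfix (Or.inl hfx)
      have hxb : x ≠ p.2 := by rintro rfl; exact hfix (Or.inr hfx)
      have hx' : x ∈ O ∨ x ∈ ends l := by
        simp only [ends, List.flatMap_cons, List.cons_append, List.nil_append,
          List.mem_cons] at hx ⊢
        tauto
      rw [ih h3 (joinEnds_invol hf _ _ hab) ⟨x, hx', joinEnds_fix (Or.inl hfx)⟩,
        ih h3 (joinEnds_invol (cut_invol hf _) _ _ hab)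
          ⟨x, hx', joinEnds_fix (Or.inl (cut_fix hfx))⟩, smul_zero, smul_zero, sub_zero]

/-- All relevant vertices have partners, and these are relevant too. Removing a pair that is not a
loop, the cut term contains a new singleton and vanishes; so a longer loop just shrinks, until its
last pair gives `δ - 1`. -/
theorem hatEval_eq (δ : 𝕜) (δ' : 𝕜ˣ) (q : (A → A) → Q) (O : Set A)
    (hq : ∀ g, (∃ x ∈ O, g x = x) → q g = 0) (l : List (A × A)) (hl : (ends l).Nodup)
    (hO : ∀ x ∈ O, x ∉ ends l)
    {f : A → A} (hf : Function.Involutive f) (hx : ∀ x, (x ∈ O ∨ x ∈ ends l) →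
      f x ≠ x ∧ (f x ∈ O ∨ f x ∈ ends l)) :
    hatEval δ' (weighted δ δ' q l) (l.map Prod.fst) f =
      (δ - 1) ^ numLoops f l • q (straighten f l) := by
  induction l generalizing f with
  | nil => simp [hatEval, weighted, straighten, numLoops, numStrings]
  | cons p l ih =>
    have hfst : ∀ z, z ∈ l.map Prod.fst → z ∈ ends l := by
      intro z hz
      obtain ⟨y, hy, rfl⟩ := List.mem_map.1 hz
      exact List.mem_flatMap.2 ⟨y, hy, by simp⟩
    have hl' : (p.1 ≠ p.2 ∧ p.1 ∉ ends l) ∧ p.2 ∉ ends l ∧ (ends l).Nodup := by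
      simpa [ends, not_or] using hl
    obtain ⟨⟨hab, h1⟩, h2, h3⟩ := hl'
    have hmem : ∀ z, z ∈ ends (p :: l) ↔ z = p.1 ∨ z = p.2 ∨ z ∈ ends l := by
      intro z
      simp [ends]
    simp only [hmem] at hO hx
    rw [List.map_cons, hatEval_cons_pair δ δ' q p hab l _ (fun h => h1 (hfst _ h))
      (fun h => h2 (hfst _ h)) hf]
    have ha := hx p.1 (by tauto)
    have hb := hx p.2 (by tauto)
    have e1 := hf p.1
    have e2 := hf p.2
    have hO1 : p.1 ∉ O := fun h => hO _ h (Or.inl rfl)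
    have hO2 : p.2 ∉ O := fun h => hO _ h (Or.inr (Or.inl rfl))
    have step := ih h3 (fun x hx hx' => hO x hx (by tauto)) (joinEnds_invol hf _ _ hab) (by
      intro x hxl
      have hxx := hx x (by tauto)
      have e3 := hf x
      have hxa : x ≠ p.1 := fun h => hxl.elim (fun h' => hO1 (h ▸ h')) (fun h' => h1 (h ▸ h'))
      have hxb : x ≠ p.2 := fun h => hxl.elim (fun h' => hO2 (h ▸ h')) (fun h' => h2 (h ▸ h'))
      have n0 : ∀ y, (y ∈ O ∨ y = p.1 ∨ y = p.2 ∨ y ∈ ends l) → y ≠ p.1 → y ≠ p.2 →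
          y ∈ O ∨ y ∈ ends l := by
        intro y hy hy1 hy2
        rcases hy with hy | hy | hy | hy
        exacts [Or.inl hy, absurd hy hy1, absurd hy hy2, Or.inr hy]
      have n1 := fun h => n0 (f p.1) ha.2 ha.1 h
      have n2 := fun h => n0 (f p.2) hb.2 h hb.1
      have n3 := n0 (f x) hxx.2
      have key := joinEnds_live hf hab ha.1 hb.1 hxa hxb hxx.1
      obtain ⟨k1, k2⟩ := key
      refine ⟨k1, ?_⟩
      rcases k2 with ⟨k, k2⟩ | ⟨k, k2⟩ | ⟨k, k', k2⟩
      · rw [k2]; exact n1 k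
      · rw [k2]; exact n2 k
      · rw [k2]; exact n3 k k')
    rw [step]
    by_cases hc : f p.1 = p.2
    -- A closed loop: `δ` without the cut, and `δ'⁻¹ δ' = 1` for the open string that the cut makes
    -- of it.
    · rw [joinEnds_cut_self hf (Or.inl hc), step, ← sub_smul, smul_smul]
      have hc2 : cut f p.1 p.2 = p.2 := by
        unfold cut
        grind
      simp only [numLoops, straighten, stepWeight, cut_self, hc, hc2, pow_add]
      congr 1
      simp [hab, hab.symm]
    -- The former partner of `p.1` is the singleton that makes the cut term vanish; it is neither
    -- `p.1` nor `p.2`, hence in `O` or in a later pair.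
    · rw [hatEval_eq_zero δ δ' q O hq l h3 (joinEnds_invol (cut_invol hf _) _ _ hab)
        ⟨f p.1, ?_, ?_⟩]
      · simp [stepWeight, hc, ha.1, numLoops, straighten]
      · tauto
      · refine joinEnds_fix (Or.inl ?_)
        simp [cut, e1]

end HatEvaluation

/-! ### Multiplication by `u_i` as cutting of diagrams -/

/-- Turn the vertex `z` of a diagram and its partner into singletons. -/
def Diagram.cut {n : ℕ} (d : Diagram n) (z : Fin n ⊕ Fin n) : Diagram n where
  partner := PartialBrauer.cut d.partner z
  partner_partner := cut_invol d.partner_partner z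

theorem Diagram.cut_of_fix {n : ℕ} {d : Diagram n} {z : Fin n ⊕ Fin n} (h : d.partner z = z) :
    d.cut z = d :=
  Diagram.ext (PartialBrauer.cut_of_fix d.partner_partner h)

theorem Diagram.cut_partner_self {n : ℕ} (d : Diagram n) (z : Fin n ⊕ Fin n) :
    (d.cut z).partner z = z := cut_self _ _

theorem Diagram.cut_partner_of_fix {n : ℕ} {d : Diagram n} {z w : Fin n ⊕ Fin n}
    (h : d.partner w = w) : (d.cut z).partner w = w := cut_fix h

theorem juxtapose_cut_left {n : ℕ} (d x : Diagram n) (z : Fin n ⊕ Fin n) :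
    juxtapose (d.cut z) x = cut (juxtapose d x) (Sum.inl z) := by
  funext w
  rcases w with w | w
  · simp only [juxtapose, Sum.map_inl, Diagram.cut, cut, Sum.inl.injEq]
    split_ifs <;> rfl
  · simp [juxtapose, cut]

theorem juxtapose_cut_right {n : ℕ} (d x : Diagram n) (z : Fin n ⊕ Fin n) :
    juxtapose d (x.cut z) = cut (juxtapose d x) (Sum.inr z) := by
  funext w
  rcases w with w | w
  · simp [juxtapose, cut]
  · simp only [juxtapose, Sum.map_inr, Diagram.cut, cut, Sum.inr.injEq]
    split_ifs <;> rfl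

theorem outer_not_mem_ends {n : ℕ} (z : Fin n ⊕ Fin n) : outer z ∉ ends (equator n) :=
  fun h => (mem_ends_equator _).1 h z rfl

/-- Stated for any `d'`, `x'` with the cut juxtaposition, so that it applies to cuts on the left of
`d` and to cuts on the right of `x`. -/
theorem compose_cut_outer {n : ℕ} (d x d' x' : Diagram n) (z : Fin n ⊕ Fin n)
    (h : juxtapose d' x' = cut (juxtapose d x) (outer z)) :
    d' * x' = (d * x).cut z ∧ loops d' x' = loops d x ∧
    strings d' x' + (if juxtapose d x (outer z) = outer z then 1 else 0) =
      strings d x + (if (d * x).partner z = z then 1 else 0) := by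
  obtain ⟨h1, h2, h3⟩ := straighten_cut (equator n) (equator_nodup n) (juxtapose_invol d x)
    (outer_not_mem_ends z)
  have hz : ∀ w, outer ((d * x).partner w) = straighten (juxtapose d x) (equator n) (outer w) :=
    outer_composePartner d x
  refine ⟨?_, ?_, ?_⟩
  · refine Diagram.ext (funext fun w => outer_injective ?_)
    refine (outer_composePartner d' x' w).trans ?_
    rw [h, h1]
    simp only [cut, ← hz, outer_injective.eq_iff, Diagram.cut]
    split_ifs <;> rfl
  · rw [loops, h, h2, loops]
  · rw [strings, h, h3, strings, ← hz]
    simp only [outer_injective.eq_iff]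

theorem cutDiagram_eq_left {n : ℕ} (i : Fin n) :
    cutDiagram i = (identity n).cut (Sum.inl i) := by
  refine Diagram.ext (funext fun w => ?_)
  rcases w with w | w <;> simp [cutDiagram, Diagram.cut, cut, identity]

theorem cutDiagram_eq_right {n : ℕ} (i : Fin n) :
    cutDiagram i = (identity n).cut (Sum.inr i) := by
  refine Diagram.ext (funext fun w => ?_)
  rcases w with w | w <;> simp [cutDiagram, Diagram.cut, cut, identity]

/-- The diagram `u_i` is the identity cut at the exterior vertex `i`, so the product is `1 * x`, cut
there. The first vertex is not a singleton in the juxtaposition with the identity, and the balance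
of `compose_cut_outer` leaves just the stated number of strings. -/
theorem cutDiagram_mul {n : ℕ} (i : Fin n) (x : Diagram n) :
    cutDiagram i * x = x.cut (Sum.inl i) ∧ loops (cutDiagram i) x = 0 ∧
    strings (cutDiagram i) x = if x.partner (Sum.inl i) = Sum.inl i then 1 else 0 := by
  obtain ⟨h1, h2, h3⟩ := compose_cut_outer (identity n) x (cutDiagram i) x (Sum.inl i)
    (by rw [cutDiagram_eq_left, juxtapose_cut_left]; rfl)
  have h4 : identity n * x = x := one_mul x
  rw [h4] at h1
  rw [(identity_compose x).2.1] at h2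
  rw [(identity_compose x).2.2, if_neg (by simp [juxtapose, outer, identity])] at h3
  simp only [h4] at h3
  exact ⟨h1, h2, by omega⟩

theorem mul_cutDiagram {n : ℕ} (i : Fin n) (x : Diagram n) :
    x * cutDiagram i = x.cut (Sum.inr i) ∧ loops x (cutDiagram i) = 0 ∧
    strings x (cutDiagram i) = if x.partner (Sum.inr i) = Sum.inr i then 1 else 0 := by
  obtain ⟨h1, h2, h3⟩ := compose_cut_outer x (identity n) x (cutDiagram i) (Sum.inr i)
    (by rw [cutDiagram_eq_right, juxtapose_cut_right]; rfl)
  have h4 : x * identity n = x := mul_one x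
  rw [h4] at h1
  rw [(compose_identity x).2.1] at h2
  rw [(compose_identity x).2.2, if_neg (by simp [juxtapose, outer, identity])] at h3
  simp only [h4] at h3
  exact ⟨h1, h2, by omega⟩

/-! ### The idempotents `û_i` in the partial Brauer algebra -/

section Algebra

variable {𝕜 : Type*} [CommRing 𝕜] {n : ℕ} (δ : 𝕜) (δ' : 𝕜ˣ)

theorem basis_mul_basis (η η' : 𝕜) (d x : Diagram n) : basis η η' d * basis η η' x =
    (η ^ loops d x * η' ^ strings d x) • basis η η' (d * x) := by
  simp only [basis, TwistedAlgebra.single_mul_single, TwistedAlgebra.smul_single, one_mul, mul_one]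
  rfl

theorem basis_cutDiagram_mul (η η' : 𝕜) (i : Fin n) (x : Diagram n) :
    basis η η' (cutDiagram i) * basis η η' x =
      η' ^ (if x.partner (Sum.inl i) = Sum.inl i then 1 else 0) •
        basis η η' (x.cut (Sum.inl i)) := by
  obtain ⟨h1, h2, h3⟩ := cutDiagram_mul i x
  rw [basis_mul_basis, h1, h2, h3, pow_zero, one_mul]

theorem basis_mul_cutDiagram (η η' : 𝕜) (i : Fin n) (x : Diagram n) :
    basis η η' x * basis η η' (cutDiagram i) =
      η' ^ (if x.partner (Sum.inr i) = Sum.inr i then 1 else 0) •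
        basis η η' (x.cut (Sum.inr i)) := by
  obtain ⟨h1, h2, h3⟩ := mul_cutDiagram i x
  rw [basis_mul_basis, h1, h2, h3, pow_zero, one_mul]

theorem basis_cutDiagram_mul_of_fix (η η' : 𝕜) {i : Fin n} {x : Diagram n}
    (h : x.partner (Sum.inl i) = Sum.inl i) :
    basis η η' (cutDiagram i) * basis η η' x = η' • basis η η' x := by
  rw [basis_cutDiagram_mul, if_pos h, Diagram.cut_of_fix h, pow_one]

theorem basis_mul_cutDiagram_of_fix (η η' : 𝕜) {i : Fin n} {x : Diagram n}
    (h : x.partner (Sum.inr i) = Sum.inr i) :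
    basis η η' x * basis η η' (cutDiagram i) = η' • basis η η' x := by
  rw [basis_mul_cutDiagram, if_pos h, Diagram.cut_of_fix h, pow_one]

theorem basis_cutDiagram_commute (η η' : 𝕜) (i j : Fin n) :
    Commute (basis η η' (cutDiagram i)) (basis η η' (cutDiagram j)) := by
  by_cases hij : i = j
  · rw [hij]
  · rw [Commute, SemiconjBy, basis_cutDiagram_mul, basis_mul_cutDiagram]
    have h : (cutDiagram j).cut (Sum.inl i) = (cutDiagram j).cut (Sum.inr i) := by
      refine Diagram.ext (funext fun w => ?_)
      rcases w with w | w <;> simp only [cutDiagram, Diagram.cut, cut, Sum.elim_inl, Sum.elim_inr]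
        <;> grind
    rw [h]
    simp [cutDiagram, hij]

theorem uHat_commute_cutDiagram (i j : Fin n) :
    Commute (uHat δ δ' i) (basis δ (δ' : 𝕜) (cutDiagram j)) :=
  (Commute.one_left _).sub_left ((basis_cutDiagram_commute δ (δ' : 𝕜) i j).smul_left _)

theorem uHat_commute (i j : Fin n) : Commute (uHat δ δ' i) (uHat δ δ' j) :=
  (Commute.one_right _).sub_right ((uHat_commute_cutDiagram δ δ' i j).smul_right _)

theorem uHat_mul_of_fix {i : Fin n} {d : Diagram n} (h : d.partner (Sum.inl i) = Sum.inl i) :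
    uHat δ δ' i * basis δ (δ' : 𝕜) d = 0 := by
  rw [uHat, sub_mul, one_mul, smul_mul_assoc, basis_cutDiagram_mul_of_fix _ _ h, smul_smul,
    Units.inv_mul, one_smul, sub_self]

theorem mul_uHat_of_fix {i : Fin n} {d : Diagram n} (h : d.partner (Sum.inr i) = Sum.inr i) :
    basis δ (δ' : 𝕜) d * uHat δ δ' i = 0 := by
  rw [uHat, mul_sub, mul_one, mul_smul_comm, basis_mul_cutDiagram_of_fix _ _ h, smul_smul,
    Units.inv_mul, one_smul, sub_self]

theorem uHat_idem (i : Fin n) : uHat δ δ' i * uHat δ δ' i = uHat δ δ' i := by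
  conv_lhs => enter [2]; rw [uHat]
  rw [mul_sub, mul_one, mul_smul_comm, uHat_mul_of_fix δ δ' (by simp [cutDiagram]), smul_zero,
    sub_zero]

/-- The product of the elements `û_i`, for `i` in a list. -/
noncomputable def uHatList (m : List (Fin n)) : PartialBrauerAlgebra n δ (δ' : 𝕜) :=
  (m.map (uHat δ δ')).prod

theorem uHatList_cons (i : Fin n) (m : List (Fin n)) :
    uHatList δ δ' (i :: m) = uHat δ δ' i * uHatList δ δ' m := by
  simp [uHatList]

theorem uHatList_nil : uHatList δ δ' ([] : List (Fin n)) = 1 := by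
  simp [uHatList]

theorem uHat_commute_list (i : Fin n) (m : List (Fin n)) :
    Commute (uHat δ δ' i) (uHatList δ δ' m) := by
  refine Commute.list_prod_right _ _ fun y hy => ?_
  obtain ⟨j, -, rfl⟩ := List.mem_map.1 hy
  exact uHat_commute δ δ' i j

theorem cutDiagram_commute_list (i : Fin n) (m : List (Fin n)) :
    Commute (basis δ (δ' : 𝕜) (cutDiagram i)) (uHatList δ δ' m) := by
  refine Commute.list_prod_right _ _ fun y hy => ?_
  obtain ⟨j, -, rfl⟩ := List.mem_map.1 hy
  exact (uHat_commute_cutDiagram δ δ' j i).symm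

theorem uHatList_idem (m : List (Fin n)) :
    uHatList δ δ' m * uHatList δ δ' m = uHatList δ δ' m := by
  induction m with
  | nil => rw [uHatList_nil, one_mul]
  | cons i m ih =>
    rw [uHatList_cons, mul_assoc, ← mul_assoc (uHatList δ δ' m), ← (uHat_commute_list δ δ' i m).eq,
      mul_assoc, ih, ← mul_assoc, uHat_idem]

theorem uHatList_mul_of_fix {i : Fin n} {m : List (Fin n)} (hi : i ∈ m) {d : Diagram n}
    (h : d.partner (Sum.inl i) = Sum.inl i) : uHatList δ δ' m * basis δ (δ' : 𝕜) d = 0 := by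
  induction m with
  | nil => simp at hi
  | cons j m ih =>
    rw [uHatList_cons]
    rcases List.mem_cons.1 hi with rfl | hi
    · rw [(uHat_commute_list δ δ' i m).eq, mul_assoc, uHat_mul_of_fix δ δ' h, mul_zero]
    · rw [mul_assoc, ih hi, mul_zero]

theorem mul_uHatList_of_fix {i : Fin n} {m : List (Fin n)} (hi : i ∈ m) {d : Diagram n}
    (h : d.partner (Sum.inr i) = Sum.inr i) : basis δ (δ' : 𝕜) d * uHatList δ δ' m = 0 := by
  induction m with
  | nil => simp at hi
  | cons j m ih =>
    rw [uHatList_cons]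
    rcases List.mem_cons.1 hi with rfl | hi
    · rw [← mul_assoc, mul_uHat_of_fix δ δ' h, zero_mul]
    · rw [(uHat_commute_list δ δ' j m).eq, ← mul_assoc, ih hi, zero_mul]

variable {Q : Type*} [AddCommGroup Q] [Module 𝕜 Q]

/-- Two linear maps which agree on the diagrams are equal. -/
theorem linearMap_ext {η η' : 𝕜} {p q : PartialBrauerAlgebra n η η' →ₗ[𝕜] Q}
    (h : ∀ d, p (basis η η' d) = q (basis η η' d)) : p = q := by
  refine LinearMap.ext fun y => ?_
  induction y using TwistedAlgebra.induction with
  | h0 => rw [map_zero, map_zero]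
  | hadd x y hx hy => rw [map_add, map_add, hx, hy]
  | hs d r =>
    have : TwistedAlgebra.single (partialBrauerTwist n η η') d r = r • basis η η' d := by
      rw [basis, TwistedAlgebra.smul_single, mul_one]
    rw [this, map_smul, map_smul, h]

/-- Every diagram in `u_i y` has a singleton at `i`, so a map that vanishes on such diagrams cannot
tell `û_i` from `1`. -/
theorem map_uHatList_mul (q : PartialBrauerAlgebra n δ (δ' : 𝕜) →ₗ[𝕜] Q) (m : List (Fin n))
    (hq : ∀ i ∈ m, ∀ d : Diagram n, d.partner (Sum.inl i) = Sum.inl i → q (basis δ (δ' : 𝕜) d) = 0)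
    (y : PartialBrauerAlgebra n δ (δ' : 𝕜)) : q (uHatList δ δ' m * y) = q y := by
  induction m with
  | nil => rw [uHatList_nil, one_mul]
  | cons i m ih =>
    have key : q ∘ₗ LinearMap.mulLeft 𝕜 (basis δ (δ' : 𝕜) (cutDiagram i)) = 0 := by
      refine linearMap_ext fun d => ?_
      rw [LinearMap.comp_apply, LinearMap.mulLeft_apply, basis_cutDiagram_mul, map_smul,
        hq i List.mem_cons_self _ (Diagram.cut_partner_self _ _), smul_zero,
        LinearMap.zero_apply]
    have key' : ∀ z, q (basis δ (δ' : 𝕜) (cutDiagram i) * z) = 0 := fun z =>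
      LinearMap.congr_fun key z
    rw [uHatList_cons, mul_assoc, uHat, sub_mul, one_mul, smul_mul_assoc, map_sub, map_smul,
      key', smul_zero, sub_zero, ih fun j hj => hq j (List.mem_cons_of_mem _ hj)]

theorem map_mul_uHatList (q : PartialBrauerAlgebra n δ (δ' : 𝕜) →ₗ[𝕜] Q) (m : List (Fin n))
    (hq : ∀ i ∈ m, ∀ d : Diagram n, d.partner (Sum.inr i) = Sum.inr i → q (basis δ (δ' : 𝕜) d) = 0)
    (y : PartialBrauerAlgebra n δ (δ' : 𝕜)) : q (y * uHatList δ δ' m) = q y := by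
  induction m with
  | nil => rw [uHatList_nil, mul_one]
  | cons i m ih =>
    have key : q ∘ₗ LinearMap.mulRight 𝕜 (basis δ (δ' : 𝕜) (cutDiagram i)) = 0 := by
      refine linearMap_ext fun d => ?_
      rw [LinearMap.comp_apply, LinearMap.mulRight_apply, basis_mul_cutDiagram, map_smul,
        hq i List.mem_cons_self _ (Diagram.cut_partner_self _ _), smul_zero,
        LinearMap.zero_apply]
    have key' : ∀ z, q (z * basis δ (δ' : 𝕜) (cutDiagram i)) = 0 := fun z =>
      LinearMap.congr_fun key z
    rw [uHatList_cons, (uHat_commute_list δ δ' i m).eq, ← mul_assoc, uHat, mul_sub, mul_one,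
      mul_smul_comm, map_sub, map_smul,
      key', smul_zero, sub_zero, ih fun j hj => hq j (List.mem_cons_of_mem _ hj)]

open Classical in
/-- The value of `q` on the diagram with the partner map `g` on the outer vertices. -/
noncomputable def outerValue {η η' : 𝕜} (q : PartialBrauerAlgebra n η η' →ₗ[𝕜] Q)
    (g : (Fin n ⊕ Fin n) ⊕ (Fin n ⊕ Fin n) → (Fin n ⊕ Fin n) ⊕ (Fin n ⊕ Fin n)) : Q :=
  if h : ∀ z, unouter (g (outer (unouter (g (outer z))))) = z then
    q (basis η η' ⟨fun z => unouter (g (outer z)), h⟩) else 0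

theorem outerValue_straighten {η η' : 𝕜} (q : PartialBrauerAlgebra n η η' →ₗ[𝕜] Q)
    (d x : Diagram n) : outerValue q (straighten (juxtapose d x) (equator n)) =
      q (basis η η' (d * x)) :=
  dif_pos (compose d x).partner_partner

/-- Each factor `û_i` next to `d` either does nothing or cuts `d` at `i'`, a vertex of the equator.
Once all choices are made, what is left is a product of two diagrams. Passing through a linear map
`q` allows exterior singletons to be discarded later. -/
theorem map_mul_uHatList_mul (q : PartialBrauerAlgebra n δ (δ' : 𝕜) →ₗ[𝕜] Q) (m : List (Fin n))
    (d x : Diagram n) : q (basis δ (δ' : 𝕜) d * uHatList δ δ' m * basis δ (δ' : 𝕜) x) =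
      hatEval δ' (weighted δ (δ' : 𝕜) (outerValue q) (equator n))
        (m.map fun i => Sum.inl (Sum.inr i)) (juxtapose d x) := by
  induction m generalizing d with
  | nil =>
    rw [uHatList_nil, mul_one, basis_mul_basis, map_smul, List.map_nil, hatEval, weighted,
      outerValue_straighten]
    rfl
  | cons i m ih =>
    rw [List.map_cons, hatEval, ← juxtapose_cut_left, ← ih, ← ih, uHatList_cons, ← mul_assoc, uHat,
      mul_sub, mul_one, mul_smul_comm, basis_mul_cutDiagram, sub_mul, sub_mul, map_sub, smul_smul,
      smul_mul_assoc, smul_mul_assoc, map_smul]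
    have : (juxtapose d x (Sum.inl (Sum.inr i)) = Sum.inl (Sum.inr i)) ↔
      d.partner (Sum.inr i) = Sum.inr i := by simp [juxtapose]
    simp only [this]

end Algebra

/-! ### Products `d û x`, with singletons facing each other at some places of the equator -/

theorem joinEnds_of_fix {A : Type*} [DecidableEq A] {f : A → A} (hf : Function.Involutive f)
    {a b : A} (ha : f a = a) (hb : f b = b) : joinEnds f a b = f := by
  funext x
  have h0 := hf x
  unfold joinEnds
  grind

theorem straighten_append_of_fix {A : Type*} [DecidableEq A] (l l' : List (A × A)) {f : A → A}
    (hf : Function.Involutive f) (hfix : ∀ x ∈ ends l, f x = x) (hl : (ends l).Nodup) :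
    straighten f (l ++ l') = straighten f l' ∧ numLoops f (l ++ l') = numLoops f l' := by
  induction l with
  | nil => exact ⟨rfl, rfl⟩
  | cons p l ih =>
    simp only [ends, List.flatMap_cons, List.cons_append, List.nil_append, List.nodup_cons,
      List.mem_cons, forall_eq_or_imp, not_or] at hfix hl ih
    have hj := joinEnds_of_fix hf hfix.1 hfix.2.1
    obtain ⟨h1, h2⟩ := ih hfix.2.2 hl.2.2
    simp only [List.cons_append, straighten, numLoops, hj, hfix.1, h1, h2, hl.1.1, if_false,
      zero_add, and_self]

/-- Two singletons that face each other are an open string, unaffected by the cuts elsewhere; each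
such pair gives one factor `δ'`. -/
theorem hatEval_append_of_fix {𝕜 A Q : Type*} [CommRing 𝕜] [DecidableEq A] [AddCommGroup Q]
    [Module 𝕜 Q] (δ : 𝕜) (δ' : 𝕜ˣ) (q : (A → A) → Q) (l l' : List (A × A)) (m : List A)
    {f : A → A} (hf : Function.Involutive f) (hfix : ∀ x ∈ ends l, f x = x) (hl : (ends l).Nodup)
    (hm : ∀ x ∈ ends l, x ∉ m) :
    hatEval δ' (weighted δ δ' q (l ++ l')) m f =
      (δ' : 𝕜) ^ l.length • hatEval δ' (weighted δ δ' q l') m f := by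
  induction l with
  | nil => simp
  | cons p l ih =>
    simp only [ends, List.flatMap_cons, List.cons_append, List.nil_append, List.nodup_cons,
      List.mem_cons, forall_eq_or_imp, not_or] at hfix hl hm ih
    rw [List.cons_append, hatEval_weighted_cons δ δ' q p hl.1.1 _ _ hm.1 hm.2.1 hf,
      joinEnds_of_fix hf hfix.1 hfix.2.1, ih hfix.2.2 hl.2.2 hm.2.2, smul_smul, List.length_cons]
    simp [stepWeight, hfix.1, hfix.2.1, hl.1.1, pow_succ']

/-- The pairs of vertices of the equator at the places in a list. -/
def equatorAt {n : ℕ} (m : List (Fin n)) :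
    List (((Fin n ⊕ Fin n) ⊕ (Fin n ⊕ Fin n)) × ((Fin n ⊕ Fin n) ⊕ (Fin n ⊕ Fin n))) :=
  m.map fun i => (Sum.inl (Sum.inr i), Sum.inr (Sum.inl i))

theorem mem_ends_equatorAt {n : ℕ} (m : List (Fin n))
    (x : (Fin n ⊕ Fin n) ⊕ (Fin n ⊕ Fin n)) : x ∈ ends (equatorAt m) ↔
      ∃ i ∈ m, x = Sum.inl (Sum.inr i) ∨ x = Sum.inr (Sum.inl i) := by
  simp [ends, equatorAt]

/-- The product `d û x`, up to diagrams with new singletons outside of the equator. -/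
theorem map_mul_uHatList_mul_eq {𝕜 Q : Type*} [CommRing 𝕜] [AddCommGroup Q] [Module 𝕜 Q] {n : ℕ}
    (δ : 𝕜) (δ' : 𝕜ˣ) (q : PartialBrauerAlgebra n δ (δ' : 𝕜) →ₗ[𝕜] Q) (s m : List (Fin n))
    (hs : List.finRange n = s ++ m) (d x : Diagram n)
    (hds : ∀ i ∈ s, d.partner (Sum.inr i) = Sum.inr i)
    (hxs : ∀ i ∈ s, x.partner (Sum.inl i) = Sum.inl i)
    (hdm : ∀ i ∈ m, d.partner (Sum.inr i) ≠ Sum.inr i)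
    (hxm : ∀ i ∈ m, x.partner (Sum.inl i) ≠ Sum.inl i)
    (hql : ∀ (y : Diagram n) (i : Fin n), d.partner (Sum.inl i) ≠ Sum.inl i →
      y.partner (Sum.inl i) = Sum.inl i → q (basis δ (δ' : 𝕜) y) = 0)
    (hqr : ∀ (y : Diagram n) (i : Fin n), x.partner (Sum.inr i) ≠ Sum.inr i →
      y.partner (Sum.inr i) = Sum.inr i → q (basis δ (δ' : 𝕜) y) = 0) :
    q (basis δ (δ' : 𝕜) d * uHatList δ δ' m * basis δ (δ' : 𝕜) x) =
      ((δ' : 𝕜) ^ s.length * (δ - 1) ^ loops d x) • q (basis δ (δ' : 𝕜) (d * x)) := by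
  have heq : equator n = equatorAt s ++ equatorAt m := by
    rw [equator, hs, List.map_append, equatorAt, equatorAt]
  have hnd := equator_nodup n
  have hends : ∀ z, z ∈ ends (equator n) ↔ z ∈ ends (equatorAt s) ∨ z ∈ ends (equatorAt m) := by
    intro z
    simp [heq, ends]
  have hsplit : ends (equatorAt s ++ equatorAt m) = ends (equatorAt s) ++ ends (equatorAt m) := by
    simp [ends]
  rw [heq, hsplit, List.nodup_append] at hnd
  have hinv := juxtapose_invol d x
  have hfix : ∀ z ∈ ends (equatorAt s), juxtapose d x z = z := by
    intro z hz
    obtain ⟨i, hi, rfl | rfl⟩ := (mem_ends_equatorAt _ _).1 hz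
    · simp [juxtapose, hds i hi]
    · simp [juxtapose, hxs i hi]
  have hnfix : ∀ z ∈ ends (equatorAt m), juxtapose d x z ≠ z := by
    intro z hz
    obtain ⟨i, hi, rfl | rfl⟩ := (mem_ends_equatorAt _ _).1 hz
    · simp [juxtapose, hdm i hi]
    · simp [juxtapose, hxm i hi]
  have hm : (m.map fun i => (Sum.inl (Sum.inr i) : (Fin n ⊕ Fin n) ⊕ (Fin n ⊕ Fin n))) =
      (equatorAt m).map Prod.fst := by
    simp [equatorAt]
  have hmm : ∀ z, z ∈ (equatorAt m).map Prod.fst → z ∈ ends (equatorAt m) := by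
    intro z hz
    obtain ⟨y, hy, rfl⟩ := List.mem_map.1 hz
    exact List.mem_flatMap.2 ⟨y, hy, by simp⟩
  obtain ⟨h1, h2⟩ := straighten_append_of_fix (equatorAt s) (equatorAt m) hinv hfix hnd.1
  -- The exterior vertices with partners. A singleton of the result at one of them is new, and `q`
  -- vanishes by `hql` or `hqr`.
  set O : Set ((Fin n ⊕ Fin n) ⊕ (Fin n ⊕ Fin n)) :=
    {z | z ∉ ends (equator n) ∧ juxtapose d x z ≠ z} with hO
  have hlive : ∀ z, juxtapose d x z ≠ z → z ∈ O ∨ z ∈ ends (equatorAt m) := by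
    intro z hz
    by_cases h : z ∈ ends (equator n)
    · rcases (hends z).1 h with h | h
      · exact absurd (hfix z h) hz
      · exact Or.inr h
    · exact Or.inl ⟨h, hz⟩
  rw [map_mul_uHatList_mul, heq, hm, hatEval_append_of_fix δ δ' _ _ _ _ hinv hfix hnd.1
    (fun z hz hz' => hnd.2.2 z hz z (hmm z hz') rfl), hatEval_eq δ δ' _ O ?_ _ hnd.2.1 ?_ hinv ?_,
    smul_smul, ← h1, ← heq, outerValue_straighten, loops, heq, h2]
  · rw [equatorAt, List.length_map]
  · rintro g ⟨z, ⟨hz, hz'⟩, hg⟩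
    rw [outerValue]
    split_ifs with h
    · rw [mem_ends_equator] at hz
      push Not at hz
      obtain ⟨y, rfl⟩ := hz
      rcases y with i | i
      · refine hql _ i (fun h => hz' ?_) ?_
        · simp [juxtapose, outer, h]
        · change unouter (g (outer _)) = _
          rw [hg]
          rfl
      · refine hqr _ i (fun h => hz' ?_) ?_
        · simp [juxtapose, outer, h]
        · change unouter (g (outer _)) = _
          rw [hg]
          rfl
    · rfl
  · intro z hz hz'
    exact hz.1 ((hends z).2 (Or.inr hz'))
  · intro z hz
    have hne : juxtapose d x z ≠ z := hz.elim (fun h => h.2) (hnfix z)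
    -- The partner of a vertex with a partner has one too, so the vertices with partners are closed
    -- under the involution, as `hatEval_eq` needs.
    exact ⟨hne, hlive _ fun h => hne (hinv.injective h)⟩

/-! ### Gluing a diagram from an involution of some of its vertices -/

section Glue

variable {n N : ℕ} {K : Type*}

/-- The diagram with the parts of `h`, moved along `ι` and `r`, further singletons on the left, and
further parts on the right given by `g`. -/
noncomputable def glue (ι : Fin n → Fin N) (r : K → Fin N) (g : Fin N → Fin N)
    (h : Fin n ⊕ K → Fin n ⊕ K) (hι : Function.Injective ι) (hr : Function.Injective r)
    (hg : ∀ j, j ∉ Set.range r → g j ∉ Set.range r ∧ g (g j) = j) (hh : Function.Involutive h) :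
    Diagram N where
  partner := Function.extend (Sum.map ι r) (Sum.map ι r ∘ h) (Sum.map id g)
  partner_partner x := by
    have hE := hι.sumMap hr
    by_cases hx : ∃ z, Sum.map ι r z = x
    · obtain ⟨z, rfl⟩ := hx
      rw [hE.extend_apply, Function.comp_apply, hE.extend_apply, Function.comp_apply, hh z]
    · rw [Function.extend_apply' _ _ _ hx, Function.extend_apply']
      · rcases x with i | j
        · rfl
        · exact congrArg Sum.inr (hg j fun ⟨z, hz⟩ => hx ⟨Sum.inr z, congrArg Sum.inr hz⟩).2
      · rcases x with i | j
        · exact hx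
        · rintro ⟨z | z, hz⟩
          · simp at hz
          · exact (hg j fun ⟨z, hz⟩ => hx ⟨Sum.inr z, congrArg Sum.inr hz⟩).1
              ⟨z, Sum.inr.inj hz⟩

variable {ι : Fin n → Fin N} {r : K → Fin N} {g : Fin N → Fin N}
    {h : Fin n ⊕ K → Fin n ⊕ K} {hι : Function.Injective ι} {hr : Function.Injective r}
    {hg : ∀ j, j ∉ Set.range r → g j ∉ Set.range r ∧ g (g j) = j} {hh : Function.Involutive h}

theorem glue_map (z : Fin n ⊕ K) :
    (glue ι r g h hι hr hg hh).partner (Sum.map ι r z) = Sum.map ι r (h z) :=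
  (hι.sumMap hr).extend_apply _ _ _

theorem glue_inl {i : Fin N} (hi : i ∉ Set.range ι) :
    (glue ι r g h hι hr hg hh).partner (Sum.inl i) = Sum.inl i :=
  Function.extend_apply' _ _ _ (by
    rintro ⟨z | z, hz⟩
    · exact hi ⟨z, Sum.inl.inj hz⟩
    · simp at hz)

theorem glue_inr {j : Fin N} (hj : j ∉ Set.range r) :
    (glue ι r g h hι hr hg hh).partner (Sum.inr j) = Sum.inr (g j) :=
  Function.extend_apply' _ _ _ (by
    rintro ⟨z | z, hz⟩
    · simp at hz
    · exact hj ⟨z, Sum.inr.inj hz⟩)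

theorem eq_glue {x : Diagram N} (h1 : ∀ z, x.partner (Sum.map ι r z) = Sum.map ι r (h z))
    (h2 : ∀ i, i ∉ Set.range ι → x.partner (Sum.inl i) = Sum.inl i)
    (h3 : ∀ j, j ∉ Set.range r → x.partner (Sum.inr j) = Sum.inr (g j)) :
    x = glue ι r g h hι hr hg hh := by
  refine Diagram.ext (funext fun w => ?_)
  rcases w with i | j
  · by_cases hi : i ∈ Set.range ι
    · obtain ⟨i, rfl⟩ := hi
      exact (h1 (Sum.inl i)).trans (glue_map (Sum.inl i)).symm
    · rw [h2 i hi, glue_inl hi]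
  · by_cases hj : j ∈ Set.range r
    · obtain ⟨j, rfl⟩ := hj
      exact (h1 (Sum.inr j)).trans (glue_map (Sum.inr j)).symm
    · rw [h3 j hj, glue_inr hj]

end Glue

/-! ### Inserting places -/

/-- A decomposition of the `N` places of a diagram into the `n` places given by `ι`, and those
in the list `s`. -/
structure Places (n N : ℕ) where
  ι : Fin n → Fin N
  s : List (Fin N)
  finRange_eq : List.finRange N = s ++ (List.finRange n).map ι

namespace Places

variable {n N : ℕ} (S : Places n N)

theorem injective : Function.Injective S.ι := by
  have h := List.nodup_finRange N
  rw [S.finRange_eq, List.nodup_append] at h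
  intro i j hij
  exact List.inj_on_of_nodup_map h.2.1 (List.mem_finRange i) (List.mem_finRange j) hij

theorem mem_iff (i : Fin N) : i ∈ S.s ↔ i ∉ Set.range S.ι := by
  have h := List.nodup_finRange N
  rw [S.finRange_eq, List.nodup_append] at h
  constructor
  · rintro hi ⟨j, rfl⟩
    exact h.2.2 _ hi _ (List.mem_map.2 ⟨j, List.mem_finRange j, rfl⟩) rfl
  · intro hi
    have h' := List.mem_finRange i
    rw [S.finRange_eq, List.mem_append] at h'
    rcases h' with h' | h'
    · exact h'
    · obtain ⟨j, -, hj⟩ := List.mem_map.1 h'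
      exact absurd ⟨j, hj⟩ hi

/-- Insert singletons at the places not in the image of `ι`. -/
noncomputable def pad (b : Diagram n) : Diagram N :=
  glue S.ι S.ι id b.partner S.injective S.injective (fun _ hj => ⟨hj, rfl⟩) b.partner_partner

/-- The diagrams with singletons on the left at exactly the places in `s`. -/
def Proper (x : Diagram N) : Prop :=
  (∀ i ∈ S.s, x.partner (Sum.inl i) = Sum.inl i) ∧
    ∀ i, x.partner (Sum.inl (S.ι i)) ≠ Sum.inl (S.ι i)

theorem pad_map (b : Diagram n) (z : Fin n ⊕ Fin n) :
    (S.pad b).partner (Sum.map S.ι S.ι z) = Sum.map S.ι S.ι (b.partner z) := glue_map z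

theorem pad_inl (b : Diagram n) {i : Fin N} (hi : i ∈ S.s) :
    (S.pad b).partner (Sum.inl i) = Sum.inl i := glue_inl ((S.mem_iff i).1 hi)

theorem pad_inr (b : Diagram n) {i : Fin N} (hi : i ∈ S.s) :
    (S.pad b).partner (Sum.inr i) = Sum.inr i := glue_inr ((S.mem_iff i).1 hi)

theorem eq_pad {b : Diagram n} {x : Diagram N}
    (h1 : ∀ z, x.partner (Sum.map S.ι S.ι z) = Sum.map S.ι S.ι (b.partner z))
    (h2 : ∀ i ∈ S.s, x.partner (Sum.inl i) = Sum.inl i)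
    (h3 : ∀ i ∈ S.s, x.partner (Sum.inr i) = Sum.inr i) : x = S.pad b :=
  eq_glue h1 (fun i hi => h2 i ((S.mem_iff i).2 hi)) (fun i hi => h3 i ((S.mem_iff i).2 hi))

theorem pad_injective : Function.Injective S.pad := by
  intro b b' h
  refine Diagram.ext (funext fun z => S.injective.sumMap S.injective ?_)
  rw [← pad_map, ← pad_map, h]

theorem proper_pad (b : BrauerDiagram n) : S.Proper (S.pad b.1) := by
  refine ⟨fun i hi => S.pad_inl _ hi, fun i h => b.2 (Sum.inl i) ?_⟩
  exact S.injective.sumMap S.injective ((S.pad_map b.1 (Sum.inl i)).symm.trans h)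

theorem pad_inr_ne (b : BrauerDiagram n) (i : Fin n) :
    (S.pad b.1).partner (Sum.inr (S.ι i)) ≠ Sum.inr (S.ι i) := by
  intro h
  refine b.2 (Sum.inr i) ?_
  exact S.injective.sumMap S.injective ((S.pad_map b.1 (Sum.inr i)).symm.trans h)

end Places

/-! ### Products of glued diagrams -/

section Product

variable {n N : ℕ} {K : Type*}

/-- The pairs of vertices to be identified. -/
def halfEquator (n : ℕ) (K : Type*) : List (((Fin n ⊕ Fin n) ⊕ (Fin n ⊕ K)) × ((Fin n ⊕ Fin n) ⊕ (Fin n ⊕ K))) :=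
  (List.finRange n).map fun i => (Sum.inl (Sum.inr i), Sum.inr (Sum.inl i))

/-- The vertices on the exterior of a juxtaposition. -/
def halfOuter : Fin n ⊕ K → (Fin n ⊕ Fin n) ⊕ (Fin n ⊕ K)
  | Sum.inl i => Sum.inl (Sum.inl i)
  | Sum.inr j => Sum.inr (Sum.inr j)

theorem halfEquator_nodup : (ends (halfEquator n K)).Nodup :=
  ends_nodup _ _ (fun i j h => by simpa using h) (fun i j h => by simpa using h) (by simp)

theorem halfOuter_not_mem (z : Fin n ⊕ K) : halfOuter z ∉ ends (halfEquator n K) := by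
  rcases z with z | z <;> simp [ends, halfEquator, halfOuter]

theorem halfOuter_eq_outer : halfOuter (n := n) (K := Fin n) = outer := by
  funext z
  rcases z with z | z <;> rfl

/-- At the places in `s` two singletons face each other, which affects neither the loops nor the
straightened involution. Everything else takes place in the image of a smaller juxtaposition that
knows `b` and `h` only, not the embedding. This is why products can be compared between different
ranks and cells. -/
theorem Places.mul_glued [DecidableEq K] (S : Places n N) {r : K → Fin N}
    (hr : Function.Injective r) {h : Fin n ⊕ K → Fin n ⊕ K} (b : Diagram n) (x : Diagram N)
    (hx : ∀ z, x.partner (Sum.map S.ι r z) = Sum.map S.ι r (h z))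
    (hxs : ∀ i ∈ S.s, x.partner (Sum.inl i) = Sum.inl i) :
    loops (S.pad b) x = numLoops (Sum.map b.partner h) (halfEquator n K) ∧
    ∀ z, outer ((S.pad b * x).partner (Sum.map S.ι r z)) =
      Sum.map (Sum.map S.ι S.ι) (Sum.map S.ι r)
        (straighten (Sum.map b.partner h) (halfEquator n K) (halfOuter z)) := by
  set E : (Fin n ⊕ Fin n) ⊕ (Fin n ⊕ K) → (Fin N ⊕ Fin N) ⊕ (Fin N ⊕ Fin N) :=
    Sum.map (Sum.map S.ι S.ι) (Sum.map S.ι r) with hE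
  have hEi : Function.Injective E :=
    (S.injective.sumMap S.injective).sumMap (S.injective.sumMap hr)
  obtain ⟨h1, h2, -⟩ := straighten_embed hEi (halfEquator n K) (f := Sum.map b.partner h)
    (g := juxtapose (S.pad b) x) (by
      rintro (z | z)
      · simp only [hE, juxtapose, Sum.map_inl, S.pad_map]
      · simp only [hE, juxtapose, Sum.map_inr, hx])
  have heq : equator N = equatorAt S.s ++ (halfEquator n K).map fun p => (E p.1, E p.2) := by
    rw [equator, S.finRange_eq, List.map_append, equatorAt, halfEquator, List.map_map,
      List.map_map]
    rfl
  have hnd := equator_nodup N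
  have hsplit : ∀ l l' : List (((Fin N ⊕ Fin N) ⊕ (Fin N ⊕ Fin N)) × ((Fin N ⊕ Fin N) ⊕ (Fin N ⊕ Fin N))),
      ends (l ++ l') = ends l ++ ends l' := by
    simp [ends]
  rw [heq, hsplit, List.nodup_append] at hnd
  obtain ⟨h3, h4⟩ := straighten_append_of_fix (equatorAt S.s)
    ((halfEquator n K).map fun p => (E p.1, E p.2)) (juxtapose_invol (S.pad b) x) (by
      intro z hz
      obtain ⟨i, hi, rfl | rfl⟩ := (mem_ends_equatorAt _ _).1 hz
      · simp [juxtapose, S.pad_inr b hi]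
      · simp [juxtapose, hxs i hi]) hnd.1
  refine ⟨?_, fun z => ?_⟩
  · rw [loops, heq, h4, h2]
  · have hz : outer (Sum.map S.ι r z) = E (halfOuter z) := by
      rcases z with z | z <;> rfl
    refine (outer_composePartner _ _ _).trans ?_
    rw [heq, h3, hz, h1]

theorem mul_left_part (b x : Diagram n) (i j : Fin n)
    (h : b.partner (Sum.inl i) = Sum.inl j) : (b * x).partner (Sum.inl i) = Sum.inl j := by
  apply outer_injective
  have h' : juxtapose b x (outer (Sum.inl i)) = outer (Sum.inl j) :=
    congrArg Sum.inl h
  rw [← h']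
  refine (outer_composePartner b x _).trans (straighten_keep _ ?_ ?_)
  · exact fun hh => (mem_ends_equator _).1 hh _ rfl
  · rw [h']
    exact fun hh => (mem_ends_equator _).1 hh _ rfl

/-- The case in which the right factor is padded as well, with the right vertices placed by `ι`; the
smaller juxtaposition is then that of `b` and `b'`. -/
theorem Places.pad_mul (S : Places n N) (b b' : Diagram n) :
    S.pad b * S.pad b' = S.pad (b * b') ∧ loops (S.pad b) (S.pad b') = loops b b' := by
  obtain ⟨h1, h2⟩ := S.mul_glued S.injective b (S.pad b') (S.pad_map b') (fun i => S.pad_inl b')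
  refine ⟨S.eq_pad (fun z => outer_injective ?_)
    (fun i hi => mul_left_part _ _ _ _ (S.pad_inl b hi))
    (fun i hi => mul_right_part _ _ _ _ (S.pad_inr b' hi)), h1⟩
  rw [h2 z, halfOuter_eq_outer]
  have h3 : straighten (Sum.map b.partner b'.partner) (halfEquator n (Fin n)) (outer z) =
    outer ((b * b').partner z) := (outer_composePartner b b' z).symm
  rw [h3]
  generalize (b * b').partner z = w
  rcases w with w | w <;> rfl

end Product

/-! ### Half diagrams -/

/-- The possible left sides of diagrams with `k` propagating lines and no singletons on the left. -/
@[ext]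
structure HalfDiagram (n k : ℕ) where
  partner : Fin n ⊕ Fin k → Fin n ⊕ Fin k
  invol : Function.Involutive partner
  ne : ∀ z, partner z ≠ z
  right : ∀ j, ∃ i, partner (Sum.inr j) = Sum.inl i

namespace LeftCell

variable {n N k : ℕ}

/-- Some diagram in a left cell. -/
noncomputable def rep (L : LeftCell N) : Diagram N := L.exists_rep.choose

theorem mem_iff (L : LeftCell N) (d : Diagram N) : d ∈ L.carrier ↔ SameRightParts d L.rep := by
  conv_lhs => rw [L.exists_rep.choose_spec]
  rfl

theorem rep_mem (L : LeftCell N) : L.rep ∈ L.carrier := (L.mem_iff _).2 fun _ _ => Iff.rfl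

/-- The parts of the diagrams in a left cell contained in the right side. -/
noncomputable def rightPart (L : LeftCell N) (j : Fin N) : Fin N :=
  Sum.elim (fun _ => j) id (L.rep.partner (Sum.inr j))

theorem partner_inr_of_not_mem (L : LeftCell N) {d : Diagram N} (hd : d ∈ L.carrier) {j : Fin N}
    (hj : j ∉ L.rightEnds) : d.partner (Sum.inr j) = Sum.inr (L.rightPart j) := by
  obtain ⟨i, hi⟩ := (L.not_mem_rightEnds j).1 hj
  rw [hi d hd, rightPart, hi _ L.rep_mem]
  rfl

theorem rightPart_not_mem (L : LeftCell N) {j : Fin N} (hj : j ∉ L.rightEnds) :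
    L.rightPart j ∉ L.rightEnds ∧ L.rightPart (L.rightPart j) = j := by
  have h1 := L.partner_inr_of_not_mem L.rep_mem hj
  have h2 : L.rep.partner (Sum.inr (L.rightPart j)) = Sum.inr j := by
    rw [← h1, L.rep.partner_partner]
  have h3 : L.rightPart j ∉ L.rightEnds := by
    intro h
    obtain ⟨x, hx⟩ := (L.mem_rightEnds _).1 h _ L.rep_mem
    rw [h2] at hx
    exact Sum.inr_ne_inl hx
  exact ⟨h3, Sum.inr.inj ((L.partner_inr_of_not_mem L.rep_mem h3).symm.trans h2)⟩

/-- The right ends of the propagating lines, in their natural order. -/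
noncomputable def rightEnd (L : LeftCell N) (hk : L.propNumber = k) (j : Fin k) : Fin N :=
  (L.rightEnds.orderIsoOfFin hk j).1

theorem rightEnd_injective (L : LeftCell N) (hk : L.propNumber = k) :
    Function.Injective (L.rightEnd hk) :=
  Subtype.val_injective.comp (L.rightEnds.orderIsoOfFin hk).injective

theorem range_rightEnd (L : LeftCell N) (hk : L.propNumber = k) (j : Fin N) :
    j ∈ Set.range (L.rightEnd hk) ↔ j ∈ L.rightEnds := by
  constructor
  · rintro ⟨i, rfl⟩
    exact (L.rightEnds.orderIsoOfFin hk i).2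
  · intro hj
    obtain ⟨i, hi⟩ := (L.rightEnds.orderIsoOfFin hk).surjective ⟨j, hj⟩
    exact ⟨i, congrArg Subtype.val hi⟩

theorem rightEnd_mem (L : LeftCell N) (hk : L.propNumber = k) (j : Fin k) :
    L.rightEnd hk j ∈ L.rightEnds := (L.range_rightEnd hk _).1 ⟨j, rfl⟩

/-- The diagram in a left cell with a given left side, and additional singletons on the left. -/
noncomputable def ofHalf (L : LeftCell N) (hk : L.propNumber = k) (S : Places n N)
    (h : HalfDiagram n k) : Diagram N :=
  glue S.ι (L.rightEnd hk) L.rightPart h.partner S.injective (L.rightEnd_injective hk)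
    (fun j hj => by
      simp only [range_rightEnd] at hj ⊢
      exact L.rightPart_not_mem hj) h.invol

variable (L : LeftCell N) (hk : L.propNumber = k) (S : Places n N)

theorem ofHalf_map (h : HalfDiagram n k) (z : Fin n ⊕ Fin k) :
    (L.ofHalf hk S h).partner (Sum.map S.ι (L.rightEnd hk) z) =
      Sum.map S.ι (L.rightEnd hk) (h.partner z) := glue_map z

theorem ofHalf_inl (h : HalfDiagram n k) {i : Fin N} (hi : i ∈ S.s) :
    (L.ofHalf hk S h).partner (Sum.inl i) = Sum.inl i := glue_inl ((S.mem_iff i).1 hi)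

theorem ofHalf_inr (h : HalfDiagram n k) {j : Fin N} (hj : j ∉ L.rightEnds) :
    (L.ofHalf hk S h).partner (Sum.inr j) = Sum.inr (L.rightPart j) :=
  glue_inr (by rwa [range_rightEnd])

theorem eq_ofHalf {h : HalfDiagram n k} {x : Diagram N} (hx : x ∈ L.carrier)
    (h1 : ∀ z, x.partner (Sum.map S.ι (L.rightEnd hk) z) =
      Sum.map S.ι (L.rightEnd hk) (h.partner z))
    (h2 : ∀ i ∈ S.s, x.partner (Sum.inl i) = Sum.inl i) : x = L.ofHalf hk S h :=
  eq_glue h1 (fun i hi => h2 i ((S.mem_iff i).2 hi)) fun j hj =>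
    L.partner_inr_of_not_mem hx (by rwa [range_rightEnd] at hj)

theorem ofHalf_mem (h : HalfDiagram n k) : L.ofHalf hk S h ∈ L.carrier := by
  rw [mem_iff]
  intro i j
  by_cases hi : i ∈ L.rightEnds
  · obtain ⟨y, hy⟩ := (L.mem_rightEnds i).1 hi _ L.rep_mem
    obtain ⟨i, rfl⟩ := (L.range_rightEnd hk i).2 hi
    obtain ⟨w, hw⟩ := h.right i
    have := L.ofHalf_map hk S h (Sum.inr i)
    rw [hw, Sum.map_inr, Sum.map_inl] at this
    simp [this, hy]
  · rw [L.ofHalf_inr hk S h hi, L.partner_inr_of_not_mem L.rep_mem hi]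

theorem ofHalf_proper (h : HalfDiagram n k) : S.Proper (L.ofHalf hk S h) := by
  refine ⟨fun i hi => L.ofHalf_inl hk S h hi, fun i hi => h.ne (Sum.inl i) ?_⟩
  exact S.injective.sumMap (L.rightEnd_injective hk)
    ((L.ofHalf_map hk S h (Sum.inl i)).symm.trans hi)

theorem ofHalf_injective : Function.Injective (L.ofHalf hk S) := by
  intro h h' e
  refine HalfDiagram.ext (funext fun z => S.injective.sumMap (L.rightEnd_injective hk) ?_)
  rw [← ofHalf_map, ← ofHalf_map, e]

/-- A left vertex with a partner is at a chosen place, and a right vertex whose partner is on the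
left is a right end of the cell. So the partner map restricts to the chosen places and the right
ends, and the rest of the diagram is forced by properness and by the cell. -/
theorem exists_half {x : Diagram N} (hx : x ∈ L.carrier) (hp : S.Proper x) :
    ∃ h : HalfDiagram n k, L.ofHalf hk S h = x := by
  -- Contrapositive of properness: a left vertex that is not a singleton is in the image of `ι`.
  have hrange : ∀ i, (∃ w, x.partner (Sum.inl i) = w ∧ w ≠ Sum.inl i) → ∃ j, i = S.ι j := by
    rintro i ⟨w, hw, hwi⟩
    by_contra hi
    exact hwi (hw ▸ hp.1 i ((S.mem_iff i).2 fun ⟨j, hj⟩ => hi ⟨j, hj.symm⟩))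
  have hinr : ∀ j, ∃ i, x.partner (Sum.inr (L.rightEnd hk j)) = Sum.inl (S.ι i) := by
    intro j
    obtain ⟨i, hi⟩ := (L.mem_rightEnds _).1 (L.rightEnd_mem hk j) x hx
    obtain ⟨i', rfl⟩ := hrange i ⟨_, by rw [← hi, x.partner_partner], Sum.inr_ne_inl⟩
    exact ⟨i', hi⟩
  have hex : ∀ z, ∃ w, x.partner (Sum.map S.ι (L.rightEnd hk) z) =
      Sum.map S.ι (L.rightEnd hk) w := by
    rintro (i | j)
    · rcases hi : x.partner (Sum.inl (S.ι i)) with w | w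
      · have hw : x.partner (Sum.inl w) = Sum.inl (S.ι i) := by rw [← hi, x.partner_partner]
        obtain ⟨w', rfl⟩ := hrange w ⟨_, hw, fun h => hp.2 i (by rw [hi, h])⟩
        exact ⟨Sum.inl w', hi⟩
      · have hw : w ∈ L.rightEnds := by
          by_contra h
          have h' := L.partner_inr_of_not_mem hx h
          rw [← hi, x.partner_partner] at h'
          exact Sum.inl_ne_inr h'
        obtain ⟨w', rfl⟩ := (L.range_rightEnd hk w).2 hw
        exact ⟨Sum.inr w', hi⟩
    · obtain ⟨i, hi⟩ := hinr j
      exact ⟨Sum.inl i, hi⟩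
  have hE := S.injective.sumMap (L.rightEnd_injective hk)
  choose h hh using hex
  refine ⟨⟨h, fun z => hE ?_, fun z hz => ?_, fun j => ?_⟩, ?_⟩
  · rw [← hh, ← hh, x.partner_partner]
  · have h1 := hh z
    rw [hz] at h1
    rcases z with i | j
    · exact hp.2 i h1
    · obtain ⟨i, hi⟩ := hinr j
      exact Sum.inl_ne_inr (hi.symm.trans h1)
  · obtain ⟨i, hi⟩ := hinr j
    exact ⟨i, hE ((hh (Sum.inr j)).symm.trans hi)⟩
  · exact (L.eq_ofHalf hk S hx hh hp.1).symm

/-- The product of the Brauer diagram `b` and the half diagram `h` has no pairs on the right, and is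
the half diagram `h'`. -/
def _root_.PartialBrauer.HalfDiagram.Step (b : BrauerDiagram n) (h h' : HalfDiagram n k) : Prop :=
  ∀ z, straighten (Sum.map b.1.partner h.partner) (halfEquator n (Fin k)) (halfOuter z) =
    halfOuter (h'.partner z)

theorem loops_pad_ofHalf (b : BrauerDiagram n) (h : HalfDiagram n k) :
    loops (S.pad b.1) (L.ofHalf hk S h) =
      numLoops (Sum.map b.1.partner h.partner) (halfEquator n (Fin k)) :=
  (S.mul_glued (L.rightEnd_injective hk) b.1 _ (L.ofHalf_map hk S h)
    (fun _ hi => L.ofHalf_inl hk S h hi)).1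

/-- The relation `Step` mentions neither the cell nor the places, so one step computes the products
in all cells with the same propagating number simultaneously. -/
theorem pad_mul_ofHalf_of_step {b : BrauerDiagram n} {h h' : HalfDiagram n k}
    (hs : HalfDiagram.Step b h h') : S.pad b.1 * L.ofHalf hk S h = L.ofHalf hk S h' := by
  obtain ⟨-, h2⟩ := S.mul_glued (L.rightEnd_injective hk) b.1 _ (L.ofHalf_map hk S h)
    (fun _ hi => L.ofHalf_inl hk S h hi)
  have h3 : ∀ z, (S.pad b.1 * L.ofHalf hk S h).partner (Sum.map S.ι (L.rightEnd hk) z) =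
      Sum.map S.ι (L.rightEnd hk) (h'.partner z) := by
    intro z
    apply outer_injective
    rw [h2 z, hs z]
    generalize h'.partner z = w
    rcases w with w | w <;> rfl
  exact eq_glue h3
    (fun i hi => mul_left_part _ _ _ _ (S.pad_inl b.1 ((S.mem_iff i).2 hi)))
    fun j hj => mul_right_part _ _ _ _
      (L.ofHalf_inr hk S h (by rwa [range_rightEnd] at hj))

/-- Straightening an involution without fixed points gives no fixed points on the exterior, so the
product is proper; lying in the cell, it comes from a half diagram, which is the result of the step.
Together with `pad_mul_ofHalf_of_step` this shows that whether the product stays in the cell does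
not depend on the cell. -/
theorem exists_step {b : BrauerDiagram n} {h : HalfDiagram n k}
    (hm : S.pad b.1 * L.ofHalf hk S h ∈ L.carrier) : ∃ h', HalfDiagram.Step b h h' := by
  obtain ⟨-, h2⟩ := S.mul_glued (L.rightEnd_injective hk) b.1 _ (L.ofHalf_map hk S h)
    (fun _ hi => L.ofHalf_inl hk S h hi)
  have hinj : Function.Injective (Sum.map (Sum.map S.ι S.ι) (Sum.map S.ι (L.rightEnd hk))) :=
    (S.injective.sumMap S.injective).sumMap (S.injective.sumMap (L.rightEnd_injective hk))
  have hout : ∀ z, outer (Sum.map S.ι (L.rightEnd hk) z) =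
      Sum.map (Sum.map S.ι S.ι) (Sum.map S.ι (L.rightEnd hk)) (halfOuter z) := by
    rintro (z | z) <;> rfl
  obtain ⟨h', hh'⟩ := L.exists_half hk S hm
    ⟨fun i hi => mul_left_part _ _ _ _ (S.pad_inl b.1 hi), fun i hi => by
      have hfn : ∀ z, Sum.map b.1.partner h.partner z ≠ z := by
        rintro (z | z)
        · simpa using b.2 z
        · simpa using h.ne z
      refine (straighten_ne (halfEquator n (Fin k)) halfEquator_nodup
        (f := Sum.map b.1.partner h.partner) ?_ (fun z _ => hfn z) (hfn (halfOuter (Sum.inl i)))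
        (halfOuter_not_mem _)).1 (hinj ?_)
      · rintro (z | z)
        · simp [b.1.partner_partner]
        · simp [h.invol z]
      · rw [← h2 (Sum.inl i), ← hout]
        exact congrArg outer hi⟩
  refine ⟨h', fun z => hinj ?_⟩
  rw [← h2, ← hh', ofHalf_map, hout]

/-- The right action of permutations on half diagrams. -/
def _root_.PartialBrauer.HalfDiagram.act (h : HalfDiagram n k) (σ : Equiv.Perm (Fin k)) :
    HalfDiagram n k where
  partner z := Sum.map id σ.symm (h.partner (Sum.map id σ z))
  invol z := by
    have h1 : ∀ y : Fin n ⊕ Fin k, Sum.map id σ (Sum.map id σ.symm y) = y := by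
      rintro (y | y) <;> simp
    have h2 : ∀ y : Fin n ⊕ Fin k, Sum.map id σ.symm (Sum.map id σ y) = y := by
      rintro (y | y) <;> simp
    simp only [h1, h.invol _, h2]
  ne z hz := by
    refine h.ne (Sum.map id σ z) ?_
    conv_rhs => rw [← hz]
    generalize h.partner (Sum.map id σ z) = y
    rcases y with y | y <;> simp
  right j := by
    obtain ⟨i, hi⟩ := h.right (σ j)
    exact ⟨i, by simp [hi]⟩

/-- The extended permutation acts on the right ends, taken in their order, as `σ` does on `Fin k`;
the other right vertices and the left side are not moved. -/
theorem ofHalf_act (h : HalfDiagram n k) (σ : Equiv.Perm (Fin k)) :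
    (L.ofHalf hk S h).relabelRight (L.endPerm hk σ).symm = L.ofHalf hk S (h.act σ) := by
  have hend : ∀ j, L.endPerm hk σ (L.rightEnd hk j) = L.rightEnd hk (σ j) := by
    intro j
    exact Equiv.Perm.extendDomain_apply_image σ (L.rightEnds.orderIsoOfFin hk).toEquiv j
  have h1 : ∀ z, Sum.map id (L.endPerm hk σ) (Sum.map S.ι (L.rightEnd hk) z) =
      Sum.map S.ι (L.rightEnd hk) (Sum.map id σ z) := by
    rintro (z | z) <;> simp [hend]
  have h2 : ∀ z, Sum.map id (L.endPerm hk σ).symm (Sum.map S.ι (L.rightEnd hk) z) =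
      Sum.map S.ι (L.rightEnd hk) (Sum.map id σ.symm z) := by
    rintro (z | z)
    · rfl
    · simp only [Sum.map_inr, Sum.inr.injEq, Equiv.symm_apply_eq, hend, Equiv.apply_symm_apply]
  refine L.eq_ofHalf hk S (L.relabel_mem hk σ _ (L.ofHalf_mem hk S h)) (fun z => ?_)
    (fun i hi => ?_)
  · simp only [Diagram.relabelRight, Equiv.symm_symm, h1, ofHalf_map, h2, HalfDiagram.act]
  · simp [Diagram.relabelRight, L.ofHalf_inl hk S h hi]

theorem proper_relabelRight (x : Diagram N) (τ : Equiv.Perm (Fin N)) :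
    S.Proper (x.relabelRight τ) ↔ S.Proper x := by
  have key : ∀ i j, (x.relabelRight τ).partner (Sum.inl i) = Sum.inl j ↔
      x.partner (Sum.inl i) = Sum.inl j := by
    intro i j
    simp only [Diagram.relabelRight, Sum.map_inl, id]
    generalize x.partner (Sum.inl i) = y
    rcases y with y | y <;> simp
  simp only [Places.Proper, key, ne_eq]

end LeftCell

/-- Relabelling is an embedding of the juxtaposition in itself which fixes the equator, so
straightening commutes with it and counts the same loops and strings. -/
theorem mul_relabelRight {n : ℕ} (d x : Diagram n) (τ : Equiv.Perm (Fin n)) :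
    d * x.relabelRight τ = (d * x).relabelRight τ ∧ loops d (x.relabelRight τ) = loops d x ∧
    strings d (x.relabelRight τ) = strings d x := by
  set e : (Fin n ⊕ Fin n) ⊕ (Fin n ⊕ Fin n) → (Fin n ⊕ Fin n) ⊕ (Fin n ⊕ Fin n) :=
    Sum.map id (Sum.map id τ) with he
  have hei : Function.Injective e :=
    Function.injective_id.sumMap (Function.injective_id.sumMap τ.injective)
  have h0 : ∀ y : Fin n ⊕ Fin n, Sum.map id τ.symm (Sum.map id τ y) = y := by
    rintro (y | y) <;> simp
  have h0' : ∀ y : Fin n ⊕ Fin n, Sum.map id τ (Sum.map id τ.symm y) = y := by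
    rintro (y | y) <;> simp
  obtain ⟨h1, h2, h3⟩ := straighten_embed hei (equator n) (f := juxtapose d x)
    (g := juxtapose d (x.relabelRight τ)) (by
      rintro (z | z)
      · simp [he, juxtapose]
      · simp only [he, juxtapose, Sum.map_inr, Diagram.relabelRight, h0])
  have heq : (equator n).map (fun p => (e p.1, e p.2)) = equator n := by
    simp [equator, he]
  rw [heq] at h1 h2 h3
  have hout : ∀ z, e (outer z) = outer (Sum.map id τ z) := by
    rintro (z | z) <;> rfl
  refine ⟨Diagram.ext (funext fun z => outer_injective ?_), h2, h3⟩
  refine (outer_composePartner _ _ _).trans ?_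
  have h4 := h1 (outer (Sum.map id τ.symm z))
  have h5 : straighten (juxtapose d x) (equator n) (outer (Sum.map id τ.symm z)) =
    outer ((d * x).partner (Sum.map id τ.symm z)) := (outer_composePartner d x _).symm
  rw [hout, h0', h5, hout] at h4
  exact h4

/-! ### Parity, and existence of left cells with Brauer diagrams -/

/-- A set with an involution without fixed points has even cardinality; here the sum of ones modulo
2 cancels in pairs. -/
theorem HalfDiagram.even {n k : ℕ} (h : HalfDiagram n k) : Even (n + k) := by
  have h1 : ∑ _z : Fin n ⊕ Fin k, (1 : ZMod 2) = 0 :=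
    Finset.sum_involution (fun z _ => h.partner z) (fun _ _ => by decide) (fun z _ _ => h.ne z)
      (fun _ _ => Finset.mem_univ _) (fun z _ => h.invol z)
  rw [Finset.sum_const, Finset.card_univ, Fintype.card_sum, Fintype.card_fin, Fintype.card_fin,
    nsmul_eq_mul, mul_one, ZMod.natCast_eq_zero_iff] at h1
  exact even_iff_two_dvd.2 h1

/-- Exchange neighbours, from the place `k` on. -/
def neighbour {n : ℕ} (k : ℕ) (i : Fin n) : Fin n :=
  if h : i.1 + 1 < n ∧ (i.1 - k) % 2 = 0 then ⟨i.1 + 1, h.1⟩ else ⟨i.1 - 1, by omega⟩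

/-- The places from `k` on are paired as `(k, k + 1)`, `(k + 2, k + 3)`, and so on. Since `n - k` is
even, no place at an even distance from `k` is the last one, and the fallback `i - 1` is used at odd
distances only. -/
theorem neighbour_spec {n k : ℕ} (hnk : Even (n + k)) (i : Fin n) (hi : k ≤ i.1) :
    k ≤ (neighbour k i).1 ∧ neighbour k (neighbour k i) = i ∧ neighbour k i ≠ i := by
  obtain ⟨m, hm⟩ := hnk
  have := i.2
  by_cases h : i.1 + 1 < n ∧ (i.1 - k) % 2 = 0
  · have h1 : neighbour k i = ⟨i.1 + 1, h.1⟩ := dif_pos h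
    have h2 : neighbour k ⟨i.1 + 1, h.1⟩ = i := by
      rw [neighbour, dif_neg (by simp only; omega)]
      exact Fin.ext (by simp)
    refine ⟨by rw [h1]; simp only; omega, by rw [h1, h2], fun h3 => ?_⟩
    have := congrArg Fin.val (h1.symm.trans h3)
    simp at this
  · have h1 : neighbour k i = ⟨i.1 - 1, by omega⟩ := dif_neg h
    have h2 : neighbour k (⟨i.1 - 1, by omega⟩ : Fin n) = i := by
      rw [neighbour, dif_pos (by simp only; omega)]
      exact Fin.ext (by simp only; omega)
    refine ⟨by rw [h1]; simp only; omega, by rw [h1, h2], fun h3 => ?_⟩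
    have := congrArg Fin.val (h1.symm.trans h3)
    simp only at this
    omega

theorem exists_brauer_cell {n k : ℕ} (hk : k ≤ n) (hnk : Even (n + k)) :
    ∃ M : LeftCell n, M.propNumber = k ∧ M.brauer.Nonempty := by
  let d : Diagram n :=
    { partner := Sum.elim (fun i => if i.1 < k then Sum.inr i else Sum.inl (neighbour k i))
        (fun i => if i.1 < k then Sum.inl i else Sum.inr (neighbour k i))
      partner_partner := by
        rintro (i | i) <;> by_cases h : i.1 < k
        · simp [h]
        · obtain ⟨h1, h2, -⟩ := neighbour_spec hnk i (by omega)
          simp [h, h1, h2]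
        · simp [h]
        · obtain ⟨h1, h2, -⟩ := neighbour_spec hnk i (by omega)
          simp [h, h1, h2] }
  have hd : d ∈ brauerSubmonoid n := by
    rintro (i | i) hi <;> by_cases h : i.1 < k
    · simp [d, h] at hi
    · simp [d, h, (neighbour_spec hnk i (by omega)).2.2] at hi
    · simp [d, h] at hi
    · simp [d, h, (neighbour_spec hnk i (by omega)).2.2] at hi
  let M : LeftCell n := ⟨{d' | SameRightParts d' d}, d, rfl⟩
  have hm : d ∈ M.carrier := fun _ _ => Iff.rfl
  refine ⟨M, ?_, ⟨d, hd⟩, hm⟩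
  have : M.rightEnds = Finset.univ.filter fun i : Fin n => i.1 < k := by
    ext i
    rw [Finset.mem_filter]
    constructor
    · intro h
      obtain ⟨j, hj⟩ := (M.mem_rightEnds i).1 h d hm
      by_contra hi
      simp only [Finset.mem_univ, true_and] at hi
      simp [d, hi] at hj
    · rintro ⟨-, h⟩
      by_contra hi
      obtain ⟨j, hj⟩ := (M.not_mem_rightEnds i).1 hi
      have := hj d hm
      simp [d, h] at this
  rw [LeftCell.propNumber, this, Fin.card_filter_val_lt]
  omega

open TensorProduct

/-! ### The corner functor on modules with a presentation of `e M` -/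

section Corner

variable {R B : Type u} [Ring R] [Ring B] {e : R} (he : IsIdempotentElem e)
  (γ : he.Corner ≃+* B) (X : ModuleCat.{u} R)

/-- A homomorphism on `R e` is determined by its value at `e`, because `x = x e` on this left ideal.
This identifies `Hom_R(R e, X)` with `e X`. -/
theorem cornerHom_apply {R : Type u} [Ring R] {e : R} (he : IsIdempotentElem e)
    (X : ModuleCat.{u} R) (f : Submodule.span R {e} →ₗ[R] X) (x : Submodule.span R {e}) :
    f x = x.1 • f ⟨e, Submodule.mem_span_singleton_self e⟩ := by
  obtain ⟨r, hr⟩ := Submodule.mem_span_singleton.1 x.2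
  rw [← map_smul]
  congr 1
  refine Subtype.ext ?_
  change x.1 = x.1 * e
  rw [← hr, smul_eq_mul, mul_assoc, he.eq]

/-- Multiplication of an element of `M`, as a homomorphism on `R e`. -/
def smulHom (m : X) : CornerHom e X where
  toFun x := x.1 • m
  map_add' x y := add_smul x.1 y.1 m
  map_smul' r x := mul_smul r x.1 m

variable {Y : Type u} [AddCommGroup Y] [Module B Y] (A : Y →+ X)
  (hsemi : ∀ b y, A (b • y) = (γ.symm b).1 • A y)

/-- A map from a `B`-module to `M` gives a homomorphism to `Hom_R(R e, M)`. -/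
def cornerLift : Y →ₗ[B] (moritaFunctor he γ).obj X where
  toFun y := (smulHom X (A y) : CornerHom e X)
  map_add' y z := LinearMap.ext fun x => by
    change x.1 • A (y + z) = x.1 • A y + x.1 • A z
    rw [map_add, smul_add]
  map_smul' b y := LinearMap.ext fun x => by
    change x.1 • A (b • y) = (x.1 * (γ.symm b).1) • A y
    rw [hsemi, mul_smul]

theorem cornerLift_eq_zero (hfix : ∀ y, e • A y = A y) (y : Y) :
    cornerLift he γ X A hsemi y = 0 ↔ A y = 0 := by
  constructor
  · intro h
    have h1 : e • A y = 0 := LinearMap.congr_fun (f := (smulHom X (A y) : CornerHom e X))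
      (g := 0) h ⟨e, Submodule.mem_span_singleton_self e⟩
    rwa [hfix] at h1
  · intro h
    refine LinearMap.ext fun x => ?_
    change x.1 • A y = 0
    rw [h, smul_zero]

/-- The value of a homomorphism at `e` is fixed by `e`, hence lies in `e X`, which the image of `A`
contains. -/
theorem cornerLift_surjective (hrange : ∀ x : X, ∃ y, A y = e • x) :
    Function.Surjective (cornerLift he γ X A hsemi) := by
  intro f
  have hf := cornerHom_apply he X f
  obtain ⟨y, hy⟩ := hrange ((show Submodule.span R {e} →ₗ[R] X from f)
    ⟨e, Submodule.mem_span_singleton_self e⟩)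
  refine ⟨y, LinearMap.ext fun x => ?_⟩
  change x.1 • A y = (show Submodule.span R {e} →ₗ[R] X from f) x
  rw [hy, ← hf ⟨e, Submodule.mem_span_singleton_self e⟩]
  exact (hf x).symm

theorem moritaFunctor_isZero (h : ∀ x : X, e • x = 0) :
    Limits.IsZero ((moritaFunctor he γ).obj X) := by
  have : Subsingleton ((moritaFunctor he γ).obj X) := by
    refine subsingleton_of_forall_eq 0 fun f => LinearMap.ext fun x => ?_
    have hf := cornerHom_apply he X f
    change (show Submodule.span R {e} →ₗ[R] X from f) x = 0
    rw [hf x, hf ⟨e, Submodule.mem_span_singleton_self e⟩, h, smul_zero]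
  exact ModuleCat.isZero_of_subsingleton _

end Corner

/-! ### Cell modules -/

section Cells

variable {𝕜 : Type u} [CommRing 𝕜] {M₁ M₂ : Type} [Monoid M₁] [Monoid M₂]
  {t₁ : TwoCocycle M₁ 𝕜} {t₂ : TwoCocycle M₂ 𝕜} {L₁ : Set M₁} {L₂ : Set M₂}

theorem CellModule.linearMap_ext {L : Set M₁} {Q : Type*} [AddCommGroup Q] [Module 𝕜 Q]
    {p q : CellModule t₁ L →ₗ[𝕜] Q}
    (h : ∀ x, p (CellModule.single t₁ x 1) = q (CellModule.single t₁ x 1)) : p = q := by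
  refine LinearMap.ext fun y => ?_
  induction y using CellModule.induction with
  | h0 => rw [map_zero, map_zero]
  | hadd x y hx hy => rw [map_add, map_add, hx, hy]
  | hs d r =>
    have : CellModule.single t₁ d r = r • CellModule.single t₁ d 1 := by
      rw [CellModule.smul_single, mul_one]
    rw [this, map_smul, map_smul, h]

open Classical in
variable (t₁ t₂) in
/-- The linear map which sends the basis element `ψ(y)` to `y`, and those not in the image of
`ψ` to `0`. -/
noncomputable def cellOnto (ψ : L₂ → L₁) : CellModule t₁ L₁ →ₗ[𝕜] CellModule t₂ L₂ :=
  (Finsupp.linearCombination 𝕜 fun x : L₁ =>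
    if h : ∃ y, ψ y = x then CellModule.single t₂ h.choose 1 else 0 :
    (L₁ →₀ 𝕜) →ₗ[𝕜] CellModule t₂ L₂)

theorem cellOnto_single {ψ : L₂ → L₁} (hψ : Function.Injective ψ) (y : L₂) :
    cellOnto t₁ t₂ ψ (CellModule.single t₁ (ψ y) 1) = CellModule.single t₂ y 1 := by
  refine (Finsupp.linearCombination_single 𝕜 1 (ψ y)).trans ?_
  have h : ∃ z, ψ z = ψ y := ⟨y, rfl⟩
  rw [dif_pos h, one_smul, hψ h.choose_spec]

theorem cellOnto_single_of_not_mem {ψ : L₂ → L₁} {x : L₁} (hx : x ∉ Set.range ψ) :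
    cellOnto t₁ t₂ ψ (CellModule.single t₁ x 1) = 0 := by
  refine (Finsupp.linearCombination_single 𝕜 1 x).trans ?_
  have hx' : ¬ ∃ y, ψ y = x := hx
  rw [dif_neg hx', smul_zero]

variable [IsCell L₁]

variable (t₁ t₂) in
/-- The linear map which sends a basis element `y` to `e ψ(y)`. -/
noncomputable def cellInto (e : TwistedAlgebra t₁) (ψ : L₂ → L₁) :
    CellModule t₂ L₂ →ₗ[𝕜] CellModule t₁ L₁ :=
  (Finsupp.linearCombination 𝕜 fun y : L₂ => e • CellModule.single t₁ (ψ y) 1 :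
    (L₂ →₀ 𝕜) →ₗ[𝕜] CellModule t₁ L₁)

theorem cellInto_single (e : TwistedAlgebra t₁) (ψ : L₂ → L₁) (y : L₂) :
    cellInto t₁ t₂ e ψ (CellModule.single t₂ y 1) = e • CellModule.single t₁ (ψ y) 1 :=
  (Finsupp.linearCombination_single 𝕜 1 y).trans (one_smul _ _)

variable [IsCell L₂]

/-- Conditions under which the corner functor sends the cell module of `L₁` to that of `L₂`. -/
structure CellTransfer {e : TwistedAlgebra t₁} (he : IsIdempotentElem e)
    (γ : he.Corner ≃+* TwistedAlgebra t₂) (ψ : L₂ → L₁) : Prop where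
  injective : Function.Injective ψ
  onto_into : ∀ y, cellOnto t₁ t₂ ψ (e • CellModule.single t₁ (ψ y) 1) = CellModule.single t₂ y 1
  range : ∀ x : L₁, e • CellModule.single t₁ x 1 = 0 ∨
    ∃ (r : 𝕜) (y : L₂), e • CellModule.single t₁ x 1 = r • e • CellModule.single t₁ (ψ y) 1
  smul : ∀ (r : 𝕜) (b : TwistedAlgebra t₂), (γ.symm (r • b)).1 = r • (γ.symm b).1
  semi : ∀ (b : M₂) (y : L₂), (γ.symm (TwistedAlgebra.single t₂ b 1)).1 •
    e • CellModule.single t₁ (ψ y) 1 = cellInto t₁ t₂ e ψ (CellModule.basisAct t₂ b y)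

namespace CellTransfer

variable {e : TwistedAlgebra t₁} {he : IsIdempotentElem e}
    {γ : he.Corner ≃+* TwistedAlgebra t₂} {ψ : L₂ → L₁} (T : CellTransfer he γ ψ)
include T

omit [IsCell L₂] in
theorem onto_comp_into : cellOnto t₁ t₂ ψ ∘ₗ cellInto t₁ t₂ e ψ = LinearMap.id :=
  CellModule.linearMap_ext fun y => by
    rw [LinearMap.comp_apply, cellInto_single, T.onto_into, LinearMap.id_apply]

theorem into_smul (b : TwistedAlgebra t₂) (y : CellModule t₂ L₂) :
    cellInto t₁ t₂ e ψ (b • y) = (γ.symm b).1 • cellInto t₁ t₂ e ψ y := by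
  induction b using TwistedAlgebra.induction with
  | h0 =>
    rw [zero_smul, map_zero, map_zero]
    exact (zero_smul _ _).symm
  | hadd a b ha hb =>
    rw [add_smul, map_add, ha, hb, map_add]
    exact (add_smul _ _ _).symm
  | hs b r =>
    induction y using CellModule.induction with
    | h0 => simp only [smul_zero, map_zero]
    | hadd y z hy hz => simp only [smul_add, map_add, hy, hz]
    | hs y q =>
      have h1 : TwistedAlgebra.single t₂ b r = r • TwistedAlgebra.single t₂ b 1 := by
        rw [TwistedAlgebra.smul_single, mul_one]
      have h2 : CellModule.single t₂ y q = q • CellModule.single t₂ y 1 := by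
        rw [CellModule.smul_single, mul_one]
      have h3 : TwistedAlgebra.single t₂ b 1 • CellModule.single t₂ y (1 : 𝕜) =
          CellModule.basisAct t₂ b y := by
        rw [CellModule.smul_def, CellModule.actLin_single, one_mul, one_smul]
      have h4 := T.smul r (TwistedAlgebra.single t₂ b 1)
      have h5 := T.semi b y
      rw [← h1] at h4
      rw [h4, h2, LinearMap.map_smul, cellInto_single]
      generalize (γ.symm (TwistedAlgebra.single t₂ b 1)).1 = a at h5
      rw [smul_assoc, ← smul_comm q a, h5, h1, smul_assoc, ← smul_comm q, h3, LinearMap.map_smul,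
        LinearMap.map_smul]

theorem idem_smul_into (y : CellModule t₂ L₂) :
    e • cellInto t₁ t₂ e ψ y = cellInto t₁ t₂ e ψ y := by
  have h := T.into_smul 1 y
  -- The unit of the corner ring is `e`.
  rw [one_smul, map_one] at h
  exact h.symm

omit [IsCell L₂] in
theorem exists_into (x : CellModule t₁ L₁) : ∃ y, cellInto t₁ t₂ e ψ y = e • x := by
  induction x using CellModule.induction with
  | h0 => exact ⟨0, by rw [map_zero, smul_zero]⟩
  | hadd x z hx hz =>
    obtain ⟨y, hy⟩ := hx
    obtain ⟨w, hw⟩ := hz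
    exact ⟨y + w, by rw [map_add, hy, hw, smul_add]⟩
  | hs x q =>
    have h2 : CellModule.single t₁ x q = q • CellModule.single t₁ x 1 := by
      rw [CellModule.smul_single, mul_one]
    rcases T.range x with h | ⟨r, y, h⟩
    · exact ⟨0, by rw [h2, ← smul_comm q e, h, map_zero, smul_zero]⟩
    · exact ⟨q • r • CellModule.single t₂ y 1, by
        rw [h2, ← smul_comm q e, h, map_smul, map_smul, cellInto_single]⟩

/-- `cellInto` has the retraction `cellOnto`, hence is injective, and its image is `e C`; so it
induces a bijection to `Hom_R(R e, C)`. -/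
theorem cell_iso : Nonempty ((moritaFunctor he γ).obj (ModuleCat.of _ (CellModule t₁ L₁)) ≅
    ModuleCat.of _ (CellModule t₂ L₂)) := by
  let F := cornerLift he γ (ModuleCat.of _ (CellModule t₁ L₁))
    (cellInto t₁ t₂ e ψ).toAddMonoidHom T.into_smul
  have hF : Function.Bijective F := by
    refine ⟨(injective_iff_map_eq_zero F).2 fun y hy => ?_,
      cornerLift_surjective he γ _ _ _ T.exists_into⟩
    have h1 : cellInto t₁ t₂ e ψ y = 0 := (cornerLift_eq_zero he γ _ _ _ T.idem_smul_into y).1 hy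
    have h2 := LinearMap.congr_fun T.onto_comp_into y
    rw [LinearMap.comp_apply, h1, map_zero] at h2
    exact h2.symm
  exact ⟨(LinearEquiv.toModuleIso (LinearEquiv.ofBijective F hF)).symm⟩

section Tensor

variable {G : Type} {W : Type u} [Group G] [AddCommGroup W] [Module 𝕜 W]
  (act₁ : L₁ → G → L₁) (act₂ : L₂ → G → L₂) (ρ : Representation 𝕜 G W)

theorem rTensor_into_smul (b : TwistedAlgebra t₂) (z : CellModule t₂ L₂ ⊗[𝕜] W) :
    (cellInto t₁ t₂ e ψ).rTensor W (b • z) =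
      (γ.symm b).1 • (cellInto t₁ t₂ e ψ).rTensor W z := by
  induction z using TensorProduct.induction_on with
  | zero => simp only [smul_zero, map_zero]
  | add y z hy hz => simp only [smul_add, map_add, hy, hz]
  | tmul y v =>
    rw [smul_tmul', LinearMap.rTensor_tmul, LinearMap.rTensor_tmul, T.into_smul, smul_tmul']

theorem balancing_into (hact : ∀ y σ, ψ (act₂ y σ) = act₁ (ψ y) σ) {z : CellModule t₂ L₂ ⊗[𝕜] W}
    (hz : z ∈ balancing t₂ L₂ act₂ ρ) :
    (cellInto t₁ t₂ e ψ).rTensor W z ∈ balancing t₁ L₁ act₁ ρ := by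
  refine Submodule.span_induction ?_ ?_ ?_ ?_ hz
  · rintro _ ⟨y, σ, v, rfl⟩
    rw [map_sub, LinearMap.rTensor_tmul, LinearMap.rTensor_tmul, cellInto_single, cellInto_single,
      hact, ← smul_tmul', ← smul_tmul', ← smul_sub]
    exact Submodule.smul_mem _ _ (Submodule.subset_span ⟨ψ y, σ, v, rfl⟩)
  · rw [map_zero]
    exact Submodule.zero_mem _
  · intro x y _ _ hx hy
    rw [map_add]
    exact Submodule.add_mem _ hx hy
  · intro b x _ hx
    rw [T.rTensor_into_smul]
    exact Submodule.smul_mem _ _ hx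

end Tensor

end CellTransfer

/-- A right action on the basis of a cell module commutes with the left action. -/
structure ActCompatible {M G : Type*} [Monoid M] (t : TwoCocycle M 𝕜) (L : Set M)
    (act : L → G → L) : Prop where
  mem : ∀ a x σ, a * (act x σ).1 ∈ L ↔ a * x.1 ∈ L
  mul : ∀ a x σ (h : a * x.1 ∈ L), a * (act x σ).1 = (act ⟨a * x.1, h⟩ σ).1
  twist : ∀ a x σ, t.toFun a (act x σ).1 = t.toFun a x.1

/-- The projection commutes with the right actions: the image of `ψ` is stable, and so is its
complement, by `hrange`. A generator thus goes to a generator or to zero. The projection is not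
linear over the algebra, and the algebra span has to be dealt with separately. -/
theorem balancing_onto {G W : Type*} [Group G] [AddCommGroup W] [Module 𝕜 W]
    {act₁ : L₁ → G → L₁} {act₂ : L₂ → G → L₂} (ρ : Representation 𝕜 G W)
    {ψ : L₂ → L₁} (hψ : Function.Injective ψ) (hact : ∀ y σ, ψ (act₂ y σ) = act₁ (ψ y) σ)
    (hrange : ∀ x σ, act₁ x σ ∈ Set.range ψ → x ∈ Set.range ψ)
    (hcomp : ActCompatible t₁ L₁ act₁) {z : CellModule t₁ L₁ ⊗[𝕜] W}
    (hz : z ∈ balancing t₁ L₁ act₁ ρ) :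
    (cellOnto t₁ t₂ ψ).rTensor W z ∈ balancing t₂ L₂ act₂ ρ := by
  have hgen : ∀ (x : L₁) (σ : G) (v : W), (cellOnto t₁ t₂ ψ).rTensor W
      (CellModule.single t₁ (act₁ x σ) 1 ⊗ₜ v - CellModule.single t₁ x 1 ⊗ₜ ρ σ v) ∈
        balancing t₂ L₂ act₂ ρ := by
    intro x σ v
    rw [map_sub, LinearMap.rTensor_tmul, LinearMap.rTensor_tmul]
    by_cases hx : x ∈ Set.range ψ
    · obtain ⟨y, rfl⟩ := hx
      rw [← hact, cellOnto_single hψ, cellOnto_single hψ]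
      exact Submodule.subset_span ⟨y, σ, v, rfl⟩
    · rw [cellOnto_single_of_not_mem hx, cellOnto_single_of_not_mem fun h => hx (hrange x σ h),
        zero_tmul, zero_tmul, sub_zero]
      exact Submodule.zero_mem _
  -- Strengthened to all multiples of `z`, so that the induction over the span passes through scalar
  -- multiplication. A multiple of a generator by a basis element is a scalar times a generator, or
  -- zero, since the right action commutes with the left one.
  suffices h : ∀ a : TwistedAlgebra t₁,
      (cellOnto t₁ t₂ ψ).rTensor W (a • z) ∈ balancing t₂ L₂ act₂ ρ by
    have := h 1
    rwa [one_smul] at this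
  refine Submodule.span_induction ?_ ?_ ?_ ?_ hz
  · rintro _ ⟨x, σ, v, rfl⟩ a
    induction a using TwistedAlgebra.induction with
    | h0 =>
      rw [zero_smul, map_zero]
      exact Submodule.zero_mem _
    | hadd a b ha hb =>
      rw [add_smul, map_add]
      exact Submodule.add_mem _ ha hb
    | hs a r =>
      rw [smul_sub, smul_tmul', smul_tmul', CellModule.smul_def, CellModule.smul_def,
        CellModule.actLin_single, CellModule.actLin_single, mul_one, ← smul_tmul', ← smul_tmul',
        ← smul_sub, map_smul]
      refine Submodule.smul_of_tower_mem _ r ?_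
      by_cases h : a * x.1 ∈ L₁
      · have h' := (hcomp.mem a x σ).2 h
        have h1 : (⟨a * (act₁ x σ).1, h'⟩ : L₁) = act₁ ⟨a * x.1, h⟩ σ :=
          Subtype.ext (hcomp.mul a x σ h)
        have h2 : ∀ y : L₁, CellModule.single t₁ y (t₁.toFun a x.1) =
            t₁.toFun a x.1 • CellModule.single t₁ y 1 := by
          intro y
          rw [CellModule.smul_single, mul_one]
        rw [CellModule.basisAct, dif_pos h', CellModule.basisAct, dif_pos h, h1, hcomp.twist, h2,
          h2, ← smul_tmul', ← smul_tmul', ← smul_sub, map_smul]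
        exact Submodule.smul_of_tower_mem _ _ (hgen _ σ v)
      · rw [CellModule.basisAct, dif_neg (fun h' => h ((hcomp.mem a x σ).1 h')),
          CellModule.basisAct, dif_neg h, zero_tmul, zero_tmul, sub_zero, map_zero]
        exact Submodule.zero_mem _
  · intro a
    rw [smul_zero, map_zero]
    exact Submodule.zero_mem _
  · intro x y _ _ hx hy a
    rw [smul_add, map_add]
    exact Submodule.add_mem _ (hx a) (hy a)
  · intro b x _ hx a
    rw [smul_smul]
    exact hx _

/-- Tensoring `cellInto` with `W` and dividing by the relations gives a map onto `e` times the
tensor product. Only its kernel is in question. -/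
theorem CellTransfer.tensor_iso {e : TwistedAlgebra t₁} {he : IsIdempotentElem e}
    {γ : he.Corner ≃+* TwistedAlgebra t₂} {ψ : L₂ → L₁} (T : CellTransfer he γ ψ)
    {G : Type} {W : Type u} [Group G] [AddCommGroup W] [Module 𝕜 W]
    {act₁ : L₁ → G → L₁} {act₂ : L₂ → G → L₂} (ρ : Representation 𝕜 G W)
    (hact : ∀ y σ, ψ (act₂ y σ) = act₁ (ψ y) σ)
    (hrange : ∀ x σ, act₁ x σ ∈ Set.range ψ → x ∈ Set.range ψ)
    (hcomp : ActCompatible t₁ L₁ act₁) :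
    Nonempty ((moritaFunctor he γ).obj (ModuleCat.of _ (CellTensor t₁ L₁ act₁ ρ)) ≅
      ModuleCat.of _ (CellTensor t₂ L₂ act₂ ρ)) := by
  let A₀ : CellModule t₂ L₂ ⊗[𝕜] W →ₗ[𝕜] CellModule t₁ L₁ ⊗[𝕜] W :=
    (cellInto t₁ t₂ e ψ).rTensor W
  let A : CellModule t₂ L₂ ⊗[𝕜] W →+ CellTensor t₁ L₁ act₁ ρ :=
    (balancing t₁ L₁ act₁ ρ).mkQ.toAddMonoidHom.comp A₀.toAddMonoidHom
  have hA : ∀ z, A z = Submodule.Quotient.mk (A₀ z) := fun _ => rfl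
  have hsmul : ∀ (b : TwistedAlgebra t₂) z, A₀ (b • z) = (γ.symm b).1 • A₀ z :=
    T.rTensor_into_smul
  have hsemi : ∀ (b : TwistedAlgebra t₂) z, A (b • z) = (γ.symm b).1 • A z := by
    intro b z
    rw [hA, hA, hsmul, Submodule.Quotient.mk_smul]
  have hfix : ∀ z, e • A z = A z := by
    intro z
    have h := hsemi 1 z
    rw [one_smul, map_one] at h
    exact h.symm
  have hex : ∀ x, ∃ z, A z = e • x := by
    intro x
    obtain ⟨x, rfl⟩ := Submodule.Quotient.mk_surjective _ x
    rw [← Submodule.Quotient.mk_smul]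
    suffices h : ∃ z, A₀ z = e • x by
      obtain ⟨z, hz⟩ := h
      exact ⟨z, by rw [hA, hz]⟩
    induction x using TensorProduct.induction_on with
    | zero => exact ⟨0, by rw [map_zero, smul_zero]⟩
    | add x w hx hw =>
      obtain ⟨y, hy⟩ := hx
      obtain ⟨z, hz⟩ := hw
      exact ⟨y + z, by rw [map_add, hy, hz, smul_add]⟩
    | tmul x v =>
      obtain ⟨y, hy⟩ := T.exists_into x
      exact ⟨y ⊗ₜ v, by rw [smul_tmul', ← hy, LinearMap.rTensor_tmul]⟩
  let F := cornerLift he γ (ModuleCat.of _ (CellTensor t₁ L₁ act₁ ρ)) A hsemi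
  -- If the image of `z` is a relation, applying the retraction gives a relation again, and this is
  -- `z`.
  have hker : balancing t₂ L₂ act₂ ρ = LinearMap.ker F := by
    ext z
    rw [LinearMap.mem_ker, cornerLift_eq_zero he γ _ _ _ hfix, hA, Submodule.Quotient.mk_eq_zero]
    refine ⟨T.balancing_into act₁ act₂ ρ hact, fun h => ?_⟩
    have h1 := balancing_onto (t₂ := t₂) ρ T.injective hact hrange hcomp h
    have h2 : (cellOnto t₁ t₂ ψ).rTensor W (A₀ z) = z := by
      change ((cellOnto t₁ t₂ ψ).rTensor W ∘ₗ (cellInto t₁ t₂ e ψ).rTensor W) z = z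
      rw [← LinearMap.rTensor_comp, T.onto_comp_into, LinearMap.rTensor_id, LinearMap.id_apply]
    rwa [h2] at h1
  exact ⟨(LinearEquiv.toModuleIso ((Submodule.quotEquivOfEq _ _ hker).trans
    (F.quotKerEquivOfSurjective (cornerLift_surjective he γ _ _ _ hex)))).symm⟩

theorem smul_cellModule_eq_zero {e : TwistedAlgebra t₁}
    (h : ∀ x : L₁, e • CellModule.single t₁ x 1 = 0) (x : CellModule t₁ L₁) : e • x = 0 := by
  induction x using CellModule.induction with
  | h0 => rw [smul_zero]
  | hadd x y hx hy => rw [smul_add, hx, hy, add_zero]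
  | hs x q =>
    have h2 : CellModule.single t₁ x q = q • CellModule.single t₁ x 1 := by
      rw [CellModule.smul_single, mul_one]
    rw [h2, ← smul_comm q e, h, smul_zero]

theorem smul_cellTensor_eq_zero {e : TwistedAlgebra t₁}
    (h : ∀ x : L₁, e • CellModule.single t₁ x 1 = 0) {G W : Type*} [Group G] [AddCommGroup W]
    [Module 𝕜 W] (act₁ : L₁ → G → L₁) (ρ : Representation 𝕜 G W)
    (x : CellTensor t₁ L₁ act₁ ρ) : e • x = 0 := by
  obtain ⟨x, rfl⟩ := Submodule.Quotient.mk_surjective _ x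
  rw [← Submodule.Quotient.mk_smul, Submodule.Quotient.mk_eq_zero]
  convert Submodule.zero_mem _
  induction x using TensorProduct.induction_on with
  | zero => rw [smul_zero]
  | add x w hx hw => rw [smul_add, hx, hw, add_zero]
  | tmul x v => rw [smul_tmul', smul_cellModule_eq_zero h, zero_tmul]

end Cells

/-! ### The idempotents `δ'⁻¹ u_i` and their products -/

section CutList

variable {𝕜 : Type*} [CommRing 𝕜] {n : ℕ} (δ : 𝕜) (δ' : 𝕜ˣ)

/-- The product of the idempotents `δ'⁻¹ u_i`, for `i` in a list. -/
noncomputable def cutList (m : List (Fin n)) : PartialBrauerAlgebra n δ (δ' : 𝕜) :=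
  (m.map fun i => ((δ'⁻¹ : 𝕜ˣ) : 𝕜) • basis δ (δ' : 𝕜) (cutDiagram i)).prod

theorem cutList_cons (i : Fin n) (m : List (Fin n)) : cutList δ δ' (i :: m) =
    (((δ'⁻¹ : 𝕜ˣ) : 𝕜) • basis δ (δ' : 𝕜) (cutDiagram i)) * cutList δ δ' m := by
  simp [cutList]

theorem cutList_mul {m : List (Fin n)} {d : Diagram n}
    (h : ∀ i ∈ m, d.partner (Sum.inl i) = Sum.inl i) :
    cutList δ δ' m * basis δ (δ' : 𝕜) d = basis δ (δ' : 𝕜) d := by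
  induction m with
  | nil => simp [cutList]
  | cons i m ih =>
    rw [cutList_cons, mul_assoc, ih fun j hj => h j (List.mem_cons_of_mem _ hj), smul_mul_assoc,
      basis_cutDiagram_mul_of_fix _ _ (h i List.mem_cons_self), smul_smul, Units.inv_mul, one_smul]

theorem mul_cutList {m : List (Fin n)} {d : Diagram n}
    (h : ∀ i ∈ m, d.partner (Sum.inr i) = Sum.inr i) :
    basis δ (δ' : 𝕜) d * cutList δ δ' m = basis δ (δ' : 𝕜) d := by
  induction m with
  | nil => simp [cutList]
  | cons i m ih =>
    rw [cutList_cons, ← mul_assoc, mul_smul_comm,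
      basis_mul_cutDiagram_of_fix _ _ (h i List.mem_cons_self), smul_smul, Units.inv_mul, one_smul,
      ih fun j hj => h j (List.mem_cons_of_mem _ hj)]

theorem exists_cutList_mul (m : List (Fin n)) (d : Diagram n) : ∃ (r : 𝕜) (d' : Diagram n),
    cutList δ δ' m * basis δ (δ' : 𝕜) d = r • basis δ (δ' : 𝕜) d' ∧
    ∀ i ∈ m, d'.partner (Sum.inl i) = Sum.inl i := by
  induction m with
  | nil => exact ⟨1, d, by simp [cutList], by simp⟩
  | cons i m ih =>
    obtain ⟨r, d', h1, h2⟩ := ih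
    refine ⟨_, d'.cut (Sum.inl i), by
      rw [cutList_cons, mul_assoc, h1, smul_mul_assoc, mul_smul_comm, basis_cutDiagram_mul,
        smul_smul, smul_smul], fun j hj => ?_⟩
    rcases List.mem_cons.1 hj with rfl | hj
    · exact Diagram.cut_partner_self _ _
    · exact Diagram.cut_partner_of_fix (h2 j hj)

/-- The last clause is needed when both sides are cut: cuts on the right create singletons only, and
do not undo those made on the left. -/
theorem exists_mul_cutList (m : List (Fin n)) (d : Diagram n) : ∃ (r : 𝕜) (d' : Diagram n),
    basis δ (δ' : 𝕜) d * cutList δ δ' m = r • basis δ (δ' : 𝕜) d' ∧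
    (∀ i ∈ m, d'.partner (Sum.inr i) = Sum.inr i) ∧
    ∀ z, d.partner z = z → d'.partner z = z := by
  induction m generalizing d with
  | nil => exact ⟨1, d, by simp [cutList], by simp, fun _ h => h⟩
  | cons i m ih =>
    obtain ⟨r, d', h1, h2, h3⟩ := ih (d.cut (Sum.inr i))
    refine ⟨_, d', by
      rw [cutList_cons, ← mul_assoc, mul_smul_comm, basis_mul_cutDiagram, smul_mul_assoc,
        smul_mul_assoc, h1, smul_smul, smul_smul], fun j hj => ?_,
      fun z hz => h3 z (Diagram.cut_partner_of_fix hz)⟩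
    rcases List.mem_cons.1 hj with rfl | hj
    · exact h3 _ (Diagram.cut_partner_self _ _)
    · exact h2 j hj

theorem cutList_idem (m : List (Fin n)) : cutList δ δ' m * cutList δ δ' m = cutList δ δ' m := by
  -- Applied to the identity diagram, this shows that the product is itself a multiple of a diagram
  -- with singletons at all places of `m`, which it therefore fixes.
  obtain ⟨r, d', h1, h2⟩ := exists_cutList_mul δ δ' m (1 : Diagram n)
  have h3 : basis δ (δ' : 𝕜) (1 : Diagram n) = 1 := rfl
  rw [h3, mul_one] at h1
  conv_lhs => enter [2]; rw [h1]
  rw [mul_smul_comm, cutList_mul δ δ' h2, h1]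

theorem cutList_commute (m m' : List (Fin n)) : Commute (cutList δ δ' m) (uHatList δ δ' m') := by
  refine Commute.list_prod_left _ _ fun y hy => ?_
  obtain ⟨j, -, rfl⟩ := List.mem_map.1 hy
  exact (cutDiagram_commute_list δ δ' j m').smul_left _

end CutList

/-! ### Cell modules as images of the algebra -/

section CellProjection

variable {M 𝕜 : Type*} [Monoid M] [CommRing 𝕜] (t : TwoCocycle M 𝕜) (L : Set M)

open Classical in
/-- The projection of the algebra to a cell module. -/
noncomputable def cellProj : TwistedAlgebra t →ₗ[𝕜] CellModule t L :=
  (Finsupp.linearCombination 𝕜 fun d : M =>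
    if h : d ∈ L then CellModule.single t (⟨d, h⟩ : L) 1 else 0 : (M →₀ 𝕜) →ₗ[𝕜] CellModule t L)

theorem cellProj_single (x : L) (r : 𝕜) :
    cellProj t L (TwistedAlgebra.single t x.1 r) = CellModule.single t x r := by
  refine (Finsupp.linearCombination_single 𝕜 r x.1).trans ?_
  rw [dif_pos x.2, CellModule.smul_single, mul_one]

theorem cellProj_single_of_not_mem {x : M} (hx : x ∉ L) (r : 𝕜) :
    cellProj t L (TwistedAlgebra.single t x r) = 0 := by
  refine (Finsupp.linearCombination_single 𝕜 r x).trans ?_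
  rw [dif_neg hx, smul_zero]

/-- Transfers identities in the algebra, such as products with hats, to the cell module, where
diagrams that leave the cell are dropped. -/
theorem smul_single_eq_cellProj [IsCell L] (a : TwistedAlgebra t) (x : L) :
    a • CellModule.single t x 1 = cellProj t L (a * TwistedAlgebra.single t x.1 1) := by
  induction a using TwistedAlgebra.induction with
  | h0 => rw [zero_smul, zero_mul, map_zero]
  | hadd a b ha hb => rw [add_smul, add_mul, map_add, ha, hb]
  | hs a r =>
    rw [CellModule.smul_def, CellModule.actLin_single, TwistedAlgebra.single_mul_single,
      CellModule.basisAct]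
    by_cases h : a * x.1 ∈ L
    · rw [dif_pos h, cellProj_single t L ⟨a * x.1, h⟩, CellModule.smul_single]
    · rw [dif_neg h, cellProj_single_of_not_mem t L h, smul_zero]

end CellProjection

/-! ### The corner ring of a choice of places is the Brauer algebra of parameter `δ - 1` -/

namespace Places

variable {n N : ℕ} (S : Places n N)

theorem exists_pad {d : Diagram N} (h1 : ∀ i ∈ S.s, d.partner (Sum.inl i) = Sum.inl i)
    (h2 : ∀ i ∈ S.s, d.partner (Sum.inr i) = Sum.inr i)
    (h3 : ∀ i, d.partner (Sum.inl (S.ι i)) ≠ Sum.inl (S.ι i))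
    (h4 : ∀ i, d.partner (Sum.inr (S.ι i)) ≠ Sum.inr (S.ι i)) :
    ∃ b : BrauerDiagram n, S.pad b.1 = d := by
  have hE := S.injective.sumMap S.injective
  have hne : ∀ z, d.partner (Sum.map S.ι S.ι z) ≠ Sum.map S.ι S.ι z := by
    rintro (z | z)
    exacts [h3 z, h4 z]
  have hex : ∀ z, ∃ w, d.partner (Sum.map S.ι S.ι z) = Sum.map S.ι S.ι w := by
    intro z
    rcases h : d.partner (Sum.map S.ι S.ι z) with w | w
    · by_cases hw : w ∈ Set.range S.ι
      · obtain ⟨w, rfl⟩ := hw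
        exact ⟨Sum.inl w, rfl⟩
      · have h5 := h1 w ((S.mem_iff w).2 hw)
        rw [← h, d.partner_partner] at h5
        exact absurd h5.symm (hne z)
    · by_cases hw : w ∈ Set.range S.ι
      · obtain ⟨w, rfl⟩ := hw
        exact ⟨Sum.inr w, rfl⟩
      · have h5 := h2 w ((S.mem_iff w).2 hw)
        rw [← h, d.partner_partner] at h5
        exact absurd h5.symm (hne z)
  choose f hf using hex
  refine ⟨⟨⟨f, fun z => hE ?_⟩, fun z hz => hne z ?_⟩, ?_⟩
  · rw [← hf, ← hf, d.partner_partner]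
  · rw [hf]
    exact congrArg _ hz
  · exact (S.eq_pad (fun z => hf z) h1 h2).symm

section Algebra

variable {𝕜 : Type u} [CommRing 𝕜] (δ : 𝕜) (δ' : 𝕜ˣ)

/-- The product of the elements `û_i` over the places in the image of `ι`. -/
noncomputable def hat : PartialBrauerAlgebra N δ (δ' : 𝕜) :=
  uHatList δ δ' ((List.finRange n).map S.ι)

/-- The idempotent which belongs to a choice of places. -/
noncomputable def idem : PartialBrauerAlgebra N δ (δ' : 𝕜) := cutList δ δ' S.s * S.hat δ δ'

theorem mem_map_ι (i : Fin n) : S.ι i ∈ (List.finRange n).map S.ι :=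
  List.mem_map.2 ⟨i, List.mem_finRange i, rfl⟩

theorem hat_mul_hat : S.hat δ δ' * S.hat δ δ' = S.hat δ δ' := uHatList_idem δ δ' _

theorem idem_eq : S.idem δ δ' = S.hat δ δ' * cutList δ δ' S.s := (cutList_commute δ δ' _ _).eq

theorem hat_mul_idem : S.hat δ δ' * S.idem δ δ' = S.idem δ δ' := by
  rw [idem_eq, ← mul_assoc, hat_mul_hat]

theorem idem_mul_hat : S.idem δ δ' * S.hat δ δ' = S.idem δ δ' := by
  rw [idem, mul_assoc, hat_mul_hat]

theorem isIdempotentElem_idem : IsIdempotentElem (S.idem δ δ') := by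
  rw [IsIdempotentElem]
  conv_lhs => enter [1]; rw [idem_eq]
  rw [idem, mul_assoc, ← mul_assoc (cutList δ δ' S.s), cutList_idem]
  exact S.hat_mul_idem δ δ'

theorem hat_mul_eq_zero {d : Diagram N} {i : Fin n}
    (h : d.partner (Sum.inl (S.ι i)) = Sum.inl (S.ι i)) :
    S.hat δ δ' * basis δ (δ' : 𝕜) d = 0 := uHatList_mul_of_fix δ δ' (S.mem_map_ι i) h

theorem mul_hat_eq_zero {d : Diagram N} {i : Fin n}
    (h : d.partner (Sum.inr (S.ι i)) = Sum.inr (S.ι i)) :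
    basis δ (δ' : 𝕜) d * S.hat δ δ' = 0 := mul_uHatList_of_fix δ δ' (S.mem_map_ι i) h

theorem idem_mul {d : Diagram N} (h : ∀ i ∈ S.s, d.partner (Sum.inl i) = Sum.inl i) :
    S.idem δ δ' * basis δ (δ' : 𝕜) d = S.hat δ δ' * basis δ (δ' : 𝕜) d := by
  rw [idem_eq, mul_assoc, cutList_mul δ δ' h]

theorem mul_idem {d : Diagram N} (h : ∀ i ∈ S.s, d.partner (Sum.inr i) = Sum.inr i) :
    basis δ (δ' : 𝕜) d * S.idem δ δ' = basis δ (δ' : 𝕜) d * S.hat δ δ' := by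
  rw [idem, ← mul_assoc, mul_cutList δ δ' h]

/-- The element of the corner that corresponds to a Brauer diagram. -/
noncomputable def lift (b : BrauerDiagram n) : PartialBrauerAlgebra N δ (δ' : 𝕜) :=
  ((δ'⁻¹ : 𝕜ˣ) : 𝕜) ^ S.s.length • (S.hat δ δ' * basis δ (δ' : 𝕜) (S.pad b.1) * S.hat δ δ')

/-- The linear map from the Brauer algebra to the corner. -/
noncomputable def liftLin : BrauerAlgebra n (δ - 1) →ₗ[𝕜] PartialBrauerAlgebra N δ (δ' : 𝕜) :=
  (Finsupp.linearCombination 𝕜 (S.lift δ δ') :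
    (BrauerDiagram n →₀ 𝕜) →ₗ[𝕜] PartialBrauerAlgebra N δ (δ' : 𝕜))

theorem liftLin_single (b : BrauerDiagram n) (r : 𝕜) :
    S.liftLin δ δ' (TwistedAlgebra.single _ b r) = r • S.lift δ δ' b :=
  Finsupp.linearCombination_single 𝕜 r b

/-- On the left, singletons outside of the image of `ι` belong to the padded diagram already, so
only those at the chosen places have to be killed by `q`. -/
theorem mul_hat_mul {Q : Type*} [AddCommGroup Q] [Module 𝕜 Q]
    (q : PartialBrauerAlgebra N δ (δ' : 𝕜) →ₗ[𝕜] Q) (b : BrauerDiagram n) {x : Diagram N}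
    (hx : S.Proper x)
    (hql : ∀ (y : Diagram N) (i : Fin n), y.partner (Sum.inl (S.ι i)) = Sum.inl (S.ι i) →
      q (basis δ (δ' : 𝕜) y) = 0)
    (hqr : ∀ (y : Diagram N) (i : Fin N), x.partner (Sum.inr i) ≠ Sum.inr i →
      y.partner (Sum.inr i) = Sum.inr i → q (basis δ (δ' : 𝕜) y) = 0) :
    q (basis δ (δ' : 𝕜) (S.pad b.1) * S.hat δ δ' * basis δ (δ' : 𝕜) x) =
      ((δ' : 𝕜) ^ S.s.length * (δ - 1) ^ loops (S.pad b.1) x) •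
        q (basis δ (δ' : 𝕜) (S.pad b.1 * x)) := by
  refine map_mul_uHatList_mul_eq δ δ' q S.s ((List.finRange n).map S.ι) S.finRange_eq _ _
    (fun i => S.pad_inr b.1) hx.1 (fun i hi => ?_) (fun i hi => ?_) (fun y i hi hy => ?_) hqr
  · obtain ⟨j, -, rfl⟩ := List.mem_map.1 hi
    exact S.pad_inr_ne b j
  · obtain ⟨j, -, rfl⟩ := List.mem_map.1 hi
    exact hx.2 j
  · by_cases h : i ∈ Set.range S.ι
    · obtain ⟨j, rfl⟩ := h
      exact hql y j hy
    · exact absurd (S.pad_inl b.1 ((S.mem_iff i).2 h)) hi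

theorem inv_pow_mul_pow (k : ℕ) : ((δ'⁻¹ : 𝕜ˣ) : 𝕜) ^ k * (δ' : 𝕜) ^ k = 1 := by
  rw [← mul_pow, Units.inv_mul, one_pow]

/-- The map `q` puts a hat on both sides, which kills new exterior singletons. The open strings at
the places of `s` give `δ'` to the power of the length of `s`, and this cancels one of the two
scaling factors. -/
theorem lift_mul_lift (b b' : BrauerDiagram n) : S.lift δ δ' b * S.lift δ δ' b' =
    (δ - 1) ^ loops b.1 b'.1 • S.lift δ δ' (b * b') := by
  let q : PartialBrauerAlgebra N δ (δ' : 𝕜) →ₗ[𝕜] PartialBrauerAlgebra N δ (δ' : 𝕜) :=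
    LinearMap.mulLeft 𝕜 (S.hat δ δ') ∘ₗ LinearMap.mulRight 𝕜 (S.hat δ δ')
  have hq : ∀ y, q y = S.hat δ δ' * (y * S.hat δ δ') := fun _ => rfl
  have h := S.mul_hat_mul δ δ' q b (S.proper_pad b')
    (fun y i hy => by rw [hq, ← mul_assoc, S.hat_mul_eq_zero δ δ' hy, zero_mul])
    (fun y i hi hy => by
      rw [hq]
      by_cases h : i ∈ Set.range S.ι
      · obtain ⟨j, rfl⟩ := h
        rw [S.mul_hat_eq_zero δ δ' hy, mul_zero]
      · exact absurd (S.pad_inr b'.1 ((S.mem_iff i).2 h)) hi)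
  obtain ⟨h1, h2⟩ := S.pad_mul b.1 b'.1
  rw [hq, hq, h1, h2] at h
  have h3 : S.hat δ δ' * basis δ (δ' : 𝕜) (S.pad b.1) * S.hat δ δ' *
      (S.hat δ δ' * basis δ (δ' : 𝕜) (S.pad b'.1) * S.hat δ δ') =
      S.hat δ δ' * (basis δ (δ' : 𝕜) (S.pad b.1) * S.hat δ δ' * basis δ (δ' : 𝕜) (S.pad b'.1) *
        S.hat δ δ') := by
    simp only [mul_assoc]
    rw [← mul_assoc (S.hat δ δ') (S.hat δ δ'), hat_mul_hat]
  rw [lift, lift, lift, smul_mul_smul_comm, h3, h, smul_smul, smul_smul, ← mul_assoc (S.hat δ δ')]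
  congr 1
  linear_combination (((δ'⁻¹ : 𝕜ˣ) : 𝕜) ^ S.s.length * (δ - 1) ^ loops b.1 b'.1) *
    inv_pow_mul_pow δ' S.s.length

theorem liftLin_mul (x y : BrauerAlgebra n (δ - 1)) :
    S.liftLin δ δ' (x * y) = S.liftLin δ δ' x * S.liftLin δ δ' y := by
  induction x using TwistedAlgebra.induction with
  | h0 => simp only [zero_mul, map_zero]
  | hadd x x' hx hx' => simp only [add_mul, map_add, hx, hx']
  | hs a r =>
    induction y using TwistedAlgebra.induction with
    | h0 => simp only [mul_zero, map_zero]
    | hadd y y' hy hy' => simp only [mul_add, map_add, hy, hy']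
    | hs b q =>
      rw [TwistedAlgebra.single_mul_single, liftLin_single, liftLin_single, liftLin_single,
        smul_mul_smul_comm, lift_mul_lift, smul_smul]
      rfl

theorem idem_mul_liftLin (x : BrauerAlgebra n (δ - 1)) :
    S.idem δ δ' * S.liftLin δ δ' x = S.liftLin δ δ' x := by
  induction x using TwistedAlgebra.induction with
  | h0 => simp only [mul_zero, map_zero]
  | hadd y y' hy hy' => simp only [mul_add, map_add, hy, hy']
  | hs b q =>
    rw [liftLin_single, mul_smul_comm, lift, mul_smul_comm, ← mul_assoc, ← mul_assoc, idem_mul_hat,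
      S.idem_mul δ δ' (fun i => S.pad_inl b.1)]

theorem liftLin_mul_idem (x : BrauerAlgebra n (δ - 1)) :
    S.liftLin δ δ' x * S.idem δ δ' = S.liftLin δ δ' x := by
  induction x using TwistedAlgebra.induction with
  | h0 => simp only [zero_mul, map_zero]
  | hadd y y' hy hy' => simp only [add_mul, map_add, hy, hy']
  | hs b q =>
    rw [liftLin_single, smul_mul_assoc, lift, smul_mul_assoc, mul_assoc, mul_assoc, hat_mul_idem,
      S.mul_idem δ δ' (fun i => S.pad_inr b.1), ← mul_assoc]

open Classical in
/-- The linear map which recovers a Brauer diagram. -/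
noncomputable def unpad : PartialBrauerAlgebra N δ (δ' : 𝕜) →ₗ[𝕜] BrauerAlgebra n (δ - 1) :=
  (Finsupp.linearCombination 𝕜 fun d : Diagram N =>
    if h : ∃ b : BrauerDiagram n, S.pad b.1 = d then
      TwistedAlgebra.single (brauerTwist n (δ - 1)) h.choose 1 else 0 :
    (Diagram N →₀ 𝕜) →ₗ[𝕜] BrauerAlgebra n (δ - 1))

theorem unpad_pad (b : BrauerDiagram n) :
    S.unpad δ δ' (basis δ (δ' : 𝕜) (S.pad b.1)) = TwistedAlgebra.single _ b 1 := by
  refine (Finsupp.linearCombination_single 𝕜 1 (S.pad b.1)).trans ?_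
  have h : ∃ b' : BrauerDiagram n, S.pad b'.1 = S.pad b.1 := ⟨b, rfl⟩
  rw [dif_pos h, one_smul, Subtype.ext (S.pad_injective h.choose_spec)]

theorem unpad_of_forall {d : Diagram N} (h : ∀ b : BrauerDiagram n, S.pad b.1 ≠ d) :
    S.unpad δ δ' (basis δ (δ' : 𝕜) d) = 0 := by
  refine (Finsupp.linearCombination_single 𝕜 1 d).trans ?_
  rw [dif_neg (fun ⟨b, hb⟩ => h b hb), smul_zero]

/-- Padded Brauer diagrams have no singletons at chosen places, so `unpad` vanishes on the
correction terms of the hats; up to the power of `δ'`, it is a left inverse. -/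
theorem liftLin_injective : Function.Injective (S.liftLin δ δ') := by
  have key : (((δ' : 𝕜) ^ S.s.length) • S.unpad δ δ') ∘ₗ S.liftLin δ δ' = LinearMap.id := by
    refine LinearMap.ext fun x => ?_
    induction x using TwistedAlgebra.induction with
    | h0 => simp only [map_zero]
    | hadd x x' hx hx' => simp only [map_add, hx, hx']
    | hs b r =>
      have h1 : S.unpad δ δ' (S.hat δ δ' * basis δ (δ' : 𝕜) (S.pad b.1) * S.hat δ δ') =
          TwistedAlgebra.single _ b 1 := by
        rw [hat, map_mul_uHatList, map_uHatList_mul, unpad_pad]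
        · intro i hi d hd
          obtain ⟨j, -, rfl⟩ := List.mem_map.1 hi
          refine S.unpad_of_forall δ δ' fun b' hb' => (S.proper_pad b').2 j (by rw [hb', hd])
        · intro i hi d hd
          obtain ⟨j, -, rfl⟩ := List.mem_map.1 hi
          refine S.unpad_of_forall δ δ' fun b' hb' => S.pad_inr_ne b' j (by rw [hb', hd])
      rw [LinearMap.comp_apply, liftLin_single, lift, LinearMap.smul_apply, map_smul, map_smul, h1,
        smul_smul, smul_smul, TwistedAlgebra.smul_single, LinearMap.id_apply]
      congr 1
      linear_combination r * inv_pow_mul_pow δ' S.s.length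
  exact Function.LeftInverse.injective (g := ((δ' : 𝕜) ^ S.s.length) • S.unpad δ δ')
    fun x => LinearMap.congr_fun key x

/-- In `e d e` the cuts replace `d` by a multiple of a diagram with singletons at all places of `s`
on both sides. A further singleton makes the hats kill it; without one, it is a padded Brauer
diagram. -/
theorem exists_liftLin (y : PartialBrauerAlgebra N δ (δ' : 𝕜)) :
    ∃ x, S.liftLin δ δ' x = S.idem δ δ' * y * S.idem δ δ' := by
  induction y using TwistedAlgebra.induction with
  | h0 => exact ⟨0, by rw [map_zero, mul_zero, zero_mul]⟩
  | hadd y y' hy hy' =>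
    obtain ⟨x, hx⟩ := hy
    obtain ⟨x', hx'⟩ := hy'
    exact ⟨x + x', by rw [map_add, hx, hx', mul_add, add_mul]⟩
  | hs d r =>
    have h0 : TwistedAlgebra.single (partialBrauerTwist N δ (δ' : 𝕜)) d r =
        r • basis δ (δ' : 𝕜) d := by
      rw [basis, TwistedAlgebra.smul_single, mul_one]
    obtain ⟨r₁, d₁, h1, h2⟩ := exists_cutList_mul δ δ' S.s d
    obtain ⟨r₂, d₂, h3, h4, h5⟩ := exists_mul_cutList δ δ' S.s d₁
    have h6 : S.idem δ δ' * TwistedAlgebra.single (partialBrauerTwist N δ (δ' : 𝕜)) d r *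
        S.idem δ δ' = (r * r₁ * r₂) • (S.hat δ δ' * basis δ (δ' : 𝕜) d₂ * S.hat δ δ') := by
      rw [h0, mul_smul_comm, smul_mul_assoc]
      conv_lhs => enter [2, 1]; rw [idem_eq, mul_assoc, h1, mul_smul_comm]
      rw [idem, smul_mul_assoc, mul_assoc (S.hat δ δ'), ← mul_assoc (basis δ (δ' : 𝕜) d₁), h3,
        smul_mul_assoc, mul_smul_comm, smul_smul, smul_smul, mul_assoc, mul_assoc]
    by_cases h7 : ∃ i, d₂.partner (Sum.inl (S.ι i)) = Sum.inl (S.ι i)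
    · obtain ⟨i, hi⟩ := h7
      exact ⟨0, by rw [h6, S.hat_mul_eq_zero δ δ' hi, zero_mul, smul_zero, map_zero]⟩
    by_cases h8 : ∃ i, d₂.partner (Sum.inr (S.ι i)) = Sum.inr (S.ι i)
    · obtain ⟨i, hi⟩ := h8
      exact ⟨0, by rw [h6, mul_assoc (S.hat δ δ'), S.mul_hat_eq_zero δ δ' hi, mul_zero, smul_zero, map_zero]⟩
    obtain ⟨b, rfl⟩ := S.exists_pad (fun i hi => h5 _ (h2 i hi)) h4 (fun i hi => h7 ⟨i, hi⟩)
      (fun i hi => h8 ⟨i, hi⟩)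
    refine ⟨TwistedAlgebra.single _ b (r * r₁ * r₂ * (δ' : 𝕜) ^ S.s.length), ?_⟩
    rw [h6, liftLin_single, lift, smul_smul]
    congr 1
    linear_combination (r * r₁ * r₂) * inv_pow_mul_pow δ' S.s.length

/-- The identification of the corner ring with the Brauer algebra. -/
theorem exists_cornerEquiv : ∃ γ : (S.isIdempotentElem_idem δ δ').Corner ≃+*
    BrauerAlgebra n (δ - 1), ∀ x, (γ.symm x).1 = S.liftLin δ δ' x := by
  set he := S.isIdempotentElem_idem δ δ'
  have hmem : ∀ x, S.liftLin δ δ' x ∈ Subsemigroup.corner (S.idem δ δ') := fun x =>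
    (Subsemigroup.mem_corner_iff he).2 ⟨S.idem_mul_liftLin δ δ' x, S.liftLin_mul_idem δ δ' x⟩
  let Θ : BrauerAlgebra n (δ - 1) →ₙ+* he.Corner :=
    { toFun := fun x => ⟨S.liftLin δ δ' x, hmem x⟩
      map_mul' := fun x y => Subtype.ext (S.liftLin_mul δ δ' x y)
      map_zero' := Subtype.ext (map_zero _)
      map_add' := fun x y => Subtype.ext (map_add _ x y) }
  have hΘ : Function.Bijective Θ := by
    refine ⟨fun x y h => S.liftLin_injective δ δ' (congrArg Subtype.val h), fun y => ?_⟩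
    obtain ⟨x, hx⟩ := S.exists_liftLin δ δ' y.1
    have hy := (Subsemigroup.mem_corner_iff he).1 y.2
    rw [hy.1, hy.2] at hx
    exact ⟨x, Subtype.ext hx⟩
  exact ⟨(RingEquiv.ofBijective Θ hΘ).symm, fun x => rfl⟩

end Algebra

end Places

theorem relabelRight_symm {n : ℕ} (d : Diagram n) (τ : Equiv.Perm (Fin n)) :
    (d.relabelRight τ.symm).relabelRight τ.symm.symm = d := by
  refine Diagram.ext (funext fun z => ?_)
  have h : ∀ y : Fin n ⊕ Fin n, Sum.map id τ (Sum.map id τ.symm y) = y := by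
    rintro (y | y) <;> simp
  simp only [Diagram.relabelRight, Equiv.symm_symm, h]

/-! ### The two choices of places, and transport of diagrams between left cells -/

/-- All places. -/
def allPlaces (n : ℕ) : Places n n := ⟨id, [], by simp⟩

theorem allPlaces_pad {n : ℕ} (b : Diagram n) : (allPlaces n).pad b = b :=
  ((allPlaces n).eq_pad (fun z => by simp [allPlaces]) (by simp [allPlaces])
    (by simp [allPlaces])).symm

/-- All places but the first. -/
def succPlaces (n : ℕ) : Places n (n + 1) := ⟨Fin.succ, [0], by rw [List.finRange_succ]; rfl⟩

theorem succPlaces_pad {n : ℕ} (b : Diagram n) : (succPlaces n).pad b = addCut b :=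
  ((succPlaces n).eq_pad (fun z => by
      rcases z with z | z <;> simp [succPlaces, addCut])
    (by simp [succPlaces, addCut]) (by simp [succPlaces, addCut])).symm

namespace LeftCell

variable {n k : ℕ} (M : LeftCell n) (hM : M.propNumber = k)

theorem exists_half_of_brauer (y : M.brauer) :
    ∃ h : HalfDiagram n k, M.ofHalf hM (allPlaces n) h = y.1.1 :=
  M.exists_half hM (allPlaces n) y.2 ⟨by simp [allPlaces], fun i => y.1.2 _⟩

/-- The left side of a Brauer diagram. -/
noncomputable def half (y : M.brauer) : HalfDiagram n k := (M.exists_half_of_brauer hM y).choose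

theorem ofHalf_half (y : M.brauer) : M.ofHalf hM (allPlaces n) (M.half hM y) = y.1.1 :=
  (M.exists_half_of_brauer hM y).choose_spec

theorem half_injective : Function.Injective (M.half hM) := by
  intro y z h
  refine Subtype.ext (Subtype.ext ?_)
  rw [← M.ofHalf_half hM y, ← M.ofHalf_half hM z, h]

/-- A half diagram never produces singletons on the left or at right ends. The remaining right parts
are common to the cell, and one Brauer diagram in it shows that they contain no singletons either.
-/
theorem half_surjective (hne : M.brauer.Nonempty) : Function.Surjective (M.half hM) := by
  intro h
  obtain ⟨b, hb⟩ := hne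
  have hbr : M.ofHalf hM (allPlaces n) h ∈ brauerSubmonoid n := by
    rintro (i | j) hz
    · exact (M.ofHalf_proper hM (allPlaces n) h).2 i hz
    · by_cases hj : j ∈ M.rightEnds
      · obtain ⟨i, hi⟩ := (M.mem_rightEnds j).1 hj _ (M.ofHalf_mem hM (allPlaces n) h)
        exact Sum.inr_ne_inl (hz.symm.trans hi)
      · rw [M.ofHalf_inr hM (allPlaces n) h hj] at hz
        exact b.2 (Sum.inr j) ((M.partner_inr_of_not_mem hb hj).trans hz)
  refine ⟨⟨⟨_, hbr⟩, M.ofHalf_mem hM (allPlaces n) h⟩, M.ofHalf_injective hM (allPlaces n) ?_⟩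
  rw [ofHalf_half]

theorem half_act (y : M.brauer) (σ : Equiv.Perm (Fin k)) :
    M.half hM (M.brauerAct hM y σ) = (M.half hM y).act σ := by
  apply M.ofHalf_injective hM (allPlaces n)
  rw [ofHalf_half, ← ofHalf_act, ofHalf_half]
  rfl

/-- The diagram in `L` with the same left side as a Brauer diagram in `M`, up to additional
singletons. -/
noncomputable def transport {N : ℕ} (S : Places n N) (L : LeftCell N) (hL : L.propNumber = k)
    (y : M.brauer) : L.carrier :=
  ⟨L.ofHalf hL S (M.half hM y), L.ofHalf_mem hL S _⟩

variable {N : ℕ} (S : Places n N) (L : LeftCell N) (hL : L.propNumber = k)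

theorem transport_injective : Function.Injective (M.transport hM S L hL) :=
  fun _ _ h => M.half_injective hM (L.ofHalf_injective hL S (congrArg Subtype.val h))

theorem transport_act (y : M.brauer) (σ : Equiv.Perm (Fin k)) :
    M.transport hM S L hL (M.brauerAct hM y σ) = L.act hL (M.transport hM S L hL y) σ := by
  refine Subtype.ext ?_
  change L.ofHalf hL S (M.half hM (M.brauerAct hM y σ)) = _
  rw [half_act, ← ofHalf_act]
  rfl

theorem mem_range_transport (hne : M.brauer.Nonempty) (x : L.carrier) :
    x ∈ Set.range (M.transport hM S L hL) ↔ S.Proper x.1 := by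
  constructor
  · rintro ⟨y, rfl⟩
    exact L.ofHalf_proper hL S _
  · intro hx
    obtain ⟨h, hh⟩ := L.exists_half hL S x.2 hx
    obtain ⟨y, rfl⟩ := M.half_surjective hM hne h
    exact ⟨y, Subtype.ext hh⟩

/-- Multiplication on the left does not see how the right vertices are labelled. -/
theorem act_compatible {𝕜 : Type u} [CommRing 𝕜] (η η' : 𝕜) :
    ActCompatible (partialBrauerTwist N η η') L.carrier (L.act hL) where
  mem a x σ := by
    change a * x.1.relabelRight _ ∈ _ ↔ _
    rw [(mul_relabelRight _ _ _).1]
    refine ⟨fun h => ?_, fun h => L.relabel_mem hL σ _ h⟩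
    -- The converse of stability of the cell under `σ`, by its stability under the inverse.
    have h1 := L.relabel_mem hL σ⁻¹ _ h
    have h2 : L.endPerm hL σ⁻¹ = (L.endPerm hL σ).symm :=
      (Equiv.Perm.extendDomain_inv _ _).symm
    rwa [h2, relabelRight_symm] at h1
  mul a x σ h := (mul_relabelRight _ _ _).1
  twist a x σ := by
    obtain ⟨-, h1, h2⟩ := mul_relabelRight a x.1 (L.endPerm hL σ).symm
    change η ^ loops a (x.1.relabelRight _) * η' ^ strings a (x.1.relabelRight _) = _
    rw [h1, h2]
    rfl

end LeftCell

/-! ### The corner functor on the cell modules and Specht modules of a left cell -/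

namespace Places

variable {n N k : ℕ} (S : Places n N) {𝕜 : Type u} [CommRing 𝕜] (δ : 𝕜) (δ' : 𝕜ˣ)
  (L : LeftCell N)

theorem cellProj_basis (x : L.carrier) :
    cellProj (partialBrauerTwist N δ (δ' : 𝕜)) L.carrier (basis δ (δ' : 𝕜) x.1) =
      CellModule.single _ x 1 := cellProj_single _ _ x 1

theorem idem_smul_single {x : L.carrier} (hx : S.Proper x.1) :
    S.idem δ δ' • CellModule.single (partialBrauerTwist N δ (δ' : 𝕜)) x 1 =
      S.hat δ δ' • CellModule.single (partialBrauerTwist N δ (δ' : 𝕜)) x 1 := by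
  rw [smul_single_eq_cellProj, smul_single_eq_cellProj]
  exact congrArg _ (S.idem_mul δ δ' hx.1)

/-- The cuts turn `x` into a multiple of a diagram `d` with singletons on the left at the places of
`s`. It leaves the cell, or is proper, or has another singleton on the left, which a hat kills. -/
theorem idem_smul_single_cases (x : L.carrier) :
    S.idem δ δ' • CellModule.single (partialBrauerTwist N δ (δ' : 𝕜)) x 1 = 0 ∨
    ∃ (r : 𝕜) (x' : L.carrier), S.Proper x'.1 ∧
      S.idem δ δ' • CellModule.single (partialBrauerTwist N δ (δ' : 𝕜)) x 1 =
        r • S.idem δ δ' • CellModule.single (partialBrauerTwist N δ (δ' : 𝕜)) x' 1 := by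
  obtain ⟨r, d, h1, h2⟩ := exists_cutList_mul δ δ' S.s x.1
  have h3 : S.idem δ δ' • CellModule.single (partialBrauerTwist N δ (δ' : 𝕜)) x 1 =
      r • S.hat δ δ' • cellProj (partialBrauerTwist N δ (δ' : 𝕜)) L.carrier
        (basis δ (δ' : 𝕜) d) := by
    have h0 : cutList δ δ' S.s • CellModule.single (partialBrauerTwist N δ (δ' : 𝕜)) x 1 =
        r • cellProj (partialBrauerTwist N δ (δ' : 𝕜)) L.carrier (basis δ (δ' : 𝕜) d) := by
      rw [smul_single_eq_cellProj]
      exact (congrArg _ h1).trans (LinearMap.map_smul _ _ _)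
    rw [idem_eq, mul_smul, h0, smul_comm]
  by_cases hd : d ∈ L.carrier
  · have h4 := cellProj_basis δ δ' L ⟨d, hd⟩
    by_cases hp : S.Proper d
    · refine Or.inr ⟨r, ⟨d, hd⟩, hp, ?_⟩
      rw [h3, h4, S.idem_smul_single δ δ' L hp]
    · have h5 : ∃ i, d.partner (Sum.inl (S.ι i)) = Sum.inl (S.ι i) := by
        by_contra h
        push Not at h
        exact hp ⟨h2, h⟩
      obtain ⟨i, hi⟩ := h5
      left
      rw [h3, h4, smul_single_eq_cellProj]
      have h6 := S.hat_mul_eq_zero δ δ' hi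
      rw [basis] at h6
      rw [h6, map_zero, smul_zero]
  · left
    rw [h3, basis, cellProj_single_of_not_mem _ _ hd, smul_zero, smul_zero]

/-- A nonzero value requires a proper diagram in the cell, hence a perfect matching of an odd number
of points. -/
theorem idem_smul_single_eq_zero (h : Odd (n + L.propNumber)) (x : L.carrier) :
    S.idem δ δ' • CellModule.single (partialBrauerTwist N δ (δ' : 𝕜)) x 1 = 0 := by
  rcases S.idem_smul_single_cases δ δ' L x with h1 | ⟨r, x', h1, -⟩
  · exact h1
  · obtain ⟨y, -⟩ := L.exists_half rfl S x'.2 h1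
    exact absurd y.even (Nat.not_even_iff_odd.2 h)

/-- For `onto_into`, the corrections in `û x` have singletons on the left at chosen places, so they
are improper and the projection drops them. For `semi`, the product rule with hats reduces the
action to a product of diagrams, which is the same step of half diagrams in both cells. -/
theorem cellTransfer (hL : L.propNumber = k) (M : LeftCell n) (hM : M.propNumber = k)
    (hne : M.brauer.Nonempty)
    (γ : (S.isIdempotentElem_idem δ δ').Corner ≃+* BrauerAlgebra n (δ - 1))
    (hγ : ∀ x, (γ.symm x).1 = S.liftLin δ δ' x) :
    CellTransfer (t₁ := partialBrauerTwist N δ (δ' : 𝕜)) (t₂ := brauerTwist n (δ - 1))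
      (S.isIdempotentElem_idem δ δ') γ (M.transport hM S L hL) where
  injective := M.transport_injective hM S L hL
  onto_into y := by
    rw [S.idem_smul_single δ δ' L (L.ofHalf_proper hL S _), smul_single_eq_cellProj,
      ← LinearMap.comp_apply, hat, map_uHatList_mul, LinearMap.comp_apply,
      cellProj_single, cellOnto_single (M.transport_injective hM S L hL)]
    intro i hi d hd
    obtain ⟨j, -, rfl⟩ := List.mem_map.1 hi
    rw [LinearMap.comp_apply]
    by_cases h : d ∈ L.carrier
    · rw [cellProj_basis δ δ' L ⟨d, h⟩, cellOnto_single_of_not_mem]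
      rw [M.mem_range_transport hM S L hL hne]
      exact fun hp => hp.2 j hd
    · rw [basis, cellProj_single_of_not_mem _ _ h, map_zero]
  range x := by
    rcases S.idem_smul_single_cases δ δ' L x with h | ⟨r, x', h1, h2⟩
    · exact Or.inl h
    · obtain ⟨y, rfl⟩ := (M.mem_range_transport hM S L hL hne x').2 h1
      exact Or.inr ⟨r, y, h2⟩
  smul r b := by rw [hγ, hγ, map_smul]
  semi b y := by
    set x := M.transport hM S L hL y with hx
    have hp : S.Proper x.1 := L.ofHalf_proper hL S _
    let q : PartialBrauerAlgebra N δ (δ' : 𝕜) →ₗ[𝕜]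
        CellModule (partialBrauerTwist N δ (δ' : 𝕜)) L.carrier :=
      CellModule.actLin _ L.carrier (S.hat δ δ') ∘ₗ cellProj _ L.carrier
    have hq : ∀ z, q z = S.hat δ δ' • cellProj _ L.carrier z := fun _ => rfl
    have hproj : ∀ d : Diagram N, d ∉ L.carrier →
        cellProj (partialBrauerTwist N δ (δ' : 𝕜)) L.carrier (basis δ (δ' : 𝕜) d) = 0 :=
      fun d hd => cellProj_single_of_not_mem _ _ hd 1
    have h1 := S.mul_hat_mul δ δ' q b hp
      (fun d i hd => by
        rw [hq]
        by_cases h : d ∈ L.carrier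
        · rw [cellProj_basis δ δ' L ⟨d, h⟩, smul_single_eq_cellProj]
          have h6 := S.hat_mul_eq_zero δ δ' hd
          rw [basis] at h6
          rw [h6, map_zero]
        · rw [hproj d h, smul_zero])
      -- A new singleton on the right changes the right parts, so such a diagram is outside of the
      -- left cell and is zero in the module.
      (fun d i hi hd => by
        rw [hq, hproj d, smul_zero]
        intro h
        rw [L.mem_iff] at h
        exact hi (((L.mem_iff _).1 x.2 i i).2 ((h i i).1 hd)))
    have h2 : S.liftLin δ δ' (TwistedAlgebra.single _ b 1) •
        S.idem δ δ' • CellModule.single (partialBrauerTwist N δ (δ' : 𝕜)) x 1 =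
        ((δ - 1) ^ loops (S.pad b.1) x.1) • q (basis δ (δ' : 𝕜) (S.pad b.1 * x.1)) := by
      have h3 : q (basis δ (δ' : 𝕜) (S.pad b.1) * S.hat δ δ' * basis δ (δ' : 𝕜) x.1) =
          (S.hat δ δ' * basis δ (δ' : 𝕜) (S.pad b.1) * S.hat δ δ') •
            CellModule.single (partialBrauerTwist N δ (δ' : 𝕜)) x 1 := by
        rw [hq, mul_assoc (S.hat δ δ'), mul_smul, smul_single_eq_cellProj]
        rfl
      rw [S.idem_smul_single δ δ' L hp, liftLin_single, one_smul, lift, smul_assoc, ← mul_smul,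
        mul_assoc, hat_mul_hat, ← h3, h1, smul_smul]
      congr 1
      linear_combination ((δ - 1) ^ loops (S.pad b.1) x.1) * inv_pow_mul_pow δ' S.s.length
    rw [hγ, h2, CellModule.basisAct]
    -- Both sides are the number of loops of the same half juxtaposition.
    have h4 : loops (S.pad b.1) x.1 = loops b.1 y.1.1 := by
      rw [hx, LeftCell.transport, L.loops_pad_ofHalf hL S,
        ← M.loops_pad_ofHalf hM (allPlaces n), allPlaces_pad, M.ofHalf_half]
    have h5 := allPlaces_pad b.1
    by_cases hy : b * y.1 ∈ M.brauer
    · have hy' : (allPlaces n).pad b.1 * M.ofHalf hM (allPlaces n) (M.half hM y) ∈ M.carrier := by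
        rw [h5, M.ofHalf_half]
        exact hy
      obtain ⟨h', hstep⟩ := M.exists_step hM (allPlaces n) hy'
      have h6 : M.half hM ⟨b * y.1, hy⟩ = h' := by
        apply M.ofHalf_injective hM (allPlaces n)
        rw [M.ofHalf_half, ← M.pad_mul_ofHalf_of_step hM (allPlaces n) hstep, h5, M.ofHalf_half]
        rfl
      have h7 : S.pad b.1 * x.1 = (M.transport hM S L hL ⟨b * y.1, hy⟩).1 := by
        change _ = L.ofHalf hL S (M.half hM ⟨b * y.1, hy⟩)
        rw [h6]
        exact L.pad_mul_ofHalf_of_step hL S hstep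
      have h8 : CellModule.single (brauerTwist n (δ - 1)) (⟨b * y.1, hy⟩ : M.brauer)
          ((brauerTwist n (δ - 1)).toFun b y.1) =
          (δ - 1) ^ loops b.1 y.1.1 • CellModule.single (brauerTwist n (δ - 1)) ⟨b * y.1, hy⟩ 1 := by
        rw [CellModule.smul_single, mul_one]
        rfl
      rw [dif_pos hy, h8, map_smul, cellInto_single, h4, h7, hq, cellProj_basis,
        S.idem_smul_single δ δ' L (L.ofHalf_proper hL S _)]
    -- If the product stayed in `L`, there would be a step, and this step would keep the product in
    -- `M` too.
    · rw [dif_neg hy, map_zero, hq, hproj, smul_zero, smul_zero]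
      intro h
      obtain ⟨h', hstep⟩ := L.exists_step hL S h
      refine hy ?_
      have h6 := M.pad_mul_ofHalf_of_step hM (allPlaces n) hstep
      rw [h5, M.ofHalf_half] at h6
      change b.1 * y.1.1 ∈ M.carrier
      rw [h6]
      exact M.ofHalf_mem hM (allPlaces n) h'

/-- The corner functor of the idempotent of `S`, on cell modules and Specht modules. -/
theorem functor_spec (e : PartialBrauerAlgebra N δ (δ' : 𝕜)) (hE : e = S.idem δ δ') :
    ∃ (he : IsIdempotentElem e) (γ : he.Corner ≃+* BrauerAlgebra n (δ - 1)),
      (∀ (r : 𝕜) (b : BrauerDiagram n),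
        (γ.symm (r • brauerBasis (δ - 1) b)).1 = r • S.lift δ δ' b) ∧
      (∀ L : LeftCell N,
        (∀ M : LeftCell n, M.propNumber = L.propNumber → M.brauer.Nonempty →
          Nonempty ((moritaFunctor he γ).obj (cellObj δ (δ' : 𝕜) L) ≅
            brauerCellObj (δ - 1) M)) ∧
        (Odd (n + L.propNumber) →
          Limits.IsZero ((moritaFunctor he γ).obj (cellObj δ (δ' : 𝕜) L)))) ∧
      (∀ (μ : YoungDiagram) (L : LeftCell N) (hL : L.propNumber = μ.card),
        (∀ (M : LeftCell n) (hM : M.propNumber = μ.card), M.brauer.Nonempty →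
            Nonempty ((moritaFunctor he γ).obj (spechtObj δ (δ' : 𝕜) L μ hL) ≅
              brauerSpechtObj (δ - 1) M μ hM)) ∧
        (Odd (n + μ.card) →
          Limits.IsZero ((moritaFunctor he γ).obj (spechtObj δ (δ' : 𝕜) L μ hL)))) := by
  subst hE
  obtain ⟨γ, hγ⟩ := S.exists_cornerEquiv δ δ'
  refine ⟨S.isIdempotentElem_idem δ δ', γ, fun r b => ?_, fun L => ⟨fun M hM hne => ?_, fun h => ?_⟩,
    fun μ L hL => ⟨fun M hM hne => ?_, fun h => ?_⟩⟩
  · rw [hγ, map_smul, brauerBasis, liftLin_single, one_smul]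
  · exact (S.cellTransfer δ δ' L rfl M hM hne γ hγ).cell_iso
  · exact moritaFunctor_isZero _ _ _
      (smul_cellModule_eq_zero (S.idem_smul_single_eq_zero δ δ' L h))
  · refine (S.cellTransfer δ δ' L hL M hM hne γ hγ).tensor_iso (spechtRep 𝕜 μ)
      (M.transport_act hM S L hL) (fun x σ h => ?_) (L.act_compatible hL δ (δ' : 𝕜))
    rw [M.mem_range_transport hM S L hL hne] at h ⊢
    exact (LeftCell.proper_relabelRight S x.1 _).1 h
  · rw [← hL] at h
    exact moritaFunctor_isZero _ _ _
      (smul_cellTensor_eq_zero (S.idem_smul_single_eq_zero δ δ' L h) _ _)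

end Places

/-! ### Recovering `û_n`, `e_ω` and the decorated diagrams -/

section Idempotents

variable {𝕜 : Type u} [CommRing 𝕜] (n : ℕ) (δ : 𝕜) (δ' : 𝕜ˣ)

theorem uHatAll_eq : uHatAll n δ δ' = (allPlaces n).hat δ δ' := by
  simp [uHatAll, uHatProd, Places.hat, uHatList, allPlaces]

theorem uHatAll_eq_idem : uHatAll n δ δ' = (allPlaces n).idem δ δ' := by
  rw [uHatAll_eq, Places.idem]
  simp [allPlaces, cutList]

theorem decorated_eq_lift {n : ℕ} (b : BrauerDiagram n) :
    decorated δ δ' b.1 = (allPlaces n).lift δ δ' b := by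
  have h1 : b.1.leftNonsingletons = Finset.univ := by
    simpa [Diagram.leftNonsingletons, Finset.filter_eq_self] using fun i => b.2 (Sum.inl i)
  have h2 : b.1.rightNonsingletons = Finset.univ := by
    simpa [Diagram.rightNonsingletons, Finset.filter_eq_self] using fun i => b.2 (Sum.inr i)
  have h3 : uHatProd δ δ' Finset.univ = (allPlaces n).hat δ δ' := uHatAll_eq n δ δ'
  rw [decorated, h1, h2, h3, Places.lift, allPlaces_pad]
  simp [allPlaces]

theorem uHatProd_succ (X : Finset (Fin (n + 1))) (h0 : 0 ∉ X) (h : ∀ i : Fin n, i.succ ∈ X) :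
    uHatProd δ δ' X = (succPlaces n).hat δ δ' := by
  rw [uHatProd, List.finRange_succ, List.map_cons, List.prod_cons, if_neg h0, one_mul, List.map_map,
    Places.hat, uHatList, List.map_map]
  refine congrArg List.prod (List.map_congr_left fun i _ => ?_)
  simp [h, succPlaces]

/-- In `ω` the hats stand on both sides of `u_1`; they commute with it and are idempotent, so one
copy is enough. -/
theorem omega_eq_idem :
    ((δ'⁻¹ : 𝕜ˣ) : 𝕜) • omega n δ δ' = (succPlaces n).idem δ δ' := by
  rw [omega, decorated, uHatProd_succ, uHatProd_succ, Places.idem]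
  · have h1 : cutList δ δ' (succPlaces n).s =
        ((δ'⁻¹ : 𝕜ˣ) : 𝕜) • basis δ (δ' : 𝕜) (cutDiagram 0) := by
      simp [cutList, succPlaces]
    have h2 : Commute (basis δ (δ' : 𝕜) (cutDiagram 0)) ((succPlaces n).hat δ δ') :=
      cutDiagram_commute_list δ δ' _ _
    rw [h1, smul_mul_assoc, ← h2.eq, mul_assoc, Places.hat_mul_hat]
  all_goals simp [Diagram.leftNonsingletons, Diagram.rightNonsingletons, cutDiagram]

/-- The single factor `δ'⁻¹` is the scaling in `lift`, as there is just one place in `s`. -/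
theorem decorated_addCut_eq_lift {n : ℕ} (b : BrauerDiagram n) :
    ((δ'⁻¹ : 𝕜ˣ) : 𝕜) • decorated δ δ' (addCut b.1) = (succPlaces n).lift δ δ' b := by
  have h1 := (succPlaces n).proper_pad b
  have h2 := (succPlaces n).pad_inr_ne b
  rw [succPlaces_pad] at h1 h2
  rw [decorated, uHatProd_succ, uHatProd_succ, Places.lift, succPlaces_pad]
  · simp [succPlaces]
  · exact fun h => (Finset.mem_filter.1 h).2 rfl
  · exact fun i => Finset.mem_filter.2 ⟨Finset.mem_univ _, h2 i⟩
  · exact fun h => (Finset.mem_filter.1 h).2 rfl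
  · exact fun i => Finset.mem_filter.2 ⟨Finset.mem_univ _, h1.2 i⟩

end Idempotents

theorem LeftCell.propNumber_le {n : ℕ} (L : LeftCell n) : L.propNumber ≤ n := by
  simpa [LeftCell.propNumber] using Finset.card_le_univ L.rightEnds

end PartialBrauer

theorem proposition12 {𝕜 : Type u} [CommRing 𝕜] (δ : 𝕜) (δ' : 𝕜ˣ) (n : ℕ) :
    -- the functor `F`, for the algebra of rank `n`
    (∃ (he : IsIdempotentElem (uHatAll n δ δ')) (γ : he.Corner ≃+* BrauerAlgebra n (δ - 1)),
      (∀ (r : 𝕜) (b : BrauerDiagram n),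
        (γ.symm (r • brauerBasis (δ - 1) b)).1 = r • decorated δ δ' b.1) ∧
      (∀ L : LeftCell n,
        (∀ M : LeftCell n, M.propNumber = L.propNumber → M.brauer.Nonempty →
          Nonempty ((moritaFunctor he γ).obj (cellObj δ (δ' : 𝕜) L) ≅
            brauerCellObj (δ - 1) M)) ∧
        (Odd (n + L.propNumber) →
          Limits.IsZero ((moritaFunctor he γ).obj (cellObj δ (δ' : 𝕜) L)))) ∧
      (∀ (μ : YoungDiagram) (L : LeftCell n) (hL : L.propNumber = μ.card),
        (Even (n + μ.card) →
          (∃ M : LeftCell n, M.propNumber = μ.card ∧ M.brauer.Nonempty) ∧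
          ∀ (M : LeftCell n) (hM : M.propNumber = μ.card), M.brauer.Nonempty →
            Nonempty ((moritaFunctor he γ).obj (spechtObj δ (δ' : 𝕜) L μ hL) ≅
              brauerSpechtObj (δ - 1) M μ hM)) ∧
        (Odd (n + μ.card) →
          Limits.IsZero ((moritaFunctor he γ).obj (spechtObj δ (δ' : 𝕜) L μ hL))))) ∧
    -- the functor `F_ω`, for the algebra of rank `n + 1`; the idempotent `δ'⁻¹ ω` generates the
    -- same left ideal as `ω`
    (∃ (he : IsIdempotentElem (((δ'⁻¹ : 𝕜ˣ) : 𝕜) • omega n δ δ'))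
      (γ : he.Corner ≃+* BrauerAlgebra n (δ - 1)),
      (∀ (r : 𝕜) (b : BrauerDiagram n),
        (γ.symm (r • brauerBasis (δ - 1) b)).1 =
          r • (((δ'⁻¹ : 𝕜ˣ) : 𝕜) • decorated δ δ' (addCut b.1))) ∧
      (∀ L : LeftCell (n + 1),
        (∀ M : LeftCell n, M.propNumber = L.propNumber → M.brauer.Nonempty →
          Nonempty ((moritaFunctor he γ).obj (cellObj δ (δ' : 𝕜) L) ≅
            brauerCellObj (δ - 1) M)) ∧
        (Even (n + 1 + L.propNumber) →
          Limits.IsZero ((moritaFunctor he γ).obj (cellObj δ (δ' : 𝕜) L)))) ∧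
      (∀ (μ : YoungDiagram) (L : LeftCell (n + 1)) (hL : L.propNumber = μ.card),
        (Odd (n + 1 + μ.card) →
          (∃ M : LeftCell n, M.propNumber = μ.card ∧ M.brauer.Nonempty) ∧
          ∀ (M : LeftCell n) (hM : M.propNumber = μ.card), M.brauer.Nonempty →
            Nonempty ((moritaFunctor he γ).obj (spechtObj δ (δ' : 𝕜) L μ hL) ≅
              brauerSpechtObj (δ - 1) M μ hM)) ∧
        (Even (n + 1 + μ.card) →
          Limits.IsZero ((moritaFunctor he γ).obj (spechtObj δ (δ' : 𝕜) L μ hL))))) := by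
  refine ⟨?_, ?_⟩
  · obtain ⟨he, γ, h1, h2, h3⟩ := (allPlaces n).functor_spec δ δ' _ (uHatAll_eq_idem n δ δ')
    refine ⟨he, γ, fun r b => by rw [h1, decorated_eq_lift], h2, fun μ L hL => ⟨fun h =>
      ⟨exists_brauer_cell (hL ▸ L.propNumber_le) h, (h3 μ L hL).1⟩, (h3 μ L hL).2⟩⟩
  · obtain ⟨he, γ, h1, h2, h3⟩ := (succPlaces n).functor_spec δ δ' _ (omega_eq_idem n δ δ')
    refine ⟨he, γ, fun r b => by rw [h1, decorated_addCut_eq_lift],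
      fun L => ⟨(h2 L).1, fun h => (h2 L).2 (by grind)⟩, fun μ L hL => ⟨fun h => ⟨?_, (h3 μ L hL).1⟩,
      fun h => (h3 μ L hL).2 (by grind)⟩⟩
    -- This gives only `k ≤ n + 1`; the case `k = n + 1` is excluded because `n + 1 + k` is odd.
    have hle := L.propNumber_le
    rw [hL] at hle
    exact exists_brauer_cell (by grind) (by grind)
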